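/- Let $\mathcal C$ be a modular tensor category: an abelian, semisimple, finite $\mathbb C$-linear ribbon category with simple tensor unit $\mathbf 1$, with representatives $U_i$ ($i\in I$, $I$ finite) of the isomorphism classes of simple objects, such that the matrix $s_{i,j}$ of traces of the double braiding of $U_i$ and $U_j$ is invertible. Write $c$ for the braiding, $\theta$ for the twist, $d_X:X^\vee\otimes X\to\mathbf 1$, $b_X:\mathbf 1\to X\otimes X^\vee$, $\tilde d_X:X\otimes X^\vee\to\mathbf 1$, $\tilde b_X:\mathbf 1\to X^\vee\otimes X$ for the duality morphisms, $\dim X=\tilde d_X\circ b_X\in\mathbb C$ and $\mathrm{Dim}\,\mathcal C=\sum_{i\in I}(\dim U_i)^2$; associators are suppressed. Let $\mathcal C_+\boxtimes\mathcal C_-$ be the ribbon category whose objects are finite direct sums of pairs $V\times W$ of objects of $\mathcal C$, with $\mathrm{Hom}(V\times W,V'\times W')=\mathrm{Hom}(V,V')\otimes_{\mathbb C}\mathrm{Hom}(W,W')$, the componentwise tensor product and duals, braiding $c\times c^{-1}$ and twist $\theta\times\theta^{-1}$. *Frobenius algebras.* A Frobenius algebra $(A,m,\eta,\Delta,\varepsilon)$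 is an object that is an associative unital algebra and a coassociative counital coalgebra such that $(\mathrm{id}\otimes m)\circ(\Delta\otimes\mathrm{id})=\Delta\circ m=(m\otimes\mathrm{id})\circ(\mathrm{id}\otimes\Delta)$. It is *commutative* if $m\circ c_{A,A}=m$; *symmetric* if $((\varepsilon\circ m)\otimes\mathrm{id}_{A^\vee})\circ(\mathrm{id}_A\otimes b_A)=(\mathrm{id}_{A^\vee}\otimes(\varepsilon\circ m))\circ(\tilde b_A\otimes\mathrm{id}_A)$; *simple* if it is simple as a bimodule over itself; *special* if $m\circ\Delta=\zeta\,\mathrm{id}_A$ and $\varepsilon\circ\eta=\xi\,\mathrm{id}_{\mathbf 1}$ with $\zeta,\xi\in\mathbb C\setminus\{0\}$. For Frobenius algebras $A,B$ and $f:A\to B$ put $$f^*=((\varepsilon_B\circ m_B)\otimes\mathrm{id}_A)\circ(\mathrm{id}_B\otimes f\otimes\mathrm{id}_A)\circ(\mathrm{id}_B\otimes(\Delta_A\circ\eta_A)):B\to A,$$ and for a Frobenius algebra $A$ put $$P^l_A=(d_A\otimes\mathrm{id}_A)\circ(\mathrm{id}_{A^\vee}\otimes c_{A,A})\circ(\mathrm{id}_{A^\vee}\otimes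 m\otimes\mathrm{id}_A)\circ(\tilde b_A\otimes\Delta):A\to A.$$ *The functor $R$.* Let $T:\mathcal C_+\boxtimes\mathcal C_-\to\mathcal C$, $T(\bigoplus_n V_n\times W_n)=\bigoplus_n V_n\otimes W_n$, with the tensor structure $\phi^T_2=\mathrm{id}_U\otimes c_{W,V}^{-1}\otimes\mathrm{id}_X: T(U\times V)\otimes T(W\times X)\to T((U\times V)\otimes(W\times X))$. Let $R:\mathcal C\to\mathcal C_+\boxtimes\mathcal C_-$, $R(A)=\bigoplus_{i\in I}(A\otimes U_i^\vee)\times U_i$, $R(f)=\bigoplus_i(f\otimes\mathrm{id})\times\mathrm{id}$. The functor $R$ is right adjoint to $T$ with counit $\hat\rho_A=\bigoplus_i \mathrm{id}_A\otimes d_{U_i}$ and unit $\hat\delta_{V\times W}=\bigoplus_i\sum_\alpha\big[(\mathrm{id}_V\otimes\alpha^*\otimes\mathrm{id})\circ(\mathrm{id}_V\otimes b_{U_i})\big]\times\alpha$, where $\alpha$ runs over a basis of $\mathrm{Hom}(W,U_i)$ and $\alpha^*$ over the dual basis of $\mathrm{Hom}(U_i,W)$, $\alpha\circ\beta^*=\delta_{\alpha\beta}\,\mathrm{id}$;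 and it is left adjoint to $T$ with unit $\check\delta_A=\bigoplus_i\frac{\dim U_i}{\mathrm{Dim}\,\mathcal C}\,\mathrm{id}_A\otimes\tilde b_{U_i}$ and counit $\check\rho_{V\times W}=\bigoplus_i\frac{\mathrm{Dim}\,\mathcal C}{\dim U_i}\sum_\alpha\big[(\mathrm{id}_V\otimes\tilde d_{U_i})\circ(\mathrm{id}_V\otimes\alpha\otimes\mathrm{id})\big]\times\alpha^*$. The first adjunction makes $R$ lax monoidal and the second makes it colax monoidal; through these structures $R(A)$ carries a product, unit, coproduct and counit for every Frobenius algebra $A$ in $\mathcal C$. *Modular invariance.* Put $K=\bigoplus_{i,j}U_i\times U_j$ and $\omega=\sum_{i,j}\frac{\dim U_i\dim U_j}{\mathrm{Dim}\,\mathcal C}\,\mathrm{id}_{U_i\times U_j}$. For an object $X$ let $E_X:X\to X$ be the partial trace over $K$ of $c_{K,X}\circ c_{X,K}\circ(\mathrm{id}_X\otimes\omega)$, i.e. a closed $K$-strand carrying $\omega$ that encircles $X$. A morphism $f:A\otimes B\to B$ in $\mathcal C_+\boxtimes\mathcal C_-$ is *S-invariant* if for all $W$ $$(\mathrm{id}_W\otimes\tilde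 d_B)\circ\big((c_{B,W}\circ(f\otimes\mathrm{id}_W)\circ(\mathrm{id}_A\otimes c_{W,B}))\otimes\mathrm{id}_{B^\vee}\big)\circ(\mathrm{id}_{A\otimes W}\otimes b_B)=(\tilde d_B\otimes\mathrm{id}_W)\circ(f\otimes E_{B^\vee\otimes W})\circ(\mathrm{id}_A\otimes b_B\otimes\mathrm{id}_W).$$ An algebra $A$ in $\mathcal C_+\boxtimes\mathcal C_-$ is *modular invariant* if $\theta_A=\mathrm{id}_A$ and its product is S-invariant. *Cardy algebras.* A *Cardy $\mathcal C|\mathcal C_+\boxtimes\mathcal C_-$-algebra* $(A_{op}|A_{cl},\iota)$ consists of a symmetric Frobenius algebra $A_{op}$ in $\mathcal C$, a modular invariant commutative symmetric Frobenius algebra $A_{cl}$ in $\mathcal C_+\boxtimes\mathcal C_-$ and an algebra homomorphism $\iota:A_{cl}\to R(A_{op})$ such that (i) (centre condition) $m_{R(A_{op})}\circ c_{R(A_{op}),R(A_{op})}\circ(\iota\otimes\mathrm{id})=m_{R(A_{op})}\circ(\iota\otimes\mathrm{id})$; (ii) (Cardy condition) $\iota\circ\iota^*=P^l_{R(A_{op})}$.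 **Proposition.** Let $(A_{op}|A_{cl},\iota)$ be a Cardy $\mathcal C|\mathcal C_+\boxtimes\mathcal C_-$-algebra. If $A_{cl}$ is simple and $\dim A_{op}\neq0$, then $A_{op}$ is simple and special. -/

import Mathlib

open CategoryTheory MonoidalCategory Limits

universe v u

set_option linter.unusedSectionVars false

/-! ### Ribbon categories -/

/-- A ribbon category: a braided category in which every object `X` has a dual `Xᘁ`, with
evaluation `d_X = ε_ X Xᘁ : Xᘁ ⊗ X ⟶ 𝟙` and coevaluation `b_X = η_ X Xᘁ : 𝟙 ⟶ X ⊗ Xᘁ`,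
together with a compatible natural twist. -/
class RibbonCategory (C : Type u) [Category.{v} C] [MonoidalCategory C] [BraidedCategory C]
    [RightRigidCategory C] where
  twist : ∀ X : C, X ≅ X
  twist_naturality : ∀ {X Y : C} (f : X ⟶ Y), f ≫ (twist Y).hom = (twist X).hom ≫ f
  twist_tensor : ∀ X Y : C, (twist (X ⊗ Y)).hom =
    (β_ X Y).hom ≫ (β_ Y X).hom ≫ ((twist X).hom ⊗ₘ (twist Y).hom)
  twist_dual : ∀ X : C,
    η_ X Xᘁ ≫ (twist X).hom ▷ Xᘁ = η_ X Xᘁ ≫ X ◁ (twist (Xᘁ : C)).hom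

/-! ### Coherence identities, in the form used below -/

namespace TensorIdentities

variable {C : Type u} [Category.{v} C] [MonoidalCategory C]

theorem LU {X Y : C} (f : X ⟶ Y) :
    (𝟙 (𝟙_ C) ⊗ₘ f) ≫ (λ_ Y).hom = (λ_ X).hom ≫ f := by simp

theorem RU {X Y : C} (f : X ⟶ Y) :
    (f ⊗ₘ 𝟙 (𝟙_ C)) ≫ (ρ_ Y).hom = (ρ_ X).hom ≫ f := by simp

theorem PE (W X Y Z : C) :
    ((α_ W X Y).hom ⊗ₘ 𝟙 Z) ≫ (α_ W (X ⊗ Y) Z).hom ≫ (𝟙 W ⊗ₘ (α_ X Y Z).hom) =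
      (α_ (W ⊗ X) Y Z).hom ≫ (α_ W X (Y ⊗ Z)).hom := by simp

theorem TR (X Y : C) :
    (α_ X (𝟙_ C) Y).hom ≫ (𝟙 X ⊗ₘ (λ_ Y).hom) = (ρ_ X).hom ⊗ₘ 𝟙 Y := by simp

variable [BraidedCategory C]

theorem BNR (X : C) {Y Z : C} (f : Y ⟶ Z) :
    (𝟙 X ⊗ₘ f) ≫ (β_ X Z).hom = (β_ X Y).hom ≫ (f ⊗ₘ 𝟙 X) := by simp

theorem BNR' (X : C) {Y Z : C} (f : Y ⟶ Z) :
    (𝟙 X ⊗ₘ f) ≫ (β_ Z X).inv = (β_ Y X).inv ≫ (f ⊗ₘ 𝟙 X) := by simp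

theorem BNL {X Y : C} (f : X ⟶ Y) (Z : C) :
    (f ⊗ₘ 𝟙 Z) ≫ (β_ Y Z).hom = (β_ X Z).hom ≫ (𝟙 Z ⊗ₘ f) := by simp

theorem BNL' {X Y : C} (f : X ⟶ Y) (Z : C) :
    (f ⊗ₘ 𝟙 Z) ≫ (β_ Z Y).inv = (β_ Z X).inv ≫ (𝟙 Z ⊗ₘ f) := by simp

theorem HF (X Y Z : C) :
    (α_ X Y Z).hom ≫ (β_ X (Y ⊗ Z)).hom ≫ (α_ Y Z X).hom =
      ((β_ X Y).hom ⊗ₘ 𝟙 Z) ≫ (α_ Y X Z).hom ≫ (𝟙 Y ⊗ₘ (β_ X Z).hom) := by simp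

theorem HF' (X Y Z : C) :
    (α_ X Y Z).hom ≫ (β_ (Y ⊗ Z) X).inv ≫ (α_ Y Z X).hom =
      ((β_ Y X).inv ⊗ₘ 𝟙 Z) ≫ (α_ Y X Z).hom ≫ (𝟙 Y ⊗ₘ (β_ Z X).inv) := by simp

theorem HR (X Y Z : C) :
    (α_ X Y Z).inv ≫ (β_ (X ⊗ Y) Z).hom ≫ (α_ Z X Y).inv =
      (𝟙 X ⊗ₘ (β_ Y Z).hom) ≫ (α_ X Z Y).inv ≫ ((β_ X Z).hom ⊗ₘ 𝟙 Y) := by simp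

theorem HR' (X Y Z : C) :
    (α_ X Y Z).inv ≫ (β_ Z (X ⊗ Y)).inv ≫ (α_ Z X Y).inv =
      (𝟙 X ⊗ₘ (β_ Z Y).inv) ≫ (α_ X Z Y).inv ≫ ((β_ Z X).inv ⊗ₘ 𝟙 Y) := by simp

section

variable [RightRigidCategory C]

theorem ZZ (X : C) : (𝟙 (Xᘁ : C) ⊗ₘ η_ X (Xᘁ : C)) ≫ (α_ (Xᘁ : C) X (Xᘁ : C)).inv ≫
    (ε_ X (Xᘁ : C) ⊗ₘ 𝟙 (Xᘁ : C)) = (ρ_ (Xᘁ : C)).hom ≫ (λ_ (Xᘁ : C)).inv := by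
  simp

theorem ZZ' (X : C) : (η_ X (Xᘁ : C) ⊗ₘ 𝟙 X) ≫ (α_ X (Xᘁ : C) X).hom ≫
    (𝟙 X ⊗ₘ ε_ X (Xᘁ : C)) = (λ_ X).hom ≫ (ρ_ X).inv := by
  simp

variable [RibbonCategory C]

theorem TN' {X Y : C} (f : X ⟶ Y) :
    f ≫ (RibbonCategory.twist Y).inv = (RibbonCategory.twist X).inv ≫ f := by
  rw [Iso.comp_inv_eq, Category.assoc, RibbonCategory.twist_naturality, Iso.inv_hom_id_assoc]

theorem TT' (X Y : C) : (RibbonCategory.twist (X ⊗ Y)).inv =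
    (β_ Y X).inv ≫ (β_ X Y).inv ≫
      ((RibbonCategory.twist X).inv ⊗ₘ (RibbonCategory.twist Y).inv) := by
  have h : RibbonCategory.twist (X ⊗ Y) =
      ((β_ X Y ≪≫ β_ Y X) ≪≫ (RibbonCategory.twist X ⊗ᵢ RibbonCategory.twist Y)) :=
    Iso.ext (by simpa using RibbonCategory.twist_tensor X Y)
  have h' : RibbonCategory.twist (X ⊗ Y) =
      ((RibbonCategory.twist X ⊗ᵢ RibbonCategory.twist Y) ≪≫ (β_ X Y ≪≫ β_ Y X)) := by
    rw [h]
    refine Iso.ext ?_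
    simp only [Iso.trans_hom, tensorIso_hom, Category.assoc]
    rw [← BraidedCategory.braiding_naturality, ← BraidedCategory.braiding_naturality_assoc]
  rw [h']
  simp

theorem TD (X : C) : η_ X (Xᘁ : C) ≫ ((RibbonCategory.twist X).hom ⊗ₘ 𝟙 (Xᘁ : C)) =
    η_ X (Xᘁ : C) ≫ (𝟙 X ⊗ₘ (RibbonCategory.twist (Xᘁ : C)).hom) := by
  simpa using RibbonCategory.twist_dual X

theorem TD' (X : C) : η_ X (Xᘁ : C) ≫ ((RibbonCategory.twist X).inv ⊗ₘ 𝟙 (Xᘁ : C)) =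
    η_ X (Xᘁ : C) ≫ (𝟙 X ⊗ₘ (RibbonCategory.twist (Xᘁ : C)).inv) := by
  rw [← cancel_mono ((RibbonCategory.twist X).hom ⊗ₘ (RibbonCategory.twist (Xᘁ : C)).hom)]
  simp only [Category.assoc, tensorHom_comp_tensorHom, Iso.inv_hom_id, Category.id_comp]
  exact (TD X).symm

end

end TensorIdentities

section RibbonDuality

variable {C : Type u} [Category.{v} C] [MonoidalCategory C] [BraidedCategory C]
  [RightRigidCategory C] [RibbonCategory C]

/-- The twist `θ_X`. -/
def twist (X : C) : X ⟶ X := (RibbonCategory.twist X).hom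

/-- The second evaluation `d̃_X = d_X ∘ c_{X,Xᘁ} ∘ (θ_X ⊗ id)` of a ribbon category. -/
def evTilde (X : C) : X ⊗ (Xᘁ : C) ⟶ 𝟙_ C :=
  twist X ▷ (Xᘁ : C) ≫ (β_ X (Xᘁ : C)).hom ≫ ε_ X (Xᘁ : C)

/-- The second coevaluation `b̃_X = (id ⊗ θ_X) ∘ c_{X,Xᘁ} ∘ b_X` of a ribbon category. -/
def coevTilde (X : C) : 𝟙_ C ⟶ (Xᘁ : C) ⊗ X :=
  η_ X (Xᘁ : C) ≫ (β_ X (Xᘁ : C)).hom ≫ (Xᘁ : C) ◁ twist X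

/-- The partial trace `X ⟶ X` of the double braiding of `X` with `K`, with `ω` inserted on the
closed `K`-strand: a closed strand `K` carrying `ω` that encircles `X`. -/
def encircle (K : C) (ω : K ⟶ K) (X : C) : X ⟶ X :=
  (ρ_ X).inv ≫ X ◁ η_ K (Kᘁ : C) ≫ (α_ X K (Kᘁ : C)).inv ≫
    (X ◁ ω ≫ (β_ X K).hom ≫ (β_ K X).hom) ▷ (Kᘁ : C) ≫
    (α_ X K (Kᘁ : C)).hom ≫ X ◁ evTilde K ≫ (ρ_ X).hom

/-- For `f : A ⊗ B ⟶ B`, the morphism `A ⊗ W ⟶ W` in which the outgoing `B`-strand of `f` is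
closed up to its incoming `B`-strand by a loop that encircles `W`. -/
def loopAround {A B : C} (f : A ⊗ B ⟶ B) (W : C) : A ⊗ W ⟶ W :=
  A ◁ ((ρ_ W).inv ≫ W ◁ η_ B (Bᘁ : C) ≫ (α_ W B (Bᘁ : C)).inv ≫
      (β_ W B).hom ▷ (Bᘁ : C)) ≫
    (α_ A (B ⊗ W) (Bᘁ : C)).inv ≫
    ((α_ A B W).inv ≫ f ▷ W ≫ (β_ B W).hom) ▷ (Bᘁ : C) ≫
    (α_ W B (Bᘁ : C)).hom ≫ W ◁ evTilde B ≫ (ρ_ W).hom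

/-- For `f : A ⊗ B ⟶ B`, the morphism `A ⊗ W ⟶ W` in which the outgoing `B`-strand of `f` is
closed up to its incoming `B`-strand to the left of `W`, while a closed strand `K` carrying `ω`
encircles the returning strand `Bᘁ` together with `W`. -/
def loopLinked (K : C) (ω : K ⟶ K) {A B : C} (f : A ⊗ B ⟶ B) (W : C) : A ⊗ W ⟶ W :=
  A ◁ ((λ_ W).inv ≫ η_ B (Bᘁ : C) ▷ W ≫ (α_ B (Bᘁ : C) W).hom) ≫
    (α_ A B ((Bᘁ : C) ⊗ W)).inv ≫
    (f ⊗ₘ encircle K ω ((Bᘁ : C) ⊗ W)) ≫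
    (α_ B (Bᘁ : C) W).inv ≫ evTilde B ▷ W ≫ (λ_ W).hom

end RibbonDuality

/-! ### Frobenius algebras -/

/-- An object with a product, a unit, a coproduct and a counit (no axioms). -/
structure FrobeniusData (D : Type u) [Category.{v} D] [MonoidalCategory D] where
  X : D
  mul : X ⊗ X ⟶ X
  one : 𝟙_ D ⟶ X
  comul : X ⟶ X ⊗ X
  counit : X ⟶ 𝟙_ D

/-- A Frobenius algebra: an algebra and a coalgebra whose coproduct is a bimodule map. -/
structure FrobeniusAlgebra (D : Type u) [Category.{v} D] [MonoidalCategory D] extends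
    FrobeniusData D where
  one_mul : one ▷ X ≫ mul = (λ_ X).hom
  mul_one : X ◁ one ≫ mul = (ρ_ X).hom
  mul_assoc : mul ▷ X ≫ mul = (α_ X X X).hom ≫ X ◁ mul ≫ mul
  counit_comul : comul ≫ counit ▷ X = (λ_ X).inv
  comul_counit : comul ≫ X ◁ counit = (ρ_ X).inv
  comul_assoc : comul ≫ X ◁ comul = comul ≫ comul ▷ X ≫ (α_ X X X).hom
  frobenius_left : comul ▷ X ≫ (α_ X X X).hom ≫ X ◁ mul = mul ≫ comul
  frobenius_right : X ◁ comul ≫ (α_ X X X).inv ≫ mul ▷ X = mul ≫ comul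

namespace FrobeniusData

section

variable {D : Type u} [Category.{v} D] [MonoidalCategory D]

/-- For `f : A ⟶ B` the morphism
`f* = ((ε_B ∘ m_B) ⊗ id_A) ∘ (id_B ⊗ f ⊗ id_A) ∘ (id_B ⊗ (Δ_A ∘ η_A)) : B ⟶ A`. -/
def star (A B : FrobeniusData D) (f : A.X ⟶ B.X) : B.X ⟶ A.X :=
  (ρ_ B.X).inv ≫ B.X ◁ (A.one ≫ A.comul) ≫ B.X ◁ (f ▷ A.X) ≫
    (α_ B.X B.X A.X).inv ≫ (B.mul ≫ B.counit) ▷ A.X ≫ (λ_ A.X).hom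

/-- `f` is a homomorphism of algebras. -/
structure IsAlgebraHom (A B : FrobeniusData D) (f : A.X ⟶ B.X) : Prop where
  map_mul : A.mul ≫ f = (f ⊗ₘ f) ≫ B.mul
  map_one : A.one ≫ f = B.one

/-- Special: `m ∘ Δ` and `ε ∘ η` are nonzero multiples of the identities. -/
def IsSpecial [Preadditive D] [Linear ℂ D] (A : FrobeniusData D) : Prop :=
  ∃ ζ ξ : ℂ, ζ ≠ 0 ∧ ξ ≠ 0 ∧ A.comul ≫ A.mul = ζ • 𝟙 A.X ∧ A.one ≫ A.counit = ξ • 𝟙 (𝟙_ D)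

/-- Commutative: `m ∘ c_{A,A} = m`. -/
def IsCommutative [BraidedCategory D] (A : FrobeniusData D) : Prop :=
  (β_ A.X A.X).hom ≫ A.mul = A.mul

variable [BraidedCategory D] [RightRigidCategory D] [RibbonCategory D]

/-- `Φ_A = ((ε ∘ m) ⊗ id) ∘ (id_A ⊗ b_A) : A ⟶ Aᘁ`. -/
def Phi (A : FrobeniusData D) : A.X ⟶ (A.Xᘁ : D) :=
  (ρ_ A.X).inv ≫ A.X ◁ η_ A.X (A.Xᘁ : D) ≫ (α_ A.X A.X (A.Xᘁ : D)).inv ≫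
    (A.mul ≫ A.counit) ▷ (A.Xᘁ : D) ≫ (λ_ (A.Xᘁ : D)).hom

/-- `Φ'_A = (id ⊗ (ε ∘ m)) ∘ (b̃_A ⊗ id_A) : A ⟶ Aᘁ`. -/
def Phi' (A : FrobeniusData D) : A.X ⟶ (A.Xᘁ : D) :=
  (λ_ A.X).inv ≫ coevTilde A.X ▷ A.X ≫ (α_ (A.Xᘁ : D) A.X A.X).hom ≫
    (A.Xᘁ : D) ◁ (A.mul ≫ A.counit) ≫ (ρ_ (A.Xᘁ : D)).hom

/-- Symmetric: `Φ_A = Φ'_A`. -/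
def IsSymmetric (A : FrobeniusData D) : Prop := A.Phi = A.Phi'

/-- The endomorphism `P^l_A` of `A`: the right leg of the coproduct is led around, crossing
beneath the outgoing strand, into the left input of the product,
`(d_A ⊗ id_A) ∘ (id ⊗ c_{A,A}) ∘ (id ⊗ m ⊗ id) ∘ (b̃_A ⊗ Δ)`. -/
def leftCentreMap (A : FrobeniusData D) : A.X ⟶ A.X :=
  A.comul ≫ (λ_ (A.X ⊗ A.X)).inv ≫ coevTilde A.X ▷ (A.X ⊗ A.X) ≫
    (α_ (A.Xᘁ : D) A.X (A.X ⊗ A.X)).hom ≫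
    (A.Xᘁ : D) ◁ ((α_ A.X A.X A.X).inv ≫ A.mul ▷ A.X ≫ (β_ A.X A.X).hom) ≫
    (α_ (A.Xᘁ : D) A.X A.X).inv ≫ ε_ A.X (A.Xᘁ : D) ▷ A.X ≫ (λ_ A.X).hom

end

end FrobeniusData

section Bimodules

variable {D : Type u} [Category.{v} D] [MonoidalCategory D] [Preadditive D]
  [MonoidalPreadditive D]

instance (A B : Mon D) : HasZeroMorphisms (Bimod A B) where
  zero M N := ⟨{ hom := 0, left_act_hom := by simp, right_act_hom := by simp }⟩
  comp_zero f Z := by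
    apply Bimod.hom_ext
    exact comp_zero
  zero_comp X Y Z f := by
    apply Bimod.hom_ext
    exact zero_comp

end Bimodules

namespace FrobeniusAlgebra

variable {D : Type u} [Category.{v} D] [MonoidalCategory D]

/-- The underlying algebra, as a monoid object. -/
def toMon (A : FrobeniusAlgebra D) : Mon D where
  X := A.X
  mon :=
    { one := A.one
      mul := A.mul
      one_mul := A.one_mul
      mul_one := A.mul_one
      mul_assoc := A.mul_assoc }

/-- The algebra is simple: it is simple as a bimodule over itself. -/
def IsSimple [Preadditive D] [MonoidalPreadditive D] (A : FrobeniusAlgebra D) : Prop :=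
  Simple (Bimod.regular A.toMon)

end FrobeniusAlgebra

/-! ### Pairs of objects: the category with objects `V × W` and
`Hom(V × W, V' × W') = Hom(V, V') ⊗ Hom(W, W')` -/

/-- An object `V × W`. -/
structure BoxPair (C : Type u) where
  left : C
  right : C

namespace BoxPair

open TensorIdentities

section Cat
variable {C : Type u} [Category.{v} C] [Preadditive C] [Linear ℂ C]

/-- `Hom(V × W, V' × W')` is the tensor product over `ℂ` of the two spaces of morphisms. -/
def Hom (X Y : BoxPair C) : Type v :=
  TensorProduct ℂ (X.left ⟶ Y.left) (X.right ⟶ Y.right)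

noncomputable instance (X Y : BoxPair C) : AddCommGroup (Hom X Y) :=
  inferInstanceAs (AddCommGroup (TensorProduct ℂ (X.left ⟶ Y.left) (X.right ⟶ Y.right)))

noncomputable instance (X Y : BoxPair C) : Module ℂ (Hom X Y) :=
  inferInstanceAs (Module ℂ (TensorProduct ℂ (X.left ⟶ Y.left) (X.right ⟶ Y.right)))

noncomputable def Hom.mk {X Y : BoxPair C} (f : X.left ⟶ Y.left) (g : X.right ⟶ Y.right) : Hom X Y :=
  TensorProduct.tmul ℂ f g

theorem Hom.ind {X Y : BoxPair C} {P : Hom X Y → Prop} (h : Hom X Y)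
    (mk : ∀ f g, P (Hom.mk f g)) (add : ∀ a b, P a → P b → P (a + b)) : P h :=
  TensorProduct.induction_on h
    (by simpa [Hom.mk] using mk 0 0) mk add

/-- Composition is bilinear with `(f ⊗ g) ≫ (f' ⊗ g') = (f ≫ f') ⊗ (g ≫ g')`. -/
noncomputable def compLin (X Y Z : BoxPair C) : Hom X Y →ₗ[ℂ] Hom Y Z →ₗ[ℂ] Hom X Z :=
  TensorProduct.map₂ (Linear.comp X.left Y.left Z.left) (Linear.comp X.right Y.right Z.right)

theorem compLin_mk {X Y Z : BoxPair C} (f : X.left ⟶ Y.left) (g : X.right ⟶ Y.right)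
    (f' : Y.left ⟶ Z.left) (g' : Y.right ⟶ Z.right) :
    compLin X Y Z (Hom.mk f g) (Hom.mk f' g') = Hom.mk (f ≫ f') (g ≫ g') := rfl

noncomputable instance : Category.{v} (BoxPair C) where
  Hom := Hom
  id X := Hom.mk (𝟙 X.left) (𝟙 X.right)
  comp f g := compLin _ _ _ f g
  id_comp {X Y} f := by
    induction f using Hom.ind with
    | mk f g => simp [compLin_mk]
    | add a b ha hb => rw [map_add, ha, hb]
  comp_id {X Y} f := by
    induction f using Hom.ind with
    | mk f g => simp [compLin_mk]
    | add a b ha hb => rw [map_add, LinearMap.add_apply, ha, hb]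
  assoc {W X Y Z} f g h := by
    induction f using Hom.ind with
    | add a b ha hb => simp only [map_add, LinearMap.add_apply, ha, hb]
    | mk f f' =>
    induction g using Hom.ind with
    | add a b ha hb => simp only [map_add, LinearMap.add_apply, ha, hb]
    | mk g g' =>
    induction h using Hom.ind with
    | add a b ha hb => simp only [map_add, ha, hb]
    | mk h h' => simp [compLin_mk]

noncomputable instance (X Y : BoxPair C) : AddCommGroup (X ⟶ Y) :=
  inferInstanceAs (AddCommGroup (Hom X Y))

noncomputable instance (X Y : BoxPair C) : Module ℂ (X ⟶ Y) :=
  inferInstanceAs (Module ℂ (Hom X Y))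

noncomputable instance : Preadditive (BoxPair C) where
  add_comp X Y Z f f' g := by
    change compLin X Y Z (f + f') g = _
    rw [map_add, LinearMap.add_apply]; rfl
  comp_add X Y Z f g g' := map_add (compLin X Y Z f) g g'

noncomputable instance : Linear ℂ (BoxPair C) where
  smul_comp X Y Z r f g := by
    change compLin X Y Z (r • f) g = _
    rw [map_smul, LinearMap.smul_apply]; rfl
  comp_smul X Y Z f r g := map_smul (compLin X Y Z f) r g

/-- The morphism `f ⊗ g : V × W ⟶ V' × W'`. -/
noncomputable def hom {X Y : BoxPair C} (f : X.left ⟶ Y.left) (g : X.right ⟶ Y.right) : X ⟶ Y :=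
  Hom.mk f g

@[simp] theorem hom_comp {X Y Z : BoxPair C} (f : X.left ⟶ Y.left) (g : X.right ⟶ Y.right)
    (f' : Y.left ⟶ Z.left) (g' : Y.right ⟶ Z.right) :
    (hom f g : X ⟶ Y) ≫ (hom f' g' : Y ⟶ Z) = hom (f ≫ f') (g ≫ g') := rfl

@[simp] theorem hom_id (X : BoxPair C) : (hom (𝟙 X.left) (𝟙 X.right) : X ⟶ X) = 𝟙 X := rfl

theorem hom_ind {X Y : BoxPair C} {P : (X ⟶ Y) → Prop} (h : X ⟶ Y)
    (hom : ∀ f g, P (hom f g)) (add : ∀ a b, P a → P b → P (a + b)) : P h :=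
  Hom.ind h hom add

@[simps] noncomputable def iso {X Y : BoxPair C} (e : X.left ≅ Y.left) (e' : X.right ≅ Y.right) :
    X ≅ Y where
  hom := hom e.hom e'.hom
  inv := hom e.inv e'.inv
  hom_inv_id := by simp
  inv_hom_id := by simp

variable [MonoidalCategory C] [MonoidalPreadditive C] [MonoidalLinear ℂ C]

noncomputable def tensorHomLin (W X Y Z : C) : (W ⟶ X) →ₗ[ℂ] (Y ⟶ Z) →ₗ[ℂ] (W ⊗ Y ⟶ X ⊗ Z) :=
  LinearMap.mk₂ ℂ (fun f g => f ⊗ₘ g)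
    (by intros; simp [MonoidalCategory.tensorHom_def]) (by intros; simp [MonoidalCategory.tensorHom_def])
    (by intros; simp [MonoidalCategory.tensorHom_def]) (by intros; simp [MonoidalCategory.tensorHom_def])

noncomputable def tensorLin (W X Y Z : BoxPair C) : (W ⟶ X) →ₗ[ℂ] (Y ⟶ Z) →ₗ[ℂ]
    (BoxPair.mk (W.left ⊗ Y.left) (W.right ⊗ Y.right) ⟶
      BoxPair.mk (X.left ⊗ Z.left) (X.right ⊗ Z.right)) :=
  TensorProduct.map₂ (tensorHomLin W.left X.left Y.left Z.left)
    (tensorHomLin W.right X.right Y.right Z.right)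

noncomputable instance : MonoidalCategoryStruct (BoxPair C) where
  tensorObj X Y := ⟨X.left ⊗ Y.left, X.right ⊗ Y.right⟩
  tensorUnit := ⟨𝟙_ C, 𝟙_ C⟩
  tensorHom f g := tensorLin _ _ _ _ f g
  whiskerLeft X _ _ f := tensorLin _ _ _ _ (𝟙 X) f
  whiskerRight f Y := tensorLin _ _ _ _ f (𝟙 Y)
  associator X Y Z := iso (α_ X.left Y.left Z.left) (α_ X.right Y.right Z.right)
  leftUnitor X := iso (λ_ X.left) (λ_ X.right)
  rightUnitor X := iso (ρ_ X.left) (ρ_ X.right)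

theorem add_tensor' {W X Y Z : BoxPair C} (f f' : W ⟶ X) (g : Y ⟶ Z) :
    (f + f') ⊗ₘ g = f ⊗ₘ g + f' ⊗ₘ g := by
  change tensorLin _ _ _ _ _ _ = _
  rw [map_add]; rfl

theorem tensor_add' {W X Y Z : BoxPair C} (f : W ⟶ X) (g g' : Y ⟶ Z) :
    f ⊗ₘ (g + g') = f ⊗ₘ g + f ⊗ₘ g' :=
  map_add (tensorLin _ _ _ _ f) g g'

@[simp] theorem hom_tensor {W X Y Z : BoxPair C} (f : W.left ⟶ X.left) (f' : W.right ⟶ X.right)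
    (g : Y.left ⟶ Z.left) (g' : Y.right ⟶ Z.right) :
    (hom f f' : W ⟶ X) ⊗ₘ (hom g g' : Y ⟶ Z) = hom (f ⊗ₘ g) (f' ⊗ₘ g') := rfl

theorem id_eq (X : BoxPair C) : 𝟙 X = hom (𝟙 X.left) (𝟙 X.right) := rfl

noncomputable instance : MonoidalCategory (BoxPair C) :=
  MonoidalCategory.ofTensorHom
    (id_tensorHom_id := fun X Y => by
      rw [id_eq, id_eq, hom_tensor, id_tensorHom_id, id_tensorHom_id]; rfl)
    (id_tensorHom := fun _ _ _ _ => rfl)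
    (tensorHom_id := fun _ _ => rfl)
    (tensorHom_comp_tensorHom := fun f g f' g' => by
      induction f using hom_ind with
      | add a b ha hb => simp only [add_tensor', Preadditive.add_comp, ha, hb]
      | hom =>
      induction g using hom_ind with
      | add a b ha hb => simp only [tensor_add', Preadditive.add_comp, ha, hb]
      | hom =>
      induction f' using hom_ind with
      | add a b ha hb => simp only [add_tensor', Preadditive.comp_add, ha, hb]
      | hom =>
      induction g' using hom_ind with
      | add a b ha hb => simp only [tensor_add', Preadditive.comp_add, ha, hb]
      | hom =>
        exact congrArg₂ hom (tensorHom_comp_tensorHom _ _ _ _) (tensorHom_comp_tensorHom _ _ _ _))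
    (associator_naturality := fun f g h => by
      induction f using hom_ind with
      | add a b ha hb => simp only [add_tensor', Preadditive.add_comp, Preadditive.comp_add, ha, hb]
      | hom =>
      induction g using hom_ind with
      | add a b ha hb => simp only [add_tensor', tensor_add', Preadditive.add_comp, Preadditive.comp_add, ha, hb]
      | hom =>
      induction h using hom_ind with
      | add a b ha hb => simp only [tensor_add', Preadditive.add_comp, Preadditive.comp_add, ha, hb]
      | hom =>
        exact congrArg₂ hom (associator_naturality _ _ _) (associator_naturality _ _ _))
    (leftUnitor_naturality := fun f => by
      induction f using hom_ind with
      | add a b ha hb => simp only [tensor_add', Preadditive.add_comp, Preadditive.comp_add, ha, hb]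
      | hom f g =>
        exact congrArg₂ hom (LU _) (LU _))
    (rightUnitor_naturality := fun f => by
      induction f using hom_ind with
      | add a b ha hb => simp only [add_tensor', Preadditive.add_comp, Preadditive.comp_add, ha, hb]
      | hom f g =>
        exact congrArg₂ hom (RU _) (RU _))
    (pentagon := fun W X Y Z => congrArg₂ hom (PE _ _ _ _) (PE _ _ _ _))
    (triangle := fun X Y => congrArg₂ hom (TR _ _) (TR _ _))

instance : MonoidalPreadditive (BoxPair C) where
  whiskerLeft_zero := by intros; exact map_zero (tensorLin _ _ _ _ _)
  zero_whiskerRight := by intros X Y Z; change tensorLin _ _ _ _ (0 : Y ⟶ Z) (𝟙 X) = _; rw [map_zero]; rfl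
  whiskerLeft_add := by intros; exact map_add (tensorLin _ _ _ _ _) _ _
  add_whiskerRight := by intros; exact add_tensor' _ _ _


instance : MonoidalLinear ℂ (BoxPair C) where
  whiskerLeft_smul := by intros; exact map_smul (tensorLin _ _ _ _ _) _ _
  smul_whiskerRight := by
    intro r Y Z f X
    change tensorLin _ _ _ _ (r • f) (𝟙 X) = _
    rw [map_smul]; rfl

variable [BraidedCategory C]

/-- The braiding `c × c⁻¹`. -/
noncomputable instance : BraidedCategory (BoxPair C) where
  braiding X Y := iso (β_ X.left Y.left) (β_ Y.right X.right).symm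
  braiding_naturality_right X Y Z f := by
    induction f using hom_ind with
    | add a b ha hb =>
      simp only [MonoidalPreadditive.whiskerLeft_add, MonoidalPreadditive.add_whiskerRight,
        Preadditive.add_comp, Preadditive.comp_add, ha, hb]
    | hom f g =>
      exact congrArg₂ hom (BNR _ _) (BNR' _ _)
  braiding_naturality_left f Z := by
    induction f using hom_ind with
    | add a b ha hb =>
      simp only [MonoidalPreadditive.whiskerLeft_add, MonoidalPreadditive.add_whiskerRight,
        Preadditive.add_comp, Preadditive.comp_add, ha, hb]
    | hom f g =>
      exact congrArg₂ hom (BNL _ _) (BNL' _ _)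
  hexagon_forward X Y Z := congrArg₂ hom (HF _ _ _) (HF' _ _ _)
  hexagon_reverse X Y Z := congrArg₂ hom (HR _ _ _) (HR' _ _ _)


section Rigid

variable [RightRigidCategory C]

noncomputable instance : RightRigidCategory (BoxPair C) where
  rightDual X :=
    { rightDual := ⟨(X.leftᘁ : C), (X.rightᘁ : C)⟩
      exact :=
        { coevaluation' := hom (η_ X.left (X.leftᘁ : C)) (η_ X.right (X.rightᘁ : C))
          evaluation' := hom (ε_ X.left (X.leftᘁ : C)) (ε_ X.right (X.rightᘁ : C))
          coevaluation_evaluation' := congrArg₂ hom (ZZ _) (ZZ _)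
          evaluation_coevaluation' := congrArg₂ hom (ZZ' _) (ZZ' _) } }

variable [RibbonCategory C]

/-- The twist `θ × θ⁻¹`. -/
noncomputable instance : RibbonCategory (BoxPair C) where
  twist X := iso (RibbonCategory.twist X.left) (RibbonCategory.twist X.right).symm
  twist_naturality f := by
    induction f using hom_ind with
    | add a b ha hb => simp only [Preadditive.add_comp, Preadditive.comp_add, ha, hb]
    | hom f g =>
      exact congrArg₂ hom (RibbonCategory.twist_naturality f) (TN' g)
  twist_tensor X Y := congrArg₂ hom (RibbonCategory.twist_tensor _ _) (TT' _ _)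
  twist_dual X := congrArg₂ hom (TD _) (TD' _)

end Rigid

end Cat
end BoxPair

/-! ### Finite direct sums: the tensor structure on matrices over a preadditive category -/

namespace CategoryTheory.Mat_

open TensorIdentities
section
variable {E : Type u} [Category.{v} E] [Preadditive E]

/-- The entry of a matrix of morphisms. -/
def entry {M N : Mat_ E} (f : M ⟶ N) (i : M.ι) (j : N.ι) : M.X i ⟶ N.X j := f i j

def ofEntries {M N : Mat_ E} (f : ∀ i j, M.X i ⟶ N.X j) : M ⟶ N := f

@[simp] theorem entry_ofEntries {M N : Mat_ E} (f : ∀ (i : M.ι) (j : N.ι), M.X i ⟶ N.X j)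
    (i : M.ι) (j : N.ι) : entry (ofEntries f) i j = f i j := rfl

theorem ext_entry {M N : Mat_ E} {f g : M ⟶ N} (h : ∀ i j, entry f i j = entry g i j) : f = g :=
  hom_ext f g h

theorem entry_comp {M N K : Mat_ E} (f : M ⟶ N) (g : N ⟶ K) (i : M.ι) (k : K.ι) :
    entry (f ≫ g) i k = ∑ j : N.ι, entry f i j ≫ entry g j k := rfl

@[simp] theorem entry_id_self (M : Mat_ E) (i : M.ι) : entry (𝟙 M) i i = 𝟙 _ :=
  id_apply_self M i

theorem entry_id_ne (M : Mat_ E) {i j : M.ι} (h : i ≠ j) : entry (𝟙 M) i j = 0 :=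
  id_apply_of_ne M i j h

@[simp] theorem entry_add {M N : Mat_ E} (f g : M ⟶ N) (i : M.ι) (j : N.ι) :
    entry (f + g) i j = entry f i j + entry g i j := rfl

@[simp] theorem entry_zero {M N : Mat_ E} (i : M.ι) (j : N.ι) :
    entry (0 : M ⟶ N) i j = 0 := rfl

open scoped Classical in
/-- The matrix whose row `i` has the entry `f i` in column `e i`, and zeros elsewhere. -/
noncomputable def diag {M N : Mat_ E} (e : M.ι → N.ι) (f : ∀ i, M.X i ⟶ N.X (e i)) : M ⟶ N :=
  ofEntries fun i j => if h : e i = j then f i ≫ eqToHom (congrArg N.X h) else 0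

theorem entry_diag {M N : Mat_ E} (e : M.ι → N.ι) (f : ∀ i, M.X i ⟶ N.X (e i)) (i : M.ι) :
    entry (diag e f) i (e i) = f i := by simp [diag]

theorem entry_diag_ne {M N : Mat_ E} (e : M.ι → N.ι) (f : ∀ i, M.X i ⟶ N.X (e i)) {i : M.ι}
    {j : N.ι} (h : e i ≠ j) : entry (diag e f) i j = 0 := by simp [diag, h]

theorem entry_diag_comp {M N K : Mat_ E} (e : M.ι → N.ι) (f : ∀ i, M.X i ⟶ N.X (e i))
    (g : N ⟶ K) (i : M.ι) (k : K.ι) : entry (diag e f ≫ g) i k = f i ≫ entry g (e i) k := by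
  rw [entry_comp, Finset.sum_eq_single (e i)]
  · rw [entry_diag]
  · intro j _ hj
    rw [entry_diag_ne _ _ hj.symm, zero_comp]
  · simp

theorem entry_comp_diag {M N K : Mat_ E} (g : M ⟶ N) (e : N.ι → K.ι) (he : Function.Injective e)
    (f : ∀ i, N.X i ⟶ K.X (e i)) (i : M.ι) (j : N.ι) :
    entry (g ≫ diag e f) i (e j) = entry g i j ≫ f j := by
  rw [entry_comp, Finset.sum_eq_single j]
  · rw [entry_diag]
  · intro k _ hk
    rw [entry_diag_ne _ _ (he.ne hk), comp_zero]
  · simp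

theorem diag_comp_diag {M N K : Mat_ E} (e : M.ι → N.ι) (f : ∀ i, M.X i ⟶ N.X (e i))
    (e' : N.ι → K.ι) (f' : ∀ i, N.X i ⟶ K.X (e' i)) :
    diag e f ≫ diag e' f' = diag (fun i => e' (e i)) (fun i => f i ≫ f' (e i)) := by
  refine ext_entry fun i k => ?_
  rw [entry_diag_comp]
  by_cases h : e' (e i) = k
  · subst h; rw [entry_diag, entry_diag (fun i => e' (e i))]
  · rw [entry_diag_ne e' f' h, entry_diag_ne (fun i => e' (e i)) _ h, comp_zero]

theorem id_eq_diag (M : Mat_ E) : 𝟙 M = diag (fun i => i) (fun i => 𝟙 (M.X i)) := by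
  refine ext_entry fun i k => ?_
  by_cases h : i = k
  · subst h; rw [entry_diag (fun i => i), entry_id_self]
  · rw [entry_diag_ne (fun i => i) _ h, entry_id_ne _ h]

theorem diag_id {M : Mat_ E} (f : ∀ i, M.X i ⟶ M.X i) (h : ∀ i, f i = 𝟙 _) :
    diag (fun i => i) f = 𝟙 M := by
  rw [id_eq_diag]; congr; funext i; exact h i

theorem diag_congr {M N : Mat_ E} (e : M.ι → N.ι) {f f' : ∀ i, M.X i ⟶ N.X (e i)}
    (h : ∀ i, f i = f' i) : diag e f = diag e f' := by
  rw [funext h]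

/-- An isomorphism given by a bijection of the index sets and isomorphisms of the summands. -/
noncomputable def diagIso {M N : Mat_ E} (e : M.ι → N.ι) (e' : N.ι → M.ι)
    (f : ∀ i, M.X i ⟶ N.X (e i)) (f' : ∀ j, N.X j ⟶ M.X (e' j))
    (h : diag e f ≫ diag e' f' = 𝟙 M) (h' : diag e' f' ≫ diag e f = 𝟙 N) : M ≅ N where
  hom := diag e f
  inv := diag e' f'
  hom_inv_id := h
  inv_hom_id := h'

variable [MonoidalCategory E]

noncomputable instance : MonoidalCategoryStruct (Mat_ E) where
  tensorObj M N := ⟨M.ι × N.ι, fun p => M.X p.1 ⊗ N.X p.2⟩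
  tensorUnit := ⟨Unit, fun _ => 𝟙_ E⟩
  tensorHom f g := ofEntries fun p q => entry f p.1 q.1 ⊗ₘ entry g p.2 q.2
  whiskerLeft M _ _ g := ofEntries fun p q => entry (𝟙 M) p.1 q.1 ⊗ₘ entry g p.2 q.2
  whiskerRight f N := ofEntries fun p q => entry f p.1 q.1 ⊗ₘ entry (𝟙 N) p.2 q.2
  associator L M N := diagIso (fun p => (p.1.1, (p.1.2, p.2))) (fun p => ((p.1, p.2.1), p.2.2))
    (fun p => (α_ (L.X p.1.1) (M.X p.1.2) (N.X p.2)).hom)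
    (fun p => (α_ (L.X p.1) (M.X p.2.1) (N.X p.2.2)).inv)
    (by rw [diag_comp_diag]; exact diag_id _ (fun _ => by simp))
    (by rw [diag_comp_diag]; exact diag_id _ (fun _ => by simp))
  leftUnitor M := diagIso (fun p => p.2) (fun i => ((), i))
    (fun p => (λ_ (M.X p.2)).hom) (fun i => (λ_ (M.X i)).inv)
    (by rw [diag_comp_diag]; exact diag_id _ (fun _ => by simp))
    (by rw [diag_comp_diag]; exact diag_id _ (fun _ => by simp))
  rightUnitor M := diagIso (fun p => p.1) (fun i => (i, ()))
    (fun p => (ρ_ (M.X p.1)).hom) (fun i => (ρ_ (M.X i)).inv)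
    (by rw [diag_comp_diag]; exact diag_id _ (fun _ => by simp))
    (by rw [diag_comp_diag]; exact diag_id _ (fun _ => by simp))

theorem entry_tensor {M N P Q : Mat_ E} (f : M ⟶ N) (g : P ⟶ Q) (p : M.ι × P.ι) (q : N.ι × Q.ι) :
    entry (f ⊗ₘ g) p q = entry f p.1 q.1 ⊗ₘ entry g p.2 q.2 := rfl

variable [MonoidalPreadditive E]

theorem diag_tensor {M N P Q : Mat_ E} (e : M.ι → N.ι) (f : ∀ i, M.X i ⟶ N.X (e i))
    (e' : P.ι → Q.ι) (f' : ∀ i, P.X i ⟶ Q.X (e' i)) :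
    diag e f ⊗ₘ diag e' f' =
      (diag (fun p => (e p.1, e' p.2)) (fun p => f p.1 ⊗ₘ f' p.2) : M ⊗ P ⟶ N ⊗ Q) := by
  refine ext_entry fun p q => ?_
  obtain ⟨i, j⟩ := p
  obtain ⟨k, l⟩ := q
  rw [entry_tensor]
  by_cases h : e i = k
  · by_cases h' : e' j = l
    · subst h h'
      rw [entry_diag, entry_diag]
      exact (entry_diag (M := M ⊗ P) (N := N ⊗ Q) (fun p => (e p.1, e' p.2))
        (fun p => f p.1 ⊗ₘ f' p.2) (i, j)).symm
    · rw [entry_diag_ne e' f' h', MonoidalPreadditive.tensor_zero]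
      exact (entry_diag_ne (M := M ⊗ P) (N := N ⊗ Q) _ _ (fun hh => h' (Prod.ext_iff.mp hh).2)).symm
  · rw [entry_diag_ne e f h, MonoidalPreadditive.zero_tensor]
    exact (entry_diag_ne (M := M ⊗ P) (N := N ⊗ Q) _ _ (fun hh => h (Prod.ext_iff.mp hh).1)).symm


theorem associator_eq (L M N : Mat_ E) : (α_ L M N).hom =
    diag (M := (L ⊗ M) ⊗ N) (N := L ⊗ (M ⊗ N)) (fun p => (p.1.1, (p.1.2, p.2)))
      (fun p => (α_ (L.X p.1.1) (M.X p.1.2) (N.X p.2)).hom) := rfl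

theorem associator_inv_eq (L M N : Mat_ E) : (α_ L M N).inv =
    diag (M := L ⊗ (M ⊗ N)) (N := (L ⊗ M) ⊗ N) (fun p => ((p.1, p.2.1), p.2.2))
      (fun p => (α_ (L.X p.1) (M.X p.2.1) (N.X p.2.2)).inv) := rfl

theorem leftUnitor_eq (M : Mat_ E) : (λ_ M).hom =
    diag (M := 𝟙_ (Mat_ E) ⊗ M) (N := M) (fun p => p.2) (fun p => (λ_ (M.X p.2)).hom) := rfl

theorem leftUnitor_inv_eq (M : Mat_ E) : (λ_ M).inv =
    diag (M := M) (N := 𝟙_ (Mat_ E) ⊗ M) (fun i => ((), i)) (fun i => (λ_ (M.X i)).inv) := rfl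

theorem rightUnitor_eq (M : Mat_ E) : (ρ_ M).hom =
    diag (M := M ⊗ 𝟙_ (Mat_ E)) (N := M) (fun p => p.1) (fun p => (ρ_ (M.X p.1)).hom) := rfl

theorem rightUnitor_inv_eq (M : Mat_ E) : (ρ_ M).inv =
    diag (M := M) (N := M ⊗ 𝟙_ (Mat_ E)) (fun i => (i, ())) (fun i => (ρ_ (M.X i)).inv) := rfl

noncomputable instance : MonoidalCategory (Mat_ E) :=
  MonoidalCategory.ofTensorHom
    (id_tensorHom_id := fun M N => by
      rw [id_eq_diag, id_eq_diag, diag_tensor]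
      exact diag_id _ (fun _ => id_tensorHom_id _ _))
    (id_tensorHom := fun _ _ _ _ => rfl)
    (tensorHom_id := fun _ _ => rfl)
    (tensorHom_comp_tensorHom := fun f g f' g' => by
      refine ext_entry fun p q => ?_
      rw [entry_tensor, entry_comp, entry_comp, entry_comp, sum_tensor]
      simp only [entry_tensor, tensorHom_comp_tensorHom, tensor_sum]
      exact Fintype.sum_prod_type _)
    (associator_naturality := fun {L M N L' M' N'} f g h => by
      refine ext_entry fun p q => ?_
      rw [associator_eq, associator_eq, entry_diag_comp]
      refine (entry_comp_diag ((f ⊗ₘ g) ⊗ₘ h) _ ?_ _ p ((q.1, q.2.1), q.2.2)).trans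
        (associator_naturality _ _ _)
      rintro ⟨⟨_, _⟩, _⟩ ⟨⟨_, _⟩, _⟩ hh
      cases hh; rfl)
    (leftUnitor_naturality := fun {M N} f => by
      refine ext_entry fun p q => ?_
      rw [leftUnitor_eq, leftUnitor_eq, entry_diag_comp]
      refine (entry_comp_diag (𝟙 (𝟙_ (Mat_ E)) ⊗ₘ f) _ ?_ _ p ((), q)).trans ?_
      · rintro ⟨_, _⟩ ⟨_, _⟩ hh
        cases hh; rfl
      · rw [entry_tensor, show entry (𝟙 (𝟙_ (Mat_ E))) p.1 () = 𝟙 (𝟙_ E) from entry_id_self _ _]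
        exact LU _)
    (rightUnitor_naturality := fun {M N} f => by
      refine ext_entry fun p q => ?_
      rw [rightUnitor_eq, rightUnitor_eq, entry_diag_comp]
      refine (entry_comp_diag (f ⊗ₘ 𝟙 (𝟙_ (Mat_ E))) _ ?_ _ p (q, ())).trans ?_
      · rintro ⟨_, _⟩ ⟨_, _⟩ hh
        cases hh; rfl
      · rw [entry_tensor, show entry (𝟙 (𝟙_ (Mat_ E))) p.2 () = 𝟙 (𝟙_ E) from entry_id_self _ _]
        exact RU _)
    (pentagon := fun W X Y Z => by
      rw [id_eq_diag, id_eq_diag, associator_eq, associator_eq, associator_eq, associator_eq,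
        associator_eq, diag_tensor, diag_tensor, diag_comp_diag, diag_comp_diag, diag_comp_diag]
      exact diag_congr _ (fun _ => PE _ _ _ _))
    (triangle := fun X Y => by
      rw [id_eq_diag, id_eq_diag, associator_eq, leftUnitor_eq, rightUnitor_eq, diag_tensor,
        diag_tensor, diag_comp_diag]
      exact diag_congr _ (fun _ => TR _ _))

theorem entry_associator_comp {K L M N : Mat_ E} (g : L ⊗ (M ⊗ N) ⟶ K)
    (x : (L.ι × M.ι) × N.ι) (k : K.ι) :
    entry ((α_ L M N).hom ≫ g) x k =
      (α_ (L.X x.1.1) (M.X x.1.2) (N.X x.2)).hom ≫ entry g (x.1.1, (x.1.2, x.2)) k :=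
  entry_diag_comp (M := (L ⊗ M) ⊗ N) (N := L ⊗ (M ⊗ N)) (fun p => (p.1.1, (p.1.2, p.2)))
    (fun p => (α_ (L.X p.1.1) (M.X p.1.2) (N.X p.2)).hom) g x k

theorem entry_associator_inv_comp {K L M N : Mat_ E} (g : (L ⊗ M) ⊗ N ⟶ K)
    (x : L.ι × (M.ι × N.ι)) (k : K.ι) :
    entry ((α_ L M N).inv ≫ g) x k =
      (α_ (L.X x.1) (M.X x.2.1) (N.X x.2.2)).inv ≫ entry g ((x.1, x.2.1), x.2.2) k :=
  entry_diag_comp (M := L ⊗ (M ⊗ N)) (N := (L ⊗ M) ⊗ N) (fun p => ((p.1, p.2.1), p.2.2))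
    (fun p => (α_ (L.X p.1) (M.X p.2.1) (N.X p.2.2)).inv) g x k

theorem whiskerLeft_eq (M : Mat_ E) {N P : Mat_ E} (f : N ⟶ P) : M ◁ f = 𝟙 M ⊗ₘ f := rfl

theorem whiskerRight_eq {N P : Mat_ E} (f : N ⟶ P) (M : Mat_ E) : f ▷ M = f ⊗ₘ 𝟙 M := rfl

theorem entry_whiskerLeft (M : Mat_ E) {N P : Mat_ E} (f : N ⟶ P) (p q) :
    entry (M ◁ f) p q = entry (𝟙 M) p.1 q.1 ⊗ₘ entry f p.2 q.2 := rfl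

theorem entry_whiskerRight {N P : Mat_ E} (f : N ⟶ P) (M : Mat_ E) (p q) :
    entry (f ▷ M) p q = entry f p.1 q.1 ⊗ₘ entry (𝟙 M) p.2 q.2 := rfl

instance : MonoidalPreadditive (Mat_ E) where
  whiskerLeft_zero := by
    intros; refine ext_entry fun p q => ?_; simp [entry_whiskerLeft]
  zero_whiskerRight := by
    intros; refine ext_entry fun p q => ?_; simp [entry_whiskerRight]
  whiskerLeft_add := by
    intros; refine ext_entry fun p q => ?_
    simp [entry_whiskerLeft, MonoidalPreadditive.tensor_add]
  add_whiskerRight := by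
    intros; refine ext_entry fun p q => ?_
    simp [entry_whiskerRight, MonoidalPreadditive.add_tensor]

variable [BraidedCategory E]

theorem entry_comp_swap {K M N : Mat_ E} (g : K ⟶ M ⊗ N)
    (f : ∀ p : M.ι × N.ι, M.X p.1 ⊗ N.X p.2 ⟶ N.X p.2 ⊗ M.X p.1) (k : K.ι) (q : N.ι × M.ι) :
    entry (g ≫ diag (M := M ⊗ N) (N := N ⊗ M) (fun p => (p.2, p.1)) f) k q =
      entry g k (q.2, q.1) ≫ f (q.2, q.1) :=
  entry_comp_diag (N := M ⊗ N) (K := N ⊗ M) g (fun p => (p.2, p.1))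
    (by rintro ⟨_, _⟩ ⟨_, _⟩ hh; cases hh; rfl) f k (q.2, q.1)

noncomputable def braid (M N : Mat_ E) : M ⊗ N ≅ N ⊗ M :=
  diagIso (M := M ⊗ N) (N := N ⊗ M) (fun p => (p.2, p.1)) (fun p => (p.2, p.1))
    (fun p => (β_ (M.X p.1) (N.X p.2)).hom) (fun p => (β_ (M.X p.2) (N.X p.1)).inv)
    (by rw [diag_comp_diag]; exact diag_id _ (fun _ => by simp))
    (by rw [diag_comp_diag]; exact diag_id _ (fun _ => by simp))

theorem braid_eq (M N : Mat_ E) : (braid M N).hom =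
    diag (M := M ⊗ N) (N := N ⊗ M) (fun p => (p.2, p.1))
      (fun p => (β_ (M.X p.1) (N.X p.2)).hom) := rfl

noncomputable instance : BraidedCategory (Mat_ E) where
  braiding := braid
  braiding_naturality_right M N P f := by
    refine ext_entry fun p q => ?_
    rw [braid_eq, braid_eq, entry_diag_comp, entry_comp_swap, entry_whiskerLeft,
      entry_whiskerRight]
    exact BraidedCategory.braiding_naturality _ _
  braiding_naturality_left {M N} f P := by
    refine ext_entry fun p q => ?_
    rw [braid_eq, braid_eq, entry_diag_comp, entry_comp_swap, entry_whiskerLeft,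
      entry_whiskerRight]
    exact BraidedCategory.braiding_naturality _ _
  hexagon_forward L M N := by
    rw [whiskerLeft_eq, whiskerRight_eq, id_eq_diag, id_eq_diag, braid_eq, braid_eq, braid_eq,
      associator_eq, associator_eq, associator_eq, diag_tensor, diag_tensor, diag_comp_diag,
      diag_comp_diag, diag_comp_diag, diag_comp_diag]
    exact diag_congr _ (fun _ => HF _ _ _)
  hexagon_reverse L M N := by
    rw [whiskerLeft_eq, whiskerRight_eq, id_eq_diag, id_eq_diag, braid_eq, braid_eq, braid_eq,
      associator_inv_eq, associator_inv_eq, associator_inv_eq, diag_tensor, diag_tensor,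
      diag_comp_diag, diag_comp_diag, diag_comp_diag, diag_comp_diag]
    exact diag_congr _ (fun _ => HR _ _ _)


section Rigid

variable [RightRigidCategory E]

/-- The dual of `⨁ X_i` is `⨁ X_iᘁ`. -/
noncomputable abbrev dual (M : Mat_ E) : Mat_ E := ⟨M.ι, fun i => ((M.X i)ᘁ : E)⟩

open scoped Classical in
noncomputable def coev (M : Mat_ E) : 𝟙_ (Mat_ E) ⟶ M ⊗ dual M :=
  ofEntries fun _ p =>
    if h : p.1 = p.2 then
      η_ (M.X p.1) ((M.X p.1)ᘁ : E) ≫ M.X p.1 ◁ eqToHom (congrArg (dual M).X h)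
    else 0

open scoped Classical in
noncomputable def ev (M : Mat_ E) : dual M ⊗ M ⟶ 𝟙_ (Mat_ E) :=
  ofEntries fun p _ =>
    if h : p.1 = p.2 then
      eqToHom (congrArg (dual M).X h) ▷ M.X p.2 ≫ ε_ (M.X p.2) ((M.X p.2)ᘁ : E)
    else 0

theorem entry_coev_self (M : Mat_ E) (u : Unit) (i : M.ι) :
    entry (coev M) u (i, i) = η_ (M.X i) ((M.X i)ᘁ : E) := by
  refine (dif_pos rfl).trans ?_
  exact (congrArg _ (whiskerLeft_id _ _)).trans (Category.comp_id _)

theorem entry_coev_ne (M : Mat_ E) (u : Unit) {i j : M.ι} (h : i ≠ j) :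
    entry (coev M) u (i, j) = 0 := dif_neg h

theorem entry_ev_self (M : Mat_ E) (u : Unit) (i : M.ι) :
    entry (ev M) (i, i) u = ε_ (M.X i) ((M.X i)ᘁ : E) := by
  refine (dif_pos rfl).trans ?_
  exact (congrArg (· ≫ _) (id_whiskerRight _ _)).trans (Category.id_comp _)

theorem entry_ev_ne (M : Mat_ E) (u : Unit) {i j : M.ι} (h : i ≠ j) :
    entry (ev M) (i, j) u = 0 := dif_neg h

theorem coev_ev (M : Mat_ E) :
    dual M ◁ coev M ≫ (α_ (dual M) M (dual M)).inv ≫ ev M ▷ dual M =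
      (ρ_ (dual M)).hom ≫ (λ_ (dual M)).inv := by
  refine ext_entry fun p q => ?_
  obtain ⟨j, u⟩ := p
  obtain ⟨w, k⟩ := q
  rw [entry_comp]
  have key : ∀ x : M.ι × (M.ι × M.ι),
      entry ((α_ (dual M) M (dual M)).inv ≫ ev M ▷ dual M) x (w, k) =
        (α_ ((dual M).X x.1) (M.X x.2.1) ((dual M).X x.2.2)).inv ≫
          (entry (ev M) (x.1, x.2.1) w ⊗ₘ entry (𝟙 (dual M)) x.2.2 k) := fun x =>
    entry_associator_inv_comp (ev M ▷ dual M) x (w, k)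
  refine (Finset.sum_eq_single (ι := M.ι × (M.ι × M.ι)) (j, (j, j)) ?_
    (fun h => absurd (Finset.mem_univ _) h)).trans ?_
  · rintro ⟨a, b, c⟩ _ hne
    rw [key, entry_whiskerLeft]
    dsimp only
    by_cases h1 : j = a
    · by_cases h2 : b = c
      · subst h1 h2
        rw [entry_ev_ne M w (fun h => hne (by subst h; rfl)), MonoidalPreadditive.zero_tensor,
          comp_zero, comp_zero]
      · rw [entry_coev_ne M u h2, MonoidalPreadditive.tensor_zero, zero_comp]
    · rw [entry_id_ne (dual M) h1, MonoidalPreadditive.zero_tensor, zero_comp]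
  · rw [key, entry_whiskerLeft, rightUnitor_eq, entry_diag_comp, leftUnitor_inv_eq]
    dsimp only
    rw [entry_coev_self, entry_ev_self, entry_id_self]
    by_cases h : j = k
    · subst h
      rw [entry_id_self]
      refine (ZZ _).trans (congrArg _ ?_)
      exact (entry_diag (M := dual M) (N := 𝟙_ (Mat_ E) ⊗ dual M) (fun i => ((), i))
        (fun i => (λ_ ((dual M).X i)).inv) j).symm
    · rw [entry_id_ne (dual M) h, MonoidalPreadditive.tensor_zero, comp_zero, comp_zero]
      refine (Eq.trans (congrArg _ ?_) comp_zero).symm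
      exact entry_diag_ne (M := dual M) (N := 𝟙_ (Mat_ E) ⊗ dual M) _ _
        (fun hh => h (Prod.ext_iff.mp hh).2)

theorem ev_coev (M : Mat_ E) :
    coev M ▷ M ≫ (α_ M (dual M) M).hom ≫ M ◁ ev M = (λ_ M).hom ≫ (ρ_ M).inv := by
  refine ext_entry fun p q => ?_
  obtain ⟨u, j⟩ := p
  obtain ⟨k, w⟩ := q
  rw [entry_comp]
  have key : ∀ x : (M.ι × M.ι) × M.ι,
      entry ((α_ M (dual M) M).hom ≫ M ◁ ev M) x (k, w) =
        (α_ (M.X x.1.1) ((dual M).X x.1.2) (M.X x.2)).hom ≫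
          (entry (𝟙 M) x.1.1 k ⊗ₘ entry (ev M) (x.1.2, x.2) w) := fun x =>
    entry_associator_comp (M ◁ ev M) x (k, w)
  refine (Finset.sum_eq_single (ι := (M.ι × M.ι) × M.ι) ((j, j), j) ?_
    (fun h => absurd (Finset.mem_univ _) h)).trans ?_
  · rintro ⟨⟨a, b⟩, c⟩ _ hne
    rw [key, entry_whiskerRight]
    dsimp only
    by_cases h1 : j = c
    · by_cases h2 : a = b
      · subst h1 h2
        rw [entry_ev_ne M w (fun h => hne (by subst h; rfl)), MonoidalPreadditive.tensor_zero,
          comp_zero, comp_zero]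
      · rw [entry_coev_ne M u h2, MonoidalPreadditive.zero_tensor, zero_comp]
    · rw [entry_id_ne M h1, MonoidalPreadditive.tensor_zero, zero_comp]
  · rw [key, entry_whiskerRight, leftUnitor_eq, entry_diag_comp, rightUnitor_inv_eq]
    dsimp only
    rw [entry_coev_self, entry_ev_self, entry_id_self]
    by_cases h : j = k
    · subst h
      rw [entry_id_self]
      refine (ZZ' _).trans (congrArg _ ?_)
      exact (entry_diag (M := M) (N := M ⊗ 𝟙_ (Mat_ E)) (fun i => (i, ()))
        (fun i => (ρ_ (M.X i)).inv) j).symm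
    · rw [entry_id_ne M h, MonoidalPreadditive.zero_tensor, comp_zero, comp_zero]
      refine (Eq.trans (congrArg _ ?_) comp_zero).symm
      exact entry_diag_ne (M := M) (N := M ⊗ 𝟙_ (Mat_ E)) _ _
        (fun hh => h (Prod.ext_iff.mp hh).1)

noncomputable instance : RightRigidCategory (Mat_ E) where
  rightDual M :=
    { rightDual := dual M
      exact :=
        { coevaluation' := coev M
          evaluation' := ev M
          coevaluation_evaluation' := coev_ev M
          evaluation_coevaluation' := ev_coev M } }

variable [RibbonCategory E]

noncomputable def twistIso (M : Mat_ E) : M ≅ M :=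
  diagIso (fun i => i) (fun i => i) (fun i => (RibbonCategory.twist (M.X i)).hom)
    (fun i => (RibbonCategory.twist (M.X i)).inv)
    (by rw [diag_comp_diag]; exact diag_id _ (fun _ => by simp))
    (by rw [diag_comp_diag]; exact diag_id _ (fun _ => by simp))

theorem twistIso_eq (M : Mat_ E) : (twistIso M).hom =
    diag (fun i => i) (fun i => (RibbonCategory.twist (M.X i)).hom) := rfl

noncomputable instance : RibbonCategory (Mat_ E) where
  twist := twistIso
  twist_naturality {M N} f := by
    refine ext_entry fun i j => ?_
    rw [twistIso_eq, twistIso_eq, entry_diag_comp]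
    exact (entry_comp_diag f (fun i => i) (fun _ _ h => h) _ i j).trans
      (RibbonCategory.twist_naturality _)
  twist_tensor M N := by
    change (twistIso (M ⊗ N)).hom =
      (braid M N).hom ≫ (braid N M).hom ≫ ((twistIso M).hom ⊗ₘ (twistIso N).hom)
    rw [twistIso_eq, twistIso_eq, twistIso_eq, braid_eq, braid_eq, diag_tensor, diag_comp_diag,
      diag_comp_diag]
    exact diag_congr _ (fun _ => RibbonCategory.twist_tensor _ _)
  twist_dual M := by
    change coev M ≫ (twistIso M).hom ▷ dual M = coev M ≫ M ◁ (twistIso (dual M)).hom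
    rw [whiskerLeft_eq, whiskerRight_eq, id_eq_diag, id_eq_diag, twistIso_eq, twistIso_eq,
      diag_tensor, diag_tensor]
    refine ext_entry fun u p => ?_
    obtain ⟨i, j⟩ := p
    refine (entry_comp_diag (N := M ⊗ dual M) (K := M ⊗ dual M) (coev M) (fun p => p)
      (fun _ _ h => h) _ u (i, j)).trans (Eq.trans ?_
      (entry_comp_diag (N := M ⊗ dual M) (K := M ⊗ dual M) (coev M) (fun p => p)
      (fun _ _ h => h) _ u (i, j)).symm)
    by_cases h : i = j
    · subst h
      rw [entry_coev_self]
      exact TD _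
    · rw [entry_coev_ne M u h, zero_comp, zero_comp]

end Rigid

end
end CategoryTheory.Mat_

/-! ### Modular tensor categories -/

section ModularCategories

attribute [local instance] Abelian.hasFiniteBiproducts

/-- An abelian semisimple finite `ℂ`-linear ribbon category with simple tensor unit, with a
choice of representatives `U i` of the isomorphism classes of simple objects. -/
class RibbonFusionCategory (C : Type u) [Category.{v} C] [Abelian C] [Linear ℂ C]
    [MonoidalCategory C] [MonoidalPreadditive C] [MonoidalLinear ℂ C] [BraidedCategory C]
    [RightRigidCategory C] [RibbonCategory C] where
  I : Type
  [fintype : Fintype I]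
  [decidableEq : DecidableEq I]
  U : I → C
  simple_U : ∀ i, Simple (U i)
  eq_of_iso : ∀ i j, Nonempty (U i ≅ U j) → i = j
  exists_iso : ∀ X : C, Simple X → ∃ i, Nonempty (X ≅ U i)
  finiteDimensional_hom : ∀ X Y : C, FiniteDimensional ℂ (X ⟶ Y)
  semisimple : ∀ X : C, ∃ (n : ℕ) (f : Fin n → I), Nonempty (X ≅ ⨁ fun a => U (f a))
  simple_unit : Simple (𝟙_ C)

attribute [reducible, instance] RibbonFusionCategory.fintype RibbonFusionCategory.decidableEq

attribute [instance] RibbonFusionCategory.simple_U RibbonFusionCategory.finiteDimensional_hom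
  RibbonFusionCategory.simple_unit

section Fusion

open RibbonFusionCategory

variable {C : Type u} [Category.{v} C] [Abelian C] [Linear ℂ C]
    [MonoidalCategory C] [MonoidalPreadditive C] [MonoidalLinear ℂ C] [BraidedCategory C]
    [RightRigidCategory C] [RibbonCategory C] [RibbonFusionCategory C]

/-- The identification `Hom(𝟙, 𝟙) = ℂ`: the number `z` with `f = z • id`. -/
noncomputable def scalar (f : 𝟙_ C ⟶ 𝟙_ C) : ℂ :=
  (endomorphism_simple_eq_smul_id ℂ f).choose

theorem scalar_smul_id (f : 𝟙_ C ⟶ 𝟙_ C) : scalar f • 𝟙 (𝟙_ C) = f :=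
  (endomorphism_simple_eq_smul_id ℂ f).choose_spec

/-- The dimension `d̃_X ∘ b_X` of an object. -/
noncomputable def qdim (X : C) : ℂ := scalar (η_ X (Xᘁ : C) ≫ evTilde X)

variable (C) in
/-- The global dimension `Dim C = ∑ i, (dim U_i)²`. -/
noncomputable def globalDim : ℂ := ∑ i : I C, qdim (U i : C) ^ 2

variable (C) in
/-- The matrix `s_{i,j}`: the trace of the double braiding of `U_i` and `U_j`. -/
noncomputable def sMatrix : Matrix (I C) (I C) ℂ := fun i j =>
  scalar (η_ (U i : C) ((U i)ᘁ : C) ≫ encircle (U j) (𝟙 _) (U i : C) ▷ ((U i)ᘁ : C) ≫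
    evTilde (U i : C))

end Fusion

/-- A modular tensor category: the matrix `s` is invertible. -/
class ModularTensorCategory (C : Type u) [Category.{v} C] [Abelian C] [Linear ℂ C]
    [MonoidalCategory C] [MonoidalPreadditive C] [MonoidalLinear ℂ C] [BraidedCategory C]
    [RightRigidCategory C] [RibbonCategory C] extends RibbonFusionCategory C where
  nondegenerate : IsUnit (sMatrix C)

/-! ### The category `C₊ ⊠ C₋`, the functor `R`, and Cardy algebras -/

/-- The category `C₊ ⊠ C₋`: objects are finite direct sums of pairs `V × W` of objects of `C`,
`Hom(V × W, V' × W') = Hom(V, V') ⊗ Hom(W, W')`, and morphisms between direct sums are matrices.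
The first factor carries the braiding `c` and the twist `θ` of `C`, the second `c⁻¹` and `θ⁻¹`. -/
abbrev BoxSquare (C : Type u) [Category.{v} C] [Preadditive C] [Linear ℂ C] :
    Type (max 1 u) :=
  Mat_ (BoxPair C)

section Cardy

open RibbonFusionCategory Mat_

variable {C : Type u} [Category.{v} C] [Abelian C] [Linear ℂ C]
    [MonoidalCategory C] [MonoidalPreadditive C] [MonoidalLinear ℂ C] [BraidedCategory C]
    [RightRigidCategory C] [RibbonCategory C] [RibbonFusionCategory C]

section Bases

/-- The number of simple summands in a chosen decomposition of `V`. -/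
noncomputable def decompLength (V : C) : ℕ := (semisimple V).choose

/-- The simple summands in the chosen decomposition of `V`. -/
noncomputable def decompIndex (V : C) : Fin (decompLength V) → I C :=
  (semisimple V).choose_spec.choose

/-- The chosen decomposition of `V`. -/
noncomputable def decompIso (V : C) : V ≅ ⨁ fun a => U (decompIndex V a) :=
  (semisimple V).choose_spec.choose_spec.some

/-- The index set of the chosen dual bases of `Hom(V, U_i)` and `Hom(U_i, V)`. -/
def BasisIndex (V : C) (i : I C) : Type := {a : Fin (decompLength V) // decompIndex V a = i}

noncomputable instance (V : C) (i : I C) : Fintype (BasisIndex V i) :=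
  inferInstanceAs (Fintype {a : Fin (decompLength V) // decompIndex V a = i})

/-- The chosen basis of `Hom(V, U_i)`. -/
noncomputable def toSimple (V : C) (i : I C) (a : BasisIndex V i) : V ⟶ U i :=
  (decompIso V).hom ≫ biproduct.π _ a.1 ≫ eqToHom (congrArg U a.2)

/-- The dual basis of `Hom(U_i, V)`. -/
noncomputable def fromSimple (V : C) (i : I C) (a : BasisIndex V i) : U i ⟶ V :=
  eqToHom (congrArg U a.2.symm) ≫ biproduct.ι (fun a => U (decompIndex V a)) a.1 ≫
    (decompIso V).inv

theorem fromSimple_toSimple_self (V : C) (i : I C) (a : BasisIndex V i) :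
    fromSimple V i a ≫ toSimple V i a = 𝟙 _ := by
  simp [fromSimple, toSimple]

theorem fromSimple_toSimple_ne (V : C) (i : I C) {a b : BasisIndex V i} (h : a ≠ b) :
    fromSimple V i a ≫ toSimple V i b = 0 := by
  have h' : a.1 ≠ b.1 := fun e => h (Subtype.ext e)
  simp [fromSimple, toSimple, biproduct.ι_π_ne_assoc _ h']

end Bases

/-- `R(A) = ⨁ i, (A ⊗ U_iᘁ) × U_i`. -/
noncomputable def RObj (A : C) : BoxSquare C := ⟨I C, fun i => ⟨A ⊗ ((U i)ᘁ : C), U i⟩⟩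

/-- `R(f) = ⨁ i, (f ⊗ id) × id`. -/
noncomputable def RMap {A B : C} (f : A ⟶ B) : RObj A ⟶ RObj B :=
  Mat_.diag (M := RObj A) (N := RObj B) (fun i => i)
    (fun i => BoxPair.hom (f ▷ ((U i)ᘁ : C)) (𝟙 (U i)))

/-- For the pair `X × Y`, the left leg `X ⟶ (X ⊗ Y) ⊗ U_kᘁ` of the summand `(k, a)` of the unit
`X × Y ⟶ R(X ⊗ Y)` of the adjunction with `R` right adjoint to the tensor product functor
`X × Y ↦ X ⊗ Y`; the right leg is `toSimple Y k a`. -/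
noncomputable def unitLeg (X Y : C) (k : I C) (a : BasisIndex Y k) :
    X ⟶ (X ⊗ Y) ⊗ ((U k)ᘁ : C) :=
  (ρ_ X).inv ≫ X ◁ (η_ (U k : C) ((U k)ᘁ : C) ≫ fromSimple Y k a ▷ ((U k)ᘁ : C)) ≫
    (α_ X Y ((U k)ᘁ : C)).inv

/-- For the pair `X × Y`, the left leg `(X ⊗ Y) ⊗ U_kᘁ ⟶ X` of the summand `(k, a)` of the counit
`R(X ⊗ Y) ⟶ X × Y` of the adjunction with `R` left adjoint to the tensor product functor; the
right leg is `fromSimple Y k a`, and the summand carries the factor `Dim C / dim U_k`. -/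
noncomputable def counitLeg (X Y : C) (k : I C) (a : BasisIndex Y k) :
    (X ⊗ Y) ⊗ ((U k)ᘁ : C) ⟶ X :=
  (α_ X Y ((U k)ᘁ : C)).hom ≫ X ◁ (toSimple Y k a ▷ ((U k)ᘁ : C) ≫ evTilde (U k : C)) ≫
    (ρ_ X).hom

/-- The component `(A ⊗ U_iᘁ) ⊗ U_i ⟶ A` of the counit of the first adjunction. -/
noncomputable def contract (A : C) (i : I C) : (A ⊗ ((U i)ᘁ : C)) ⊗ U i ⟶ A :=
  (α_ A ((U i)ᘁ : C) (U i)).hom ≫ A ◁ ε_ (U i : C) ((U i)ᘁ : C) ≫ (ρ_ A).hom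

/-- The component `A ⟶ (A ⊗ U_iᘁ) ⊗ U_i`, up to the factor `dim U_i / Dim C`, of the unit of the
second adjunction. -/
noncomputable def expand (A : C) (i : I C) : A ⟶ (A ⊗ ((U i)ᘁ : C)) ⊗ U i :=
  (ρ_ A).inv ≫ A ◁ coevTilde (U i : C) ≫ (α_ A ((U i)ᘁ : C) (U i)).inv

/-- The lax unit constraint `𝟙 ⟶ R(𝟙)`. -/
noncomputable def RPhi0 : 𝟙_ (BoxSquare C) ⟶ RObj (𝟙_ C) :=
  ofEntries (M := 𝟙_ (BoxSquare C)) (N := RObj (𝟙_ C)) fun _ (k : I C) =>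
    ∑ a : BasisIndex (𝟙_ C) k,
      BoxPair.hom (X := 𝟙_ (BoxPair C)) (Y := ⟨𝟙_ C ⊗ ((U k)ᘁ : C), U k⟩)
        (unitLeg (𝟙_ C) (𝟙_ C) k a ≫ (λ_ (𝟙_ C)).hom ▷ ((U k)ᘁ : C)) (toSimple (𝟙_ C) k a)

/-- The lax constraint `R(A) ⊗ R(B) ⟶ R(A ⊗ B)`. -/
noncomputable def RPhi2 (A B : C) : RObj A ⊗ RObj B ⟶ RObj (A ⊗ B) :=
  ofEntries (M := RObj A ⊗ RObj B) (N := RObj (A ⊗ B)) fun (p : I C × I C) (k : I C) =>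
    ∑ a : BasisIndex (U p.1 ⊗ U p.2 : C) k,
      BoxPair.hom
        (X := ⟨(A ⊗ ((U p.1)ᘁ : C)) ⊗ (B ⊗ ((U p.2)ᘁ : C)), U p.1 ⊗ U p.2⟩)
        (Y := ⟨(A ⊗ B) ⊗ ((U k)ᘁ : C), U k⟩)
        (unitLeg ((A ⊗ ((U p.1)ᘁ : C)) ⊗ (B ⊗ ((U p.2)ᘁ : C))) (U p.1 ⊗ U p.2) k a ≫
          (tensorμ (A ⊗ ((U p.1)ᘁ : C)) (B ⊗ ((U p.2)ᘁ : C)) (U p.1) (U p.2) ≫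
            (contract A p.1 ⊗ₘ contract B p.2)) ▷ ((U k)ᘁ : C))
        (toSimple (U p.1 ⊗ U p.2) k a)

/-- The colax counit constraint `R(𝟙) ⟶ 𝟙`. -/
noncomputable def RPsi0 : RObj (𝟙_ C) ⟶ 𝟙_ (BoxSquare C) :=
  ofEntries (M := RObj (𝟙_ C)) (N := 𝟙_ (BoxSquare C)) fun (k : I C) _ =>
    (globalDim C / qdim (U k : C)) • ∑ a : BasisIndex (𝟙_ C) k,
      BoxPair.hom (X := ⟨𝟙_ C ⊗ ((U k)ᘁ : C), U k⟩) (Y := 𝟙_ (BoxPair C))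
        ((λ_ (𝟙_ C)).inv ▷ ((U k)ᘁ : C) ≫ counitLeg (𝟙_ C) (𝟙_ C) k a) (fromSimple (𝟙_ C) k a)

/-- The colax constraint `R(A ⊗ B) ⟶ R(A) ⊗ R(B)`. -/
noncomputable def RPsi2 (A B : C) : RObj (A ⊗ B) ⟶ RObj A ⊗ RObj B :=
  ofEntries (M := RObj (A ⊗ B)) (N := RObj A ⊗ RObj B) fun (k : I C) (p : I C × I C) =>
    (qdim (U p.1 : C) * qdim (U p.2 : C) / (qdim (U k : C) * globalDim C)) •
      ∑ a : BasisIndex (U p.1 ⊗ U p.2 : C) k,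
      BoxPair.hom
        (X := ⟨(A ⊗ B) ⊗ ((U k)ᘁ : C), U k⟩)
        (Y := ⟨(A ⊗ ((U p.1)ᘁ : C)) ⊗ (B ⊗ ((U p.2)ᘁ : C)), U p.1 ⊗ U p.2⟩)
        (((expand A p.1 ⊗ₘ expand B p.2) ≫
            tensorδ (A ⊗ ((U p.1)ᘁ : C)) (B ⊗ ((U p.2)ᘁ : C)) (U p.1) (U p.2)) ▷ ((U k)ᘁ : C) ≫
          counitLeg ((A ⊗ ((U p.1)ᘁ : C)) ⊗ (B ⊗ ((U p.2)ᘁ : C))) (U p.1 ⊗ U p.2) k a)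
        (fromSimple (U p.1 ⊗ U p.2) k a)

/-- The structure morphisms of `R(A)` for a Frobenius algebra `A` in `C`. -/
noncomputable def RFrob (A : FrobeniusData C) : FrobeniusData (BoxSquare C) where
  X := RObj A.X
  mul := RPhi2 A.X A.X ≫ RMap A.mul
  one := RPhi0 ≫ RMap A.one
  comul := RMap A.comul ≫ RPsi2 A.X A.X
  counit := RMap A.counit ≫ RPsi0

variable (C) in
/-- `K = ⨁ i j, U_i × U_j`. -/
noncomputable def KObj : BoxSquare C := ⟨I C × I C, fun p => ⟨U p.1, U p.2⟩⟩

variable (C) in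
/-- `ω = ∑ i j, (dim U_i * dim U_j / Dim C) id_{U_i × U_j}`. -/
noncomputable def omega : KObj C ⟶ KObj C :=
  Mat_.diag (M := KObj C) (N := KObj C) (fun p => p)
    (fun p => (qdim (U p.1 : C) * qdim (U p.2 : C) / globalDim C) • 𝟙 ((KObj C).X p))

/-- S-invariance of a morphism `f : A ⊗ B ⟶ B` of `C₊ ⊠ C₋`. -/
def IsSInvariant {A B : BoxSquare C} (f : A ⊗ B ⟶ B) : Prop :=
  ∀ W : BoxSquare C, loopAround f W = loopLinked (KObj C) (omega C) f W

/-- Modular invariance: trivial twist and S-invariant product. -/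
structure IsModularInvariant (A : FrobeniusData (BoxSquare C)) : Prop where
  twist_eq : twist A.X = 𝟙 A.X
  sInvariant : IsSInvariant A.mul

end Cardy

end ModularCategories

/-- A Cardy `C|(C₊ ⊠ C₋)`-algebra: a symmetric Frobenius algebra `op` in `C`, a modular invariant
commutative symmetric Frobenius algebra `cl` in `C₊ ⊠ C₋` and an algebra homomorphism
`ι : cl ⟶ R(op)` satisfying the centre condition and the Cardy condition. -/
structure CardyAlgebra (C : Type u) [Category.{v} C] [Abelian C] [Linear ℂ C]
    [MonoidalCategory C] [MonoidalPreadditive C] [MonoidalLinear ℂ C] [BraidedCategory C]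
    [RightRigidCategory C] [RibbonCategory C] [ModularTensorCategory C] where
  op : FrobeniusAlgebra C
  cl : FrobeniusAlgebra (BoxSquare C)
  op_symmetric : op.IsSymmetric
  cl_symmetric : cl.IsSymmetric
  cl_commutative : cl.IsCommutative
  cl_modularInvariant : IsModularInvariant cl.toFrobeniusData
  ι : cl.X ⟶ (RFrob op.toFrobeniusData).X
  ι_isAlgebraHom :
    FrobeniusData.IsAlgebraHom cl.toFrobeniusData (RFrob op.toFrobeniusData) ι
  /-- The centre condition `m ∘ c ∘ (ι ⊗ id) = m ∘ (ι ⊗ id)`. -/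
  centre : ι ▷ (RFrob op.toFrobeniusData).X ≫
      (β_ (RFrob op.toFrobeniusData).X (RFrob op.toFrobeniusData).X).hom ≫
        (RFrob op.toFrobeniusData).mul =
    ι ▷ (RFrob op.toFrobeniusData).X ≫ (RFrob op.toFrobeniusData).mul
  /-- The Cardy condition `ι ∘ ι* = P^l`. -/
  cardy : FrobeniusData.star cl.toFrobeniusData (RFrob op.toFrobeniusData) ι ≫ ι =
    (RFrob op.toFrobeniusData).leftCentreMap

/-! The idea is to test the Cardy condition on invariants. Since `R` is right adjoint to `T` and
`T(𝟙)` is the unit up to isomorphism, every `w : 𝟙 ⟶ A_op` has a transpose `ŵ : 𝟙 ⟶ R(A_op)`, namely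
`RPhi0 ≫ RMap w`, and `untranspose` recovers `w` from it up to a unitor.

Compose `ŵ` with both sides of `ι ∘ ι* = P^l`. On the left, `ι* ∘ ŵ` is an invariant of the simple
commutative algebra `A_cl`, hence a multiple of its unit: multiplication by an invariant has an
eigenvalue `c`, and the kernel of multiplication by `z - c η` is an ideal (`unit_hom_eq_smul_one`).
Since `ι` preserves units, the left side is a multiple of the unit of `R(A_op)`.

On the right, the closed loop in `P^l` is a kink, so that `P^l = m ∘ (θ ⊗ id) ∘ c ∘ Δ`
(`leftCentreMap_eq`), and on invariants this is `m ∘ rotate ∘ Δ`. Passing back to `C`, the sum over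
the summands `U_i × U_j` has total weight `∑ d_i d_j N_{ij}^k / (d_k Dim C) = 1`, and what is left
is `m ∘ rotate (Δ ∘ w)` (`untranspose_rotate`). The division needs `Dim C ≠ 0`, which follows from
nondegeneracy of `s` (`globalDim_ne_zero`). Hence for every `w` the invariant `m ∘ rotate (Δ ∘ w)`
of `A_op` is a multiple of `η` (`CardyAlgebra.exists_rotate_eq`).

The rest takes place in `C`. By symmetry `Δ ∘ η` is fixed by rotation, so `w = η` gives `m ∘ Δ ∘ η =
l η`, whence `m ∘ Δ = l id`, and `l (ε ∘ η) = dim A_op ≠ 0`: the algebra is special. For a bimodule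
endomorphism `f`, `w = f ∘ η` gives `l f ∘ η = c η`, so `f` is a scalar. Finally `l ≠ 0` permits
averaging over `Δ`, by which every subbimodule splits off; an algebra with only scalar bimodule
endomorphisms is then simple (`isSimple_of_scalar_endomorphisms`). -/

namespace Ribbon

/-! ### Twists and the rotation of invariants -/

section Ribbon

variable {V : Type u} [Category.{v} V] [MonoidalCategory V] [BraidedCategory V]
  [RightRigidCategory V] [RibbonCategory V]

/-- The inverse twist. -/
def twistInv (X : V) : X ⟶ X := (RibbonCategory.twist X).inv

@[simp]
theorem twist_twistInv (X : V) : twist X ≫ twistInv X = 𝟙 X := Iso.hom_inv_id _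

@[simp]
theorem twistInv_twist (X : V) : twistInv X ≫ twist X = 𝟙 X := Iso.inv_hom_id _

theorem twist_naturality {X Y : V} (f : X ⟶ Y) : f ≫ twist Y = twist X ≫ f :=
  RibbonCategory.twist_naturality f

theorem twist_naturality_assoc {X Y Z : V} (f : X ⟶ Y) (g : Y ⟶ Z) :
    f ≫ twist Y ≫ g = twist X ≫ f ≫ g := by
  rw [← Category.assoc, twist_naturality, Category.assoc]

theorem twist_tensor (X Y : V) :
    twist (X ⊗ Y) = (β_ X Y).hom ≫ (β_ Y X).hom ≫ (twist X ⊗ₘ twist Y) :=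
  RibbonCategory.twist_tensor X Y

/-- The double braiding of `𝟙` with itself is trivial, so `θ_𝟙` is idempotent; it is also
invertible. -/
theorem twist_unit : twist (𝟙_ V) = 𝟙 (𝟙_ V) := by
  have h := twist_tensor (𝟙_ V) (𝟙_ V)
  have h1 : twist (𝟙_ V ⊗ 𝟙_ V) = (λ_ (𝟙_ V)).hom ≫ twist (𝟙_ V) ≫ (λ_ (𝟙_ V)).inv := by
    rw [twist_naturality_assoc]; simp
  rw [h1, braiding_tensorUnit_left, MonoidalCategory.tensorHom_def] at h
  have h2 : (twist (𝟙_ V)) = twist (𝟙_ V) ≫ twist (𝟙_ V) := by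
    rw [← cancel_mono (λ_ (𝟙_ V)).inv, ← cancel_epi (λ_ (𝟙_ V)).hom, Category.assoc, h]
    simp [unitors_equal, unitors_inv_equal]
  calc twist (𝟙_ V) = (twist (𝟙_ V) ≫ twist (𝟙_ V)) ≫ twistInv _ := by simp
    _ = _ := by rw [← h2]; simp

/-- A morphism out of the unit absorbs the twist. -/
theorem unit_comp_twist {X : V} (f : 𝟙_ V ⟶ X) : f ≫ twist X = f := by
  rw [twist_naturality, twist_unit, Category.id_comp]

theorem twist_dual (X : V) :
    η_ X (Xᘁ : V) ≫ twist X ▷ (Xᘁ : V) = η_ X (Xᘁ : V) ≫ X ◁ twist (Xᘁ : V) :=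
  RibbonCategory.twist_dual X

/-- For a morphism `𝟙 ⟶ X ⊗ Y` the twists of the two factors agree. -/
theorem unit_comp_twist_whiskerRight {X Y : V} (f : 𝟙_ V ⟶ X ⊗ Y) :
    f ≫ twist X ▷ Y = f ≫ X ◁ twist Y := by
  -- Every invariant is the coevaluation followed by its transpose `Xᘁ ⟶ Y`, and the twist is
  -- natural along that transpose; this reduces the claim to `twist_dual`.
  have hf : f = η_ X (Xᘁ : V) ≫ X ◁ ((ρ_ _).inv ≫ (Xᘁ : V) ◁ f ≫ (α_ _ _ _).inv ≫
      ε_ X (Xᘁ : V) ▷ Y ≫ (λ_ Y).hom) := by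
    symm
    calc _ = 𝟙 _ ⊗≫ (η_ X (Xᘁ : V) ▷ (𝟙_ V) ≫ (X ⊗ (Xᘁ : V)) ◁ f) ⊗≫ X ◁ (ε_ X (Xᘁ : V) ▷ Y) ⊗≫ 𝟙 _ := by
          monoidal
      _ = f ⊗≫ (η_ X (Xᘁ : V) ▷ X ⊗≫ X ◁ (ε_ X (Xᘁ : V))) ▷ Y ⊗≫ 𝟙 _ := by
          rw [← whisker_exchange]; monoidal
      _ = f := by rw [ExactPairing.evaluation_coevaluation'']; monoidal
  generalize ((ρ_ _).inv ≫ (Xᘁ : V) ◁ f ≫ (α_ _ _ _).inv ≫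
      ε_ X (Xᘁ : V) ▷ Y ≫ (λ_ Y).hom) = g at hf
  subst hf
  rw [Category.assoc, Category.assoc, whisker_exchange, ← MonoidalCategory.whiskerLeft_comp,
    twist_naturality, MonoidalCategory.whiskerLeft_comp, ← reassoc_of% twist_dual]

/-- The rotation of a morphism `𝟙 ⟶ X ⊗ Y`. -/
def rotate {X Y : V} (f : 𝟙_ V ⟶ X ⊗ Y) : 𝟙_ V ⟶ Y ⊗ X :=
  f ≫ (β_ X Y).hom ≫ twist Y ▷ X

/-- The twist of `X ⊗ Y` acts trivially on invariants, and it is the double braiding times the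
twists of the factors; so one crossing can be traded for the opposite one. This makes rotation in
`C₊ ⊠ C₋` componentwise although the second factor has the inverse braiding and twist. -/
theorem rotate_eq_inv {X Y : V} (f : 𝟙_ V ⟶ X ⊗ Y) :
    rotate f = f ≫ (β_ Y X).inv ≫ twistInv Y ▷ X := by
  have h := unit_comp_twist f
  rw [twist_tensor, MonoidalCategory.tensorHom_def'] at h
  have h2 : f ≫ (β_ Y X).inv = f ≫ (β_ X Y).hom ≫ twist Y ▷ X ≫ Y ◁ twist X := by
    conv_lhs => rw [← h]
    simp
  have h3 : f ≫ (β_ Y X).inv ≫ twistInv Y ▷ X = f ≫ (β_ X Y).hom ≫ Y ◁ twist X := by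
    rw [reassoc_of% h2, whisker_exchange, ← comp_whiskerRight_assoc]
    simp
  rw [h3, rotate, ← BraidedCategory.braiding_naturality_left,
    ← BraidedCategory.braiding_naturality_right, reassoc_of% unit_comp_twist_whiskerRight]

theorem rotate_naturality {X Y X' Y' : V} (f : 𝟙_ V ⟶ X ⊗ Y) (g : X ⟶ X') (h : Y ⟶ Y') :
    rotate (f ≫ (g ⊗ₘ h)) = rotate f ≫ (h ⊗ₘ g) := by
  simp only [rotate, Category.assoc, BraidedCategory.braiding_naturality_assoc]
  rw [MonoidalCategory.tensorHom_def' h g, Category.assoc, ← comp_whiskerRight, twist_naturality,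
    comp_whiskerRight, ← whisker_exchange_assoc]

end Ribbon

/-! ### Duals of morphisms with respect to exact pairings -/

section Mate

variable {V : Type u} [Category.{v} V] [MonoidalCategory V]

/-- The dual `L' ⟶ K'` of `f : K ⟶ L` with respect to two exact pairings. -/
def mate {K L : V} (K' L' : V) [ExactPairing K K'] [ExactPairing L L'] (f : K ⟶ L) : L' ⟶ K' :=
  (ρ_ L').inv ≫ L' ◁ η_ K K' ≫ (α_ L' K K').inv ≫ (L' ◁ f) ▷ K' ≫ ε_ L L' ▷ K' ≫ (λ_ K').hom

theorem coev_mate {K L K' L' : V} [ExactPairing K K'] [ExactPairing L L'] (f : K ⟶ L) :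
    η_ L L' ≫ L ◁ mate K' L' f = η_ K K' ≫ f ▷ K' := by
  unfold mate
  calc _ = 𝟙 _ ⊗≫ (η_ L L' ▷ (𝟙_ V) ≫ (L ⊗ L') ◁ (η_ K K' ≫ f ▷ K')) ⊗≫
        L ◁ (ε_ L L' ▷ K') ⊗≫ 𝟙 _ := by monoidal
    _ = (η_ K K' ≫ f ▷ K') ⊗≫ (η_ L L' ▷ L ⊗≫ L ◁ ε_ L L') ▷ K' ⊗≫ 𝟙 _ := by
      rw [← whisker_exchange]; monoidal
    _ = _ := by rw [ExactPairing.evaluation_coevaluation'']; monoidal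

theorem mate_ev {K L K' L' : V} [ExactPairing K K'] [ExactPairing L L'] (f : K ⟶ L) :
    mate K' L' f ▷ K ≫ ε_ K K' = L' ◁ f ≫ ε_ L L' := by
  unfold mate
  calc _ = 𝟙 _ ⊗≫ L' ◁ (η_ K K' ▷ K) ⊗≫ ((L' ◁ f ≫ ε_ L L') ▷ (K' ⊗ K) ≫ (𝟙_ V) ◁ ε_ K K') ⊗≫
        𝟙 _ := by monoidal
    _ = 𝟙 _ ⊗≫ L' ◁ (η_ K K' ▷ K ⊗≫ K ◁ ε_ K K') ⊗≫ (L' ◁ f ≫ ε_ L L') ⊗≫ 𝟙 _ := by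
      rw [← whisker_exchange]; monoidal
    _ = _ := by rw [ExactPairing.evaluation_coevaluation'']; monoidal

end Mate

/-! ### Partial traces and sphericity -/

section PartialTrace

variable {V : Type u} [Category.{v} V] [MonoidalCategory V] [BraidedCategory V]
  [RightRigidCategory V] [RibbonCategory V]

/-- The second evaluation `X ⊗ Y ⟶ 𝟙` of an exact pairing in a ribbon category. -/
def evT (X Y : V) [ExactPairing X Y] : X ⊗ Y ⟶ 𝟙_ V :=
  twist X ▷ Y ≫ (β_ X Y).hom ≫ ε_ X Y

/-- The second coevaluation `𝟙 ⟶ Y ⊗ X` of an exact pairing in a ribbon category. -/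
def coevT (X Y : V) [ExactPairing X Y] : 𝟙_ V ⟶ Y ⊗ X :=
  η_ X Y ≫ (β_ X Y).hom ≫ Y ◁ twist X

theorem whiskerLeft_mate_evT {K L K' L' : V} [ExactPairing K K'] [ExactPairing L L']
    (f : K ⟶ L) : K ◁ mate K' L' f ≫ evT K K' = f ▷ L' ≫ evT L L' := by
  unfold evT
  rw [whisker_exchange_assoc, BraidedCategory.braiding_naturality_right_assoc, mate_ev,
    ← comp_whiskerRight_assoc, twist_naturality, comp_whiskerRight_assoc,
    BraidedCategory.braiding_naturality_left_assoc f]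

/-- The partial trace over `K` of a morphism `W ⊗ K ⟶ W' ⊗ K`. -/
def ptr (K K' : V) [ExactPairing K K'] {W W' : V} (h : W ⊗ K ⟶ W' ⊗ K) : W ⟶ W' :=
  (ρ_ W).inv ≫ W ◁ η_ K K' ≫ (α_ W K K').inv ≫ h ▷ K' ≫ (α_ W' K K').hom ≫
    W' ◁ evT K K' ≫ (ρ_ W').hom

/-- Cyclicity of the partial trace, which is also its independence of the exact pairing. -/
theorem ptr_cyclic {K L : V} (K' L' : V) [ExactPairing K K'] [ExactPairing L L'] {W W' : V}
    (f : K ⟶ L) (h : W ⊗ L ⟶ W' ⊗ K) :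
    ptr K K' (W ◁ f ≫ h) = ptr L L' (h ≫ W' ◁ f) := by
  unfold ptr
  calc _ = 𝟙 _ ⊗≫ W ◁ (η_ K K' ≫ f ▷ K') ⊗≫ h ▷ K' ⊗≫ W' ◁ evT K K' ⊗≫ 𝟙 _ := by monoidal
    -- The morphism `f` travels around the loop: at the cup it becomes its mate, which commutes with
    -- `h`, and at the cap it becomes `f` again.
    _ = 𝟙 _ ⊗≫ W ◁ η_ L L' ⊗≫ ((W ⊗ L) ◁ mate K' L' f ≫ h ▷ K') ⊗≫ W' ◁ evT K K' ⊗≫ 𝟙 _ := by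
      rw [← coev_mate (L' := L')]; monoidal
    _ = 𝟙 _ ⊗≫ W ◁ η_ L L' ⊗≫ h ▷ L' ⊗≫ W' ◁ (K ◁ mate K' L' f ≫ evT K K') ⊗≫ 𝟙 _ := by
      rw [whisker_exchange]; monoidal
    _ = _ := by rw [whiskerLeft_mate_evT]; monoidal

/-- Cyclicity along the identity of `K`, with a different dual on each side. It allows a loop to be
computed with whichever pairing is convenient. -/
theorem ptr_pairing {K : V} (K' K'' : V) (p : ExactPairing K K') (q : ExactPairing K K'')
    {W W' : V} (h : W ⊗ K ⟶ W' ⊗ K) :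
    @ptr V _ _ _ _ _ K K' p W W' h = @ptr V _ _ _ _ _ K K'' q W W' h := by
  simpa using ptr_cyclic K' K'' (𝟙 K) h

theorem ptr_comp_left {K K' : V} [ExactPairing K K'] {W W' W'' : V} (f : W ⟶ W')
    (h : W' ⊗ K ⟶ W'' ⊗ K) : ptr K K' (f ▷ K ≫ h) = f ≫ ptr K K' h := by
  unfold ptr
  calc _ = 𝟙 _ ⊗≫ (W ◁ η_ K K' ≫ f ▷ (K ⊗ K')) ⊗≫ h ▷ K' ⊗≫ W'' ◁ evT K K' ⊗≫ 𝟙 _ := by monoidal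
    _ = _ := by rw [whisker_exchange]; monoidal

theorem ptr_comp_right {K K' : V} [ExactPairing K K'] {W W' W'' : V}
    (h : W ⊗ K ⟶ W' ⊗ K) (f : W' ⟶ W'') : ptr K K' (h ≫ f ▷ K) = ptr K K' h ≫ f := by
  unfold ptr
  calc _ = 𝟙 _ ⊗≫ W ◁ η_ K K' ⊗≫ h ▷ K' ⊗≫ (f ▷ (K ⊗ K') ≫ W'' ◁ evT K K') ⊗≫ 𝟙 _ := by monoidal
    _ = _ := by rw [← whisker_exchange]; monoidal

theorem ptr_whiskerLeft {K K' : V} [ExactPairing K K'] (X : V) {W W' : V}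
    (h : W ⊗ K ⟶ W' ⊗ K) :
    ptr K K' ((α_ X W K).hom ≫ X ◁ h ≫ (α_ X W' K).inv) = X ◁ ptr K K' h := by
  unfold ptr
  monoidal

/-- A strand `Y` slides across a cap `X ⊗ X' ⟶ 𝟙`. -/
theorem slide_cap {X X' Y : V} (d : X ⊗ X' ⟶ 𝟙_ V) :
    X ◁ (β_ Y X').hom ≫ (α_ X X' Y).inv ≫ d ▷ Y =
      (α_ X Y X').inv ≫ (β_ Y X).inv ▷ X' ≫ (α_ Y X X').hom ≫ Y ◁ d ≫ (ρ_ Y).hom ≫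
        (λ_ Y).inv := by
  have h := BraidedCategory.braiding_naturality_right Y d
  rw [BraidedCategory.braiding_tensor_right_hom, braiding_tensorUnit_right] at h
  rw [h]
  simp

theorem slide_cap_left {X Y Y' : V} (d : Y ⊗ Y' ⟶ 𝟙_ V) :
    (β_ X Y).hom ▷ Y' ≫ (α_ Y X Y').hom ≫ Y ◁ (β_ X Y').hom ≫ (α_ Y Y' X).inv ≫ d ▷ X =
      (α_ X Y Y').hom ≫ X ◁ d ≫ (ρ_ X).hom ≫ (λ_ X).inv := by
  have h := BraidedCategory.braiding_naturality_right X d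
  rw [BraidedCategory.braiding_tensor_right_hom, braiding_tensorUnit_right] at h
  rw [h]
  simp

theorem twist_tensor_braiding_inv (X Y : V) :
    twist (X ⊗ Y) ≫ (β_ Y X).inv = (twist X ⊗ₘ twist Y) ≫ (β_ X Y).hom := by
  rw [twist_tensor, Category.assoc, Category.assoc, BraidedCategory.braiding_inv_naturality]
  simp

/-- Sliding `Y` across the cap of `X` leaves an inverse crossing, which cancels one half of the
double braiding in the twist of `X ⊗ Y`. The other half disappears when `X` is pulled across the cap
of `Y`. -/
theorem evT_tensor (X X' Y Y' : V) [ExactPairing X X'] [ExactPairing Y Y'] :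
    evT (X ⊗ Y) (Y' ⊗ X') = 𝟙 _ ⊗≫ X ◁ evT Y Y' ▷ X' ⊗≫ evT X X' := by
  unfold evT
  rw [ExactPairing.tensor_evaluation]
  calc _ = 𝟙 _ ⊗≫ twist (X ⊗ Y) ▷ (Y' ⊗ X') ⊗≫ (β_ (X ⊗ Y) Y').hom ▷ X' ⊗≫
        Y' ◁ (X ◁ (β_ Y X').hom ≫ (α_ X X' Y).inv ≫ ((β_ X X').hom ≫ ε_ X X') ▷ Y) ⊗≫
          ε_ Y Y' ⊗≫ 𝟙 _ := by
        rw [BraidedCategory.braiding_tensor_right_hom,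
          BraidedCategory.braiding_tensor_left_hom X Y X']; monoidal
    _ = 𝟙 _ ⊗≫ twist (X ⊗ Y) ▷ (Y' ⊗ X') ⊗≫
        ((β_ (X ⊗ Y) Y').hom ≫ Y' ◁ (β_ Y X).inv) ▷ X' ⊗≫
          ((Y' ⊗ Y) ◁ ((β_ X X').hom ≫ ε_ X X') ≫ ε_ Y Y' ▷ (𝟙_ V)) ⊗≫ 𝟙 _ := by
        rw [slide_cap]; monoidal
    _ = 𝟙 _ ⊗≫ (twist (X ⊗ Y) ≫ (β_ Y X).inv) ▷ (Y' ⊗ X') ⊗≫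
        (β_ (Y ⊗ X) Y').hom ▷ X' ⊗≫ ε_ Y Y' ▷ (X ⊗ X') ⊗≫ ((β_ X X').hom ≫ ε_ X X') := by
        rw [← BraidedCategory.braiding_naturality_left, whisker_exchange]; monoidal
    _ = 𝟙 _ ⊗≫ (twist X ⊗ₘ twist Y) ▷ (Y' ⊗ X') ⊗≫
        ((β_ X Y).hom ▷ Y' ≫ (α_ Y X Y').hom ≫ Y ◁ (β_ X Y').hom ≫ (α_ Y Y' X).inv ≫
          ((β_ Y Y').hom ≫ ε_ Y Y') ▷ X) ▷ X' ⊗≫ ((β_ X X').hom ≫ ε_ X X') := by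
        rw [twist_tensor_braiding_inv, BraidedCategory.braiding_tensor_left_hom]; monoidal
    _ = 𝟙 _ ⊗≫ (twist X ▷ (Y ⊗ Y') ≫ X ◁ (twist Y ▷ Y' ≫ (β_ Y Y').hom ≫ ε_ Y Y')) ▷ X' ⊗≫
          ((β_ X X').hom ≫ ε_ X X') := by
        rw [slide_cap_left, MonoidalCategory.tensorHom_def]; monoidal
    _ = _ := by rw [← whisker_exchange]; monoidal

theorem ptr_tensor (X X' Y Y' : V) [ExactPairing X X'] [ExactPairing Y Y'] {W W' : V}
    (h : W ⊗ (X ⊗ Y) ⟶ W' ⊗ (X ⊗ Y)) :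
    ptr (X ⊗ Y) (Y' ⊗ X') h =
      ptr X X' (ptr Y Y' ((α_ W X Y).hom ≫ h ≫ (α_ W' X Y).inv)) := by
  unfold ptr
  rw [evT_tensor, ExactPairing.tensor_coevaluation]
  calc _ = 𝟙 _ ⊗≫ W ◁ η_ X X' ⊗≫ W ◁ X ◁ η_ Y Y' ▷ X' ⊗≫ h ▷ Y' ▷ X' ⊗≫
        W' ◁ X ◁ evT Y Y' ▷ X' ⊗≫ W' ◁ evT X X' ⊗≫ 𝟙 _ := by monoidal
    _ = _ := by monoidal

theorem coevT_eq_rotate (X Y : V) [ExactPairing X Y] : coevT X Y = rotate (η_ X Y) := by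
  rw [coevT, rotate, ← BraidedCategory.braiding_naturality_left,
    ← BraidedCategory.braiding_naturality_right, reassoc_of% unit_comp_twist_whiskerRight]

/-- On invariants the crossing may be reversed at the price of inverting the twist, and the inverse
twists of the two factors agree. -/
theorem coevT_eq_inv (X Y : V) [ExactPairing X Y] :
    coevT X Y = η_ X Y ≫ (β_ Y X).inv ≫ Y ◁ twistInv X := by
  have h : ∀ f : 𝟙_ V ⟶ Y ⊗ X, f ≫ twistInv Y ▷ X = f ≫ Y ◁ twistInv X := by
    intro f
    have h1 := unit_comp_twist_whiskerRight (f ≫ twistInv Y ▷ X ≫ Y ◁ twistInv X)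
    simp only [Category.assoc, ← MonoidalCategory.whiskerLeft_comp, twistInv_twist,
      MonoidalCategory.whiskerLeft_id, Category.comp_id] at h1
    rw [← h1, whisker_exchange, ← comp_whiskerRight_assoc]
    simp
  rw [coevT_eq_rotate, rotate_eq_inv, ← Category.assoc, h, Category.assoc]

theorem twist_whiskerRight_comp_ev (X Y : V) [ExactPairing X Y] :
    twist Y ▷ X ≫ ε_ X Y = Y ◁ twist X ≫ ε_ X Y := by
  -- A morphism `Y ⟶ Y` is determined by its composite with the coevaluation, and there the twists
  -- of `X` and `Y` agree.
  have h : mate Y Y (twist X) = twist Y := by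
    have h1 : η_ X Y ≫ X ◁ mate Y Y (twist X) = η_ X Y ≫ X ◁ twist Y := by
      rw [coev_mate, unit_comp_twist_whiskerRight]
    have h2 : ∀ a : Y ⟶ Y, a = 𝟙 _ ⊗≫ Y ◁ (η_ X Y ≫ X ◁ a) ⊗≫ ε_ X Y ▷ Y ⊗≫ 𝟙 _ := by
      intro a
      symm
      calc _ = 𝟙 _ ⊗≫ Y ◁ η_ X Y ⊗≫ ((Y ⊗ X) ◁ a ≫ ε_ X Y ▷ Y) ⊗≫ 𝟙 _ := by monoidal
        _ = 𝟙 _ ⊗≫ (Y ◁ η_ X Y ⊗≫ ε_ X Y ▷ Y) ⊗≫ a := by rw [whisker_exchange]; monoidal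
        _ = a := by rw [ExactPairing.coevaluation_evaluation'']; monoidal
    rw [h2 (mate Y Y (twist X)), h1, ← h2]
  rw [← h, mate_ev]

theorem ev_eq_evT (X Y : V) [ExactPairing X Y] :
    ε_ X Y = (β_ Y X).hom ≫ twist X ▷ Y ≫ evT X Y := by
  have h := twist_naturality (ε_ X Y)
  rw [twist_unit, Category.comp_id, twist_tensor, MonoidalCategory.tensorHom_def'] at h
  rw [h, evT]
  simp only [Category.assoc, twist_whiskerRight_comp_ev,
    BraidedCategory.braiding_naturality_left_assoc]

theorem braiding_inv_ev (X Y : V) [ExactPairing X Y] :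
    (β_ Y X).inv ≫ ε_ X Y = twist X ▷ Y ≫ evT X Y := by
  rw [Iso.inv_comp_eq, ev_eq_evT]

/-- The partial trace over the left tensor factor. -/
def ltr (U U' : V) [ExactPairing U U'] {Z Z' : V} (h : U ⊗ Z ⟶ U ⊗ Z') : Z ⟶ Z' :=
  (λ_ Z).inv ≫ coevT U U' ▷ Z ≫ (α_ U' U Z).hom ≫ U' ◁ h ≫ (α_ U' U Z').inv ≫
    ε_ U U' ▷ Z' ≫ (λ_ Z').hom

theorem slide_cup {U U' : V} (Z : V) (e : 𝟙_ V ⟶ U' ⊗ U) :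
    e ▷ Z ≫ (α_ U' U Z).hom ≫ U' ◁ (β_ Z U).inv =
      (λ_ Z).hom ≫ (ρ_ Z).inv ≫ Z ◁ e ≫ (α_ Z U' U).inv ≫ (β_ Z U').hom ▷ U ≫
        (α_ U' Z U).hom := by
  have h := BraidedCategory.braiding_naturality_right Z e
  rw [BraidedCategory.braiding_tensor_right_hom, braiding_tensorUnit_right] at h
  have h' : e ▷ Z = (λ_ Z).hom ≫ (ρ_ Z).inv ≫ Z ◁ e ≫ (α_ Z U' U).inv ≫ (β_ Z U').hom ▷ U ≫
      (α_ U' Z U).hom ≫ U' ◁ (β_ Z U).hom ≫ (α_ U' U Z).inv := by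
    rw [h]; simp
  rw [h']
  simp

theorem slide_cup_inv {U U' : V} (Z : V) (e : 𝟙_ V ⟶ U' ⊗ U) :
    e ▷ Z ≫ (α_ U' U Z).hom ≫ U' ◁ (β_ U Z).hom =
      (λ_ Z).hom ≫ (ρ_ Z).inv ≫ Z ◁ e ≫ (α_ Z U' U).inv ≫ (β_ U' Z).inv ▷ U ≫
        (α_ U' Z U).hom := by
  have h := BraidedCategory.braiding_naturality_left e Z
  rw [BraidedCategory.braiding_tensor_left_hom, braiding_tensorUnit_left] at h
  simp only [Category.assoc] at h
  rw [← reassoc_of% h]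
  simp

theorem slide_cap_inv {X X' Y : V} (d : X ⊗ X' ⟶ 𝟙_ V) :
    X ◁ (β_ X' Y).inv ≫ (α_ X X' Y).inv ≫ d ▷ Y =
      (α_ X Y X').inv ≫ (β_ X Y).hom ▷ X' ≫ (α_ Y X X').hom ≫ Y ◁ d ≫ (ρ_ Y).hom ≫
        (λ_ Y).inv := by
  have h := BraidedCategory.braiding_inv_naturality_right Y d
  rw [BraidedCategory.braiding_tensor_left_inv, braiding_inv_tensorUnit_left] at h
  rw [h]
  simp

/-- A loop may be closed on either side. Sliding the open strand off the cup and the cap turns its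
crossings with `U` into crossings with `U'`, which pass through `k` and cancel. The loop keeps a
twist before `k` and an inverse twist after it, and these cancel by cyclicity. -/
theorem ltr_eq_ptr_braiding (U U' : V) [ExactPairing U U'] {Z Z' : V} (k : Z ⊗ U ⟶ Z' ⊗ U) :
    ltr U U' ((β_ Z U).inv ≫ k ≫ (β_ Z' U).hom) = ptr U U' k := by
  calc _ = 𝟙 _ ⊗≫ (coevT U U' ▷ Z ≫ (α_ U' U Z).hom ≫ U' ◁ (β_ Z U).inv) ⊗≫ U' ◁ k ⊗≫
        (U' ◁ (β_ Z' U).hom ≫ (α_ U' U Z').inv ≫ ε_ U U' ▷ Z') ⊗≫ 𝟙 _ := by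
        unfold ltr; monoidal
    _ = 𝟙 _ ⊗≫ Z ◁ (η_ U U' ≫ twist U ▷ U') ⊗≫ ((β_ (Z ⊗ U) U').hom ≫ U' ◁ k) ⊗≫
          (β_ Z' U').inv ▷ U ⊗≫ Z' ◁ ε_ U U' ⊗≫ 𝟙 _ := by
        rw [slide_cup, slide_cap, coevT, BraidedCategory.braiding_tensor_left_hom,
          ← BraidedCategory.braiding_naturality_left]
        monoidal
    _ = 𝟙 _ ⊗≫ Z ◁ (η_ U U' ≫ twist U ▷ U') ⊗≫ k ▷ U' ⊗≫ Z' ◁ (β_ U U').hom ⊗≫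
          ((β_ Z' U').hom ≫ (β_ Z' U').inv) ▷ U ⊗≫ Z' ◁ ε_ U U' ⊗≫ 𝟙 _ := by
        rw [← BraidedCategory.braiding_naturality_left, BraidedCategory.braiding_tensor_left_hom]
        monoidal
    _ = 𝟙 _ ⊗≫ Z ◁ (η_ U U' ≫ twist U ▷ U') ⊗≫ k ▷ U' ⊗≫
          Z' ◁ ((twistInv U ≫ twist U) ▷ U' ≫ (β_ U U').hom ≫ ε_ U U') ⊗≫ 𝟙 _ := by
        rw [Iso.hom_inv_id, twistInv_twist]; monoidal
    _ = ptr U U' (Z ◁ twist U ≫ k ≫ Z' ◁ twistInv U) := by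
        unfold ptr evT; monoidal
    _ = _ := by
        rw [ptr_cyclic U' U', Category.assoc, ← MonoidalCategory.whiskerLeft_comp]
        simp

/-- The same move with the opposite crossings. Both are needed, since the two nested loops in
`expd_tensorδ_tensorμ_contr` cross the other strands in opposite ways. -/
theorem ltr_eq_ptr_braiding_inv (U U' : V) [ExactPairing U U'] {Z Z' : V}
    (k : Z ⊗ U ⟶ Z' ⊗ U) :
    ltr U U' ((β_ U Z).hom ≫ k ≫ (β_ U Z').inv) = ptr U U' k := by
  calc _ = 𝟙 _ ⊗≫ (coevT U U' ▷ Z ≫ (α_ U' U Z).hom ≫ U' ◁ (β_ U Z).hom) ⊗≫ U' ◁ k ⊗≫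
        (U' ◁ (β_ U Z').inv ≫ (α_ U' U Z').inv ≫ ε_ U U' ▷ Z') ⊗≫ 𝟙 _ := by
        unfold ltr; monoidal
    _ = 𝟙 _ ⊗≫ Z ◁ (η_ U U' ≫ twistInv U ▷ U') ⊗≫ ((β_ U' (Z ⊗ U)).inv ≫ U' ◁ k) ⊗≫
          (β_ U' Z').hom ▷ U ⊗≫ Z' ◁ ε_ U U' ⊗≫ 𝟙 _ := by
        rw [slide_cup_inv, slide_cap_inv, coevT_eq_inv, BraidedCategory.braiding_tensor_right_inv,
          ← BraidedCategory.braiding_inv_naturality_left]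
        monoidal
    _ = 𝟙 _ ⊗≫ Z ◁ (η_ U U' ≫ twistInv U ▷ U') ⊗≫ k ▷ U' ⊗≫ Z' ◁ (β_ U' U).inv ⊗≫
          ((β_ U' Z').inv ≫ (β_ U' Z').hom) ▷ U ⊗≫ Z' ◁ ε_ U U' ⊗≫ 𝟙 _ := by
        rw [← BraidedCategory.braiding_inv_naturality_left,
          BraidedCategory.braiding_tensor_right_inv]
        monoidal
    _ = 𝟙 _ ⊗≫ Z ◁ (η_ U U' ≫ twistInv U ▷ U') ⊗≫ k ▷ U' ⊗≫
          Z' ◁ ((β_ U' U).inv ≫ ε_ U U') ⊗≫ 𝟙 _ := by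
        rw [Iso.inv_hom_id]; monoidal
    _ = ptr U U' (Z ◁ twistInv U ≫ k ≫ Z' ◁ twist U) := by
        rw [braiding_inv_ev]; unfold ptr; monoidal
    _ = _ := by
        rw [ptr_cyclic U' U', Category.assoc, ← MonoidalCategory.whiskerLeft_comp]
        simp

theorem ptr_unit {W W' : V} (h : W ⟶ W') : ptr (𝟙_ V) (𝟙_ V) (h ▷ 𝟙_ V) = h := by
  have hη : η_ (𝟙_ V) (𝟙_ V) = (ρ_ (𝟙_ V)).inv := rfl
  have hε : ε_ (𝟙_ V) (𝟙_ V) = (ρ_ (𝟙_ V)).hom := rfl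
  unfold ptr evT
  rw [hη, hε, twist_unit, braiding_tensorUnit_left]
  monoidal

/-- The scalar endomorphism `Tr_K(f)` of the unit. -/
def tr (K K' : V) [ExactPairing K K'] (f : K ⟶ K) : 𝟙_ V ⟶ 𝟙_ V :=
  η_ K K' ≫ f ▷ K' ≫ evT K K'

theorem ptr_whiskerLeft_eq_tr (K K' : V) [ExactPairing K K'] (W : V) (f : K ⟶ K) :
    ptr K K' (W ◁ f) = (ρ_ W).inv ≫ W ◁ tr K K' f ≫ (ρ_ W).hom := by
  unfold ptr tr; monoidal

theorem tr_eq_ptr (K K' : V) [ExactPairing K K'] (f : K ⟶ K) :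
    tr K K' f = ptr K K' (𝟙_ V ◁ f) := by
  rw [ptr_whiskerLeft_eq_tr]; monoidal

theorem tr_cyclic {K L : V} (K' L' : V) [ExactPairing K K'] [ExactPairing L L']
    (f : K ⟶ L) (g : L ⟶ K) : tr K K' (f ≫ g) = tr L L' (g ≫ f) := by
  rw [tr_eq_ptr, tr_eq_ptr, MonoidalCategory.whiskerLeft_comp, ptr_cyclic K' L',
    MonoidalCategory.whiskerLeft_comp]

theorem tr_unit (f : 𝟙_ V ⟶ 𝟙_ V) : tr (𝟙_ V) (𝟙_ V) f = f := by
  rw [tr_eq_ptr]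
  have : 𝟙_ V ◁ f = f ▷ 𝟙_ V := by
    rw [id_whiskerLeft, whiskerRight_id, unitors_equal, unitors_inv_equal]
  rw [this, ptr_unit]

/-- `Tr_K(p ≫ q) = q ≫ p` for morphisms `K ⟶ 𝟙 ⟶ K`. -/
theorem tr_factor {K : V} (K' : V) [ExactPairing K K'] (p : K ⟶ 𝟙_ V) (q : 𝟙_ V ⟶ K) :
    tr K K' (p ≫ q) = q ≫ p := by
  rw [tr_cyclic K' (𝟙_ V), tr_unit]

theorem evT_dual_pairing_zigzag (X Y : V) [ExactPairing X Y] :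
    X ◁ coevT X Y ≫ (α_ X Y X).inv ≫ evT X Y ▷ X = (ρ_ X).hom ≫ (λ_ X).inv := by
  have h := @ExactPairing.coevaluation_evaluation V _ _ Y X (BraidedCategory.exactPairing_swap X Y)
  -- The braiding alone already gives a reversed exact pairing; the pairing at hand differs from it
  -- by a twist in the cap and an inverse twist in the cup.
  change X ◁ (η_ X Y ≫ (β_ Y X).inv) ≫ (α_ X Y X).inv ≫ ((β_ X Y).hom ≫ ε_ X Y) ▷ X = _ at h
  rw [coevT_eq_inv]
  unfold evT
  calc _ = 𝟙 _ ⊗≫ X ◁ (η_ X Y ≫ (β_ Y X).inv) ⊗≫ ((X ⊗ Y) ◁ twistInv X ≫ (twist X ▷ Y ≫ (β_ X Y).hom ≫ ε_ X Y) ▷ X) ⊗≫ 𝟙 _ := by monoidal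
    _ = 𝟙 _ ⊗≫ (X ◁ (η_ X Y ≫ (β_ Y X).inv) ≫ twist X ▷ (Y ⊗ X)) ⊗≫ ((β_ X Y).hom ≫ ε_ X Y) ▷ X ⊗≫ twistInv X ⊗≫ 𝟙 _ := by
        rw [whisker_exchange]; monoidal
    _ = twist X ▷ 𝟙_ V ⊗≫ (X ◁ (η_ X Y ≫ (β_ Y X).inv) ≫ (α_ X Y X).inv ≫ ((β_ X Y).hom ≫ ε_ X Y) ▷ X) ⊗≫ twistInv X ⊗≫ 𝟙 _ := by
        rw [whisker_exchange]; monoidal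
    _ = 𝟙 _ ⊗≫ (twist X ≫ twistInv X) ⊗≫ 𝟙 _ := by
        rw [h]; monoidal
    _ = _ := by rw [twist_twistInv]; monoidal

theorem coevT_dual_pairing_zigzag (X Y : V) [ExactPairing X Y] :
    coevT X Y ▷ Y ≫ (α_ Y X Y).hom ≫ Y ◁ evT X Y = (λ_ Y).hom ≫ (ρ_ Y).inv := by
  have h := @ExactPairing.evaluation_coevaluation V _ _ Y X (BraidedCategory.exactPairing_swap X Y)
  change (η_ X Y ≫ (β_ Y X).inv) ▷ Y ≫ (α_ Y X Y).hom ≫ Y ◁ ((β_ X Y).hom ≫ ε_ X Y) = _ at h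
  rw [← h, coevT_eq_inv]
  unfold evT
  calc _ = 𝟙 _ ⊗≫ (η_ X Y ≫ (β_ Y X).inv) ▷ Y ⊗≫ Y ◁ ((twistInv X ≫ twist X) ▷ Y ≫ (β_ X Y).hom ≫ ε_ X Y) ⊗≫ 𝟙 _ := by monoidal
    _ = _ := by rw [twistInv_twist]; monoidal

/-- The reversed pairing with the second (co)evaluation. -/
@[reducible]
def dualPairing (X Y : V) [ExactPairing X Y] : ExactPairing Y X where
  coevaluation' := coevT X Y
  evaluation' := evT X Y
  coevaluation_evaluation' := evT_dual_pairing_zigzag X Y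
  evaluation_coevaluation' := coevT_dual_pairing_zigzag X Y

/-- An object and its dual have the same dimension. -/
theorem tr_id_dual (X Y Y' : V) [ExactPairing X Y] [ExactPairing Y Y'] :
    tr Y Y' (𝟙 Y) = tr X Y (𝟙 X) := by
  -- Closing `Y` with `X` as its dual leaves an inverse braiding from the cup against a braiding
  -- from the cap; they cancel.
  have h : tr Y Y' (𝟙 Y) = @tr V _ _ _ _ _ Y X (dualPairing X Y) (𝟙 Y) := by
    rw [tr_eq_ptr, tr_eq_ptr]
    exact ptr_pairing _ _ _ _ _
  rw [h]
  change coevT X Y ≫ 𝟙 Y ▷ X ≫ twist Y ▷ X ≫ (β_ Y X).hom ≫ evT X Y = _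
  rw [coevT_eq_inv, tr]
  simp only [Category.assoc, id_whiskerRight, Category.id_comp]
  rw [← BraidedCategory.braiding_inv_naturality_left_assoc,
    ← BraidedCategory.braiding_inv_naturality_right_assoc, Iso.inv_hom_id_assoc,
    ← whisker_exchange_assoc, ← reassoc_of% unit_comp_twist_whiskerRight,
    ← comp_whiskerRight_assoc, twist_twistInv, id_whiskerRight, Category.id_comp]

end PartialTrace

/-! ### The left centre map and rotation of products -/

section Rotation

variable {V : Type u} [Category.{v} V] [MonoidalCategory V] [BraidedCategory V]
  [RightRigidCategory V] [RibbonCategory V]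

/-- The left partial trace of the braiding is the twist. -/
theorem ltr_braiding (X X' : V) [ExactPairing X X'] :
    ltr X X' (β_ X X).hom = twist X := by
  unfold ltr
  have h := slide_cap (Y := X) (ε_ X X')
  calc _ = 𝟙 _ ⊗≫ coevT X X' ▷ X ⊗≫ (X' ◁ (β_ X X).hom ≫ (α_ X' X X).inv ≫ ε_ X X' ▷ X) ⊗≫
        𝟙 _ := by monoidal
    _ = 𝟙 _ ⊗≫ (η_ X X' ≫ (β_ X X').hom ≫ (X' ◁ twist X ≫ (β_ X X').inv)) ▷ X ⊗≫
          X ◁ ε_ X X' ⊗≫ 𝟙 _ := by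
        rw [h, coevT]; monoidal
    _ = 𝟙 _ ⊗≫ (η_ X X' ▷ X ⊗≫ (twist X ▷ (X' ⊗ X) ≫ X ◁ ε_ X X')) ⊗≫ 𝟙 _ := by
        rw [BraidedCategory.braiding_inv_naturality_right, Iso.hom_inv_id_assoc]; monoidal
    _ = 𝟙 _ ⊗≫ (η_ X X' ▷ X ⊗≫ X ◁ ε_ X X') ⊗≫ twist X := by
        rw [← whisker_exchange]; monoidal
    _ = _ := by rw [ExactPairing.evaluation_coevaluation'']; monoidal

/-- Pulling `m` through the crossing detaches the loop from the product; what is closed up is a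
single self-crossing, a kink, which equals the twist. On an invariant, `P^l` therefore comultiplies,
rotates and multiplies. -/
theorem leftCentreMap_eq (A : FrobeniusData V) :
    A.leftCentreMap = A.comul ≫ (β_ A.X A.X).hom ≫ twist A.X ▷ A.X ≫ A.mul := by
  rw [← ltr_braiding A.X (A.Xᘁ : V)]
  unfold FrobeniusData.leftCentreMap ltr
  change A.comul ≫ _ ≫ coevT A.X (A.Xᘁ : V) ▷ (A.X ⊗ A.X) ≫ _ = _
  rw [BraidedCategory.braiding_naturality_left, BraidedCategory.braiding_tensor_left_hom]
  congr 1
  calc _ = 𝟙 _ ⊗≫ (coevT A.X (A.Xᘁ : V) ▷ (A.X ⊗ A.X) ≫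
          ((A.Xᘁ : V) ⊗ A.X) ◁ (β_ A.X A.X).hom) ⊗≫
        (A.Xᘁ : V) ◁ ((β_ A.X A.X).hom ▷ A.X) ⊗≫
        (((A.Xᘁ : V) ⊗ A.X) ◁ A.mul ≫ ε_ A.X (A.Xᘁ : V) ▷ A.X) ⊗≫ 𝟙 _ := by monoidal
    _ = _ := by
        rw [← whisker_exchange (coevT A.X (A.Xᘁ : V)), whisker_exchange (ε_ A.X (A.Xᘁ : V))]
        monoidal

/-- The rotation of `f ⊗ g`, with the middle factors interchanged, is the rotation of `f` times
the rotation of `g`. -/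
theorem rotate_tensorμ {X Y X' Y' : V} (f : 𝟙_ V ⟶ X ⊗ Y) (g : 𝟙_ V ⟶ X' ⊗ Y') :
    rotate ((λ_ (𝟙_ V)).inv ≫ (f ⊗ₘ g) ≫ tensorμ X Y X' Y') =
      (λ_ (𝟙_ V)).inv ≫ (rotate f ⊗ₘ rotate g) ≫ tensorμ Y X Y' X' := by
  -- An invariant is transparent: its double braiding with `Y` is that of the unit. This removes the
  -- linking of the two invariants that the twist of `Y ⊗ Y'` creates.
  have hg : Y ◁ g ≫ (β_ Y (X' ⊗ Y')).hom ≫ (β_ (X' ⊗ Y') Y).hom = Y ◁ g := by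
    rw [BraidedCategory.braiding_naturality_right_assoc,
      BraidedCategory.braiding_naturality_left, braiding_tensorUnit_left,
      braiding_tensorUnit_right]
    simp
  unfold rotate
  rw [twist_tensor]
  simp only [tensorμ]
  calc _ = 𝟙 _ ⊗≫ f ⊗≫ (X ⊗ Y) ◁ g ⊗≫ X ◁ (β_ Y X').hom ▷ Y' ⊗≫
        ((β_ (X ⊗ X') (Y ⊗ Y')).hom ≫ ((β_ Y Y').hom ≫ (β_ Y' Y).hom) ▷ (X ⊗ X')) ⊗≫
          (twist Y ⊗ₘ twist Y') ▷ (X ⊗ X') ⊗≫ 𝟙 _ := by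
        rw [MonoidalCategory.tensorHom_def f g]; monoidal
    _ = 𝟙 _ ⊗≫ f ⊗≫ X ◁ (Y ◁ g ≫ (β_ Y (X' ⊗ Y')).hom ≫ (β_ (X' ⊗ Y') Y).hom) ⊗≫
          X ◁ Y ◁ (β_ X' Y').hom ⊗≫ (β_ X Y).hom ▷ (Y' ⊗ X') ⊗≫ Y ◁ (β_ X Y').hom ▷ X' ⊗≫
          (twist Y ⊗ₘ twist Y') ▷ (X ⊗ X') ⊗≫ 𝟙 _ := by
        rw [← BraidedCategory.braiding_naturality_right,
          BraidedCategory.braiding_tensor_left_hom X X']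
        simp only [BraidedCategory.braiding_tensor_left_hom X' Y',
          BraidedCategory.braiding_tensor_right_hom]
        monoidal
    _ = 𝟙 _ ⊗≫ f ⊗≫ (X ⊗ Y) ◁ g ⊗≫
          ((X ⊗ Y) ◁ (β_ X' Y').hom ≫ (β_ X Y).hom ▷ (Y' ⊗ X')) ⊗≫
          (Y ◁ ((β_ X Y').hom ≫ twist Y' ▷ X) ▷ X' ⊗≫ twist Y ▷ (Y' ⊗ X ⊗ X')) ⊗≫ 𝟙 _ := by
        rw [hg, MonoidalCategory.tensorHom_def']; monoidal
    _ = 𝟙 _ ⊗≫ f ⊗≫ ((X ⊗ Y) ◁ g ≫ (β_ X Y).hom ▷ (X' ⊗ Y')) ⊗≫ (Y ⊗ X) ◁ (β_ X' Y').hom ⊗≫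
          Y ◁ (X ◁ twist Y' ≫ (β_ X Y').hom) ▷ X' ⊗≫ twist Y ▷ (Y' ⊗ X ⊗ X') ⊗≫ 𝟙 _ := by
        rw [whisker_exchange, BraidedCategory.braiding_naturality_right]; monoidal
    _ = 𝟙 _ ⊗≫ f ⊗≫ (β_ X Y).hom ⊗≫ (Y ⊗ X) ◁ (g ≫ (β_ X' Y').hom ≫ twist Y' ▷ X') ⊗≫
          (Y ◁ ((β_ X Y').hom ▷ X') ≫ twist Y ▷ ((Y' ⊗ X) ⊗ X')) ⊗≫ 𝟙 _ := by
        rw [whisker_exchange]; monoidal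
    _ = 𝟙 _ ⊗≫ f ⊗≫ (β_ X Y).hom ⊗≫ ((Y ⊗ X) ◁ (g ≫ (β_ X' Y').hom ≫ twist Y' ▷ X') ≫
          (twist Y ▷ X) ▷ (Y' ⊗ X')) ⊗≫ Y ◁ ((β_ X Y').hom ▷ X') ⊗≫ 𝟙 _ := by
        rw [whisker_exchange]; monoidal
    _ = _ := by rw [whisker_exchange, MonoidalCategory.tensorHom_def]; monoidal

end Rotation

/-! ### Expansion followed by contraction is a trace -/

section ContractExpand

variable {V : Type u} [Category.{v} V] [MonoidalCategory V] [BraidedCategory V]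
  [RightRigidCategory V] [RibbonCategory V]

/-- The contraction `(A ⊗ U') ⊗ U ⟶ A`. -/
def contr (A U U' : V) [ExactPairing U U'] : (A ⊗ U') ⊗ U ⟶ A :=
  (α_ A U' U).hom ≫ A ◁ ε_ U U' ≫ (ρ_ A).hom

/-- The expansion `A ⟶ (A ⊗ U') ⊗ U`. -/
def expd (A U U' : V) [ExactPairing U U'] : A ⟶ (A ⊗ U') ⊗ U :=
  (ρ_ A).inv ≫ A ◁ coevT U U' ≫ (α_ A U' U).inv

theorem tr_tensor (U U' W W' : V) [ExactPairing U U'] [ExactPairing W W']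
    (g : U ⊗ W ⟶ U ⊗ W) :
    tr (U ⊗ W) (W' ⊗ U') g = tr U U' (ptr W W' g) := by
  rw [tr_eq_ptr, ptr_tensor, ptr_whiskerLeft, ← tr_eq_ptr]

/-- The inner of the two loops. By naturality `U` passes the expansion and the contraction as a
whole, so it crosses only `B` and `W`; the crossings with `W` surround `g`, and
`ltr_eq_ptr_braiding_inv` turns the left closure of `W` into a right one. -/
theorem expd_contr_aux (B U W W' : V) [ExactPairing W W']
    (g : U ⊗ W ⟶ U ⊗ W) :
    U ◁ expd B W W' ≫ (α_ U (B ⊗ W') W).inv ≫ (β_ (B ⊗ W') U).inv ▷ W ≫ (α_ (B ⊗ W') U W).hom ≫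
      (B ⊗ W') ◁ g ≫ (α_ (B ⊗ W') U W).inv ≫ (β_ (B ⊗ W') U).hom ▷ W ≫ (α_ U (B ⊗ W') W).hom ≫
        U ◁ contr B W W' =
    (β_ B U).inv ≫ B ◁ ptr W W' g ≫ (β_ B U).hom := by
  have h1 : U ◁ expd B W W' ≫ (α_ U (B ⊗ W') W).inv ≫ (β_ (B ⊗ W') U).inv ▷ W =
      (β_ B U).inv ≫ expd B W W' ▷ U ≫ (α_ (B ⊗ W') W U).hom ≫ (B ⊗ W') ◁ (β_ W U).hom ≫
        (α_ (B ⊗ W') U W).inv := by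
    rw [← BraidedCategory.braiding_inv_naturality_right_assoc,
      BraidedCategory.braiding_tensor_left_inv (B ⊗ W') W U]
    simp only [Category.assoc, Iso.inv_hom_id_assoc, whiskerLeft_inv_hom_assoc,
      Iso.hom_inv_id, Category.comp_id]
  have h2 : (β_ (B ⊗ W') U).hom ▷ W ≫ (α_ U (B ⊗ W') W).hom ≫ U ◁ contr B W W' =
      (α_ (B ⊗ W') U W).hom ≫ (B ⊗ W') ◁ (β_ W U).inv ≫ (α_ (B ⊗ W') W U).inv ≫
        contr B W W' ▷ U ≫ (β_ B U).hom := by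
    rw [BraidedCategory.braiding_naturality_left,
      BraidedCategory.braiding_tensor_left_hom (B ⊗ W') W U]
    simp only [Category.assoc, Iso.inv_hom_id_assoc, whiskerLeft_inv_hom_assoc,
      Iso.hom_inv_id_assoc]
  have h3 : B ◁ ptr W W' g = expd B W W' ▷ U ≫ (α_ (B ⊗ W') W U).hom ≫
      (B ⊗ W') ◁ ((β_ W U).hom ≫ g ≫ (β_ W U).inv) ≫ (α_ (B ⊗ W') W U).inv ≫
        contr B W W' ▷ U := by
    rw [← ltr_eq_ptr_braiding_inv]
    unfold ltr expd contr
    monoidal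
  rw [reassoc_of% h1, h2, h3]
  simp

/-- Expanding, applying `g` to the expanded strands and contracting multiplies by the trace
of `g`. -/
theorem expd_tensorδ_tensorμ_contr (A B U U' W W' : V) [ExactPairing U U'] [ExactPairing W W']
    (g : U ⊗ W ⟶ U ⊗ W) :
    (expd A U U' ⊗ₘ expd B W W') ≫ tensorδ (A ⊗ U') (B ⊗ W') U W ≫
      ((A ⊗ U') ⊗ (B ⊗ W')) ◁ g ≫ tensorμ (A ⊗ U') (B ⊗ W') U W ≫
        (contr A U U' ⊗ₘ contr B W W') =
    (ρ_ (A ⊗ B)).inv ≫ (A ⊗ B) ◁ tr (U ⊗ W) (W' ⊗ U') g ≫ (ρ_ (A ⊗ B)).hom := by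
  have h1 : (expd A U U' ⊗ₘ expd B W W') ≫ tensorδ (A ⊗ U') (B ⊗ W') U W ≫
      ((A ⊗ U') ⊗ (B ⊗ W')) ◁ g ≫ tensorμ (A ⊗ U') (B ⊗ W') U W ≫
        (contr A U U' ⊗ₘ contr B W W') =
      A ◁ ltr U U' (U ◁ expd B W W' ≫ (α_ U (B ⊗ W') W).inv ≫ (β_ (B ⊗ W') U).inv ▷ W ≫
        (α_ (B ⊗ W') U W).hom ≫ (B ⊗ W') ◁ g ≫ (α_ (B ⊗ W') U W).inv ≫
          (β_ (B ⊗ W') U).hom ▷ W ≫ (α_ U (B ⊗ W') W).hom ≫ U ◁ contr B W W') := by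
    rw [MonoidalCategory.tensorHom_def, tensorHom_def' (contr A U U')]
    generalize expd B W W' = e
    generalize contr B W W' = c
    unfold ltr tensorδ tensorμ expd contr
    monoidal
  -- Once the inner loop is a partial trace, the outer loop over `U` is conjugated by the braiding
  -- with `B` only, and the two partial traces combine to the trace over `U ⊗ W`.
  rw [h1, expd_contr_aux, ltr_eq_ptr_braiding, ptr_whiskerLeft_eq_tr, tr_tensor]
  monoidal

end ContractExpand

/-! ### Closed strands encircling an object -/

section Encircle

variable {V : Type u} [Category.{v} V] [MonoidalCategory V] [BraidedCategory V]
  [RightRigidCategory V] [RibbonCategory V]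

theorem encircle_eq_ptr (K : V) (ω : K ⟶ K) (X : V) :
    encircle K ω X = ptr K (Kᘁ : V) (X ◁ ω ≫ (β_ X K).hom ≫ (β_ K X).hom) := rfl

theorem encircle_cyclic {K L : V} (f : K ⟶ L) (g : L ⟶ K) (X : V) :
    encircle K (f ≫ g) X = encircle L (g ≫ f) X := by
  rw [encircle_eq_ptr, encircle_eq_ptr, MonoidalCategory.whiskerLeft_comp, Category.assoc,
    ptr_cyclic (Kᘁ : V) (Lᘁ : V)]
  simp

theorem encircle_unit (K : V) (f : K ⟶ K) : encircle K f (𝟙_ V) = tr K (Kᘁ : V) f := by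
  rw [encircle_eq_ptr, tr_eq_ptr, braiding_tensorUnit_left, braiding_tensorUnit_right]
  simp

/-- By the hexagons, a strand coloured `K ⊗ L` is two parallel strands, and its loop comes apart
into two loops around `X`, one after the other. -/
theorem encircle_tensor (K L X : V) :
    encircle (K ⊗ L) (𝟙 _) X = encircle L (𝟙 _) X ≫ encircle K (𝟙 _) X := by
  rw [encircle_eq_ptr, ptr_pairing _ ((Lᘁ : V) ⊗ (Kᘁ : V)) _ ExactPairing.tensor, ptr_tensor]
  have h : (α_ X K L).hom ≫ (X ◁ 𝟙 (K ⊗ L) ≫ (β_ X (K ⊗ L)).hom ≫ (β_ (K ⊗ L) X).hom) ≫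
      (α_ X K L).inv = (β_ X K).hom ▷ L ≫ ((α_ K X L).hom ≫
        K ◁ (X ◁ 𝟙 L ≫ (β_ X L).hom ≫ (β_ L X).hom) ≫ (α_ K X L).inv) ≫ (β_ K X).hom ▷ L := by
    simp
  rw [h, ptr_comp_left, ptr_comp_right, ptr_whiskerLeft, ← encircle_eq_ptr,
    ← BraidedCategory.braiding_naturality_left_assoc, ptr_comp_left, encircle_eq_ptr K]
  simp

variable [Preadditive V] [MonoidalPreadditive V]

theorem ptr_add (K K' : V) [ExactPairing K K'] {W W' : V} (h h' : W ⊗ K ⟶ W' ⊗ K) :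
    ptr K K' (h + h') = ptr K K' h + ptr K K' h' := by
  simp [ptr, MonoidalPreadditive.add_whiskerRight]

theorem encircle_add (K : V) (f g : K ⟶ K) (X : V) :
    encircle K (f + g) X = encircle K f X + encircle K g X := by
  simp [encircle_eq_ptr, MonoidalPreadditive.whiskerLeft_add, ptr_add]

/-- `encircle` as a homomorphism in the endomorphism of the closed strand. -/
def encircleHom (K X : V) : (K ⟶ K) →+ (X ⟶ X) :=
  AddMonoidHom.mk' (fun f => encircle K f X) (fun f g => encircle_add K f g X)

theorem encircle_sum {ι : Type*} (s : Finset ι) (K : V) (f : ι → (K ⟶ K)) (X : V) :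
    encircle K (∑ i ∈ s, f i) X = ∑ i ∈ s, encircle K (f i) X :=
  map_sum (encircleHom K X) f s

end Encircle

/-! ### Fusion multiplicities and nonvanishing of the global dimension -/

section Fusion

attribute [local instance] Abelian.hasFiniteBiproducts

open RibbonFusionCategory

variable {C : Type u} [Category.{v} C] [Abelian C] [Linear ℂ C]
    [MonoidalCategory C] [MonoidalPreadditive C] [MonoidalLinear ℂ C] [BraidedCategory C]
    [RightRigidCategory C] [RibbonCategory C] [RibbonFusionCategory C]

theorem smul_id_injective (X : C) [Simple X] {a b : ℂ} (h : a • 𝟙 X = b • 𝟙 X) : a = b := by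
  by_contra hne
  have h0 : (a - b) • 𝟙 X = 0 := by rw [sub_smul, h, sub_self]
  rcases smul_eq_zero.1 h0 with h1 | h1
  · exact hne (sub_eq_zero.1 h1)
  · exact id_nonzero X h1

theorem hom_simple_eq_zero {i j : I C} (h : i ≠ j) (f : (U i : C) ⟶ U j) : f = 0 := by
  by_contra hf
  have := isIso_of_hom_simple hf
  exact h (eq_of_iso i j ⟨asIso f⟩)

theorem exists_smul_id (i : I C) (f : (U i : C) ⟶ U i) : ∃ c : ℂ, c • 𝟙 (U i : C) = f :=
  endomorphism_simple_eq_smul_id ℂ f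

theorem sum_toSimple_fromSimple (X : C) :
    ∑ i : I C, ∑ a : BasisIndex X i, toSimple X i a ≫ fromSimple X i a = 𝟙 X := by
  have h : ∀ i : I C, ∀ a : BasisIndex X i, toSimple X i a ≫ fromSimple X i a =
      (decompIso X).hom ≫ (biproduct.π (fun a => U (decompIndex X a)) a.1 ≫
        biproduct.ι (fun a => U (decompIndex X a)) a.1) ≫ (decompIso X).inv := by
    rintro i ⟨a, rfl⟩
    simp [toSimple, fromSimple]
  simp only [h]
  have h2 : ∀ F : Fin (decompLength X) → (X ⟶ X),
      ∑ i : I C, ∑ a : BasisIndex X i, F a.1 = ∑ a, F a := by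
    intro F
    rw [← Finset.sum_fiberwise (s := Finset.univ) (g := decompIndex X) (f := F)]
    refine Finset.sum_congr rfl fun i _ => ?_
    exact (Finset.sum_subtype (p := fun a => decompIndex X a = i)
      (Finset.univ.filter fun a => decompIndex X a = i) (by simp) F).symm
  rw [h2 (fun a => (decompIso X).hom ≫ (biproduct.π (fun a => U (decompIndex X a)) a ≫
        biproduct.ι (fun a => U (decompIndex X a)) a) ≫ (decompIso X).inv)]
  rw [← Preadditive.comp_sum, ← Preadditive.sum_comp, biproduct.total]
  simp


/-- The multiplicity of `U i` in `X`. -/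
noncomputable def mult (X : C) (i : I C) : ℕ := Fintype.card (BasisIndex X i)

open scoped Classical in
theorem fromSimple_toSimple (X : C) (i : I C) (a b : BasisIndex X i) :
    fromSimple X i a ≫ toSimple X i b = if a = b then 𝟙 _ else 0 := by
  split_ifs with h
  · subst h; exact fromSimple_toSimple_self X i a
  · exact fromSimple_toSimple_ne X i h

theorem finrank_hom_simple (X : C) (i : I C) : Module.finrank ℂ (X ⟶ U i) = mult X i := by
  classical
  let φ : (BasisIndex X i → ℂ) →ₗ[ℂ] (X ⟶ U i) :=
    Fintype.linearCombination ℂ (toSimple X i)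
  have hφ : ∀ c, φ c = ∑ a, c a • toSimple X i a := fun c => rfl
  have hb : Function.Bijective φ := by
    constructor
    · rw [injective_iff_map_eq_zero]
      intro c hc
      funext b
      have h1 : fromSimple X i b ≫ φ c = c b • 𝟙 (U i : C) := by
        rw [hφ, Preadditive.comp_sum]
        simp only [Linear.comp_smul, fromSimple_toSimple]
        simp
      rw [hc, comp_zero] at h1
      exact smul_id_injective (U i) (by rw [← h1]; simp)
    · intro f
      choose c hc using fun a : BasisIndex X i => exists_smul_id i (fromSimple X i a ≫ f)
      refine ⟨c, ?_⟩
      rw [hφ]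
      conv_rhs => rw [← Category.id_comp f, ← sum_toSimple_fromSimple X, Preadditive.sum_comp]
      rw [Finset.sum_eq_single i]
      · rw [Preadditive.sum_comp]
        refine Finset.sum_congr rfl fun a _ => ?_
        rw [Category.assoc, ← hc a]; simp
      · intro j _ hj
        rw [Preadditive.sum_comp]
        refine Finset.sum_eq_zero fun a _ => ?_
        rw [Category.assoc, hom_simple_eq_zero hj (fromSimple X j a ≫ f), comp_zero]
      · simp
  rw [← (LinearEquiv.ofBijective φ hb).finrank_eq, Module.finrank_fintype_fun_eq_card]
  rfl

theorem finrank_simple_hom (X : C) (i : I C) : Module.finrank ℂ ((U i : C) ⟶ X) = mult X i := by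
  classical
  let φ : (BasisIndex X i → ℂ) →ₗ[ℂ] ((U i : C) ⟶ X) :=
    Fintype.linearCombination ℂ (fromSimple X i)
  have hφ : ∀ c, φ c = ∑ a, c a • fromSimple X i a := fun c => rfl
  have hb : Function.Bijective φ := by
    constructor
    · rw [injective_iff_map_eq_zero]
      intro c hc
      funext b
      have h1 : φ c ≫ toSimple X i b = c b • 𝟙 (U i : C) := by
        rw [hφ, Preadditive.sum_comp]
        simp only [Linear.smul_comp, fromSimple_toSimple]
        simp
      rw [hc, zero_comp] at h1
      exact smul_id_injective (U i) (by rw [← h1]; simp)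
    · intro f
      choose c hc using fun a : BasisIndex X i => exists_smul_id i (f ≫ toSimple X i a)
      refine ⟨c, ?_⟩
      rw [hφ]
      conv_rhs => rw [← Category.comp_id f, ← sum_toSimple_fromSimple X, Preadditive.comp_sum]
      rw [Finset.sum_eq_single i]
      · rw [Preadditive.comp_sum]
        refine Finset.sum_congr rfl fun a _ => ?_
        rw [← Category.assoc, ← hc a]; simp
      · intro j _ hj
        rw [Preadditive.comp_sum]
        refine Finset.sum_eq_zero fun a _ => ?_
        rw [← Category.assoc, hom_simple_eq_zero hj.symm (f ≫ toSimple X j a), zero_comp]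
      · simp
  rw [← (LinearEquiv.ofBijective φ hb).finrank_eq, Module.finrank_fintype_fun_eq_card]
  rfl

/-- Duality identifies `Hom(U_m ⊗ U_k, U_n)` with `Hom(U_m, U_n ⊗ U_kᘁ)`. -/
theorem mult_tensor (m k n : I C) :
    mult (U m ⊗ U k : C) n = mult (U n ⊗ ((U k)ᘁ : C)) m := by
  rw [← finrank_hom_simple, ← finrank_simple_hom]
  refine LinearEquiv.finrank_eq
    { tensorRightHomEquiv (U m : C) (U k) ((U k)ᘁ : C) (U n) with
      map_add' := fun f g => ?_
      map_smul' := fun r f => ?_ }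
  · simp [tensorRightHomEquiv, MonoidalPreadditive.add_whiskerRight]
  · simp [tensorRightHomEquiv]

/-- Resolve the identity of `K` into simple summands and move the projection around the loop, where
it meets its inclusion. -/
theorem encircle_eq_sum (K X : C) :
    encircle K (𝟙 K) X = ∑ m : I C, mult K m • encircle (U m) (𝟙 _) X := by
  conv_lhs => rw [← sum_toSimple_fromSimple K, encircle_sum]
  refine Finset.sum_congr rfl fun m _ => ?_
  rw [encircle_sum]
  simp only [encircle_cyclic (toSimple K m _), fromSimple_toSimple_self]
  simp [mult]

/-- The scalar by which a closed strand `K` encircling `U l` acts. -/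
noncomputable def encScalar (K : C) (l : I C) : ℂ :=
  (exists_smul_id l (encircle K (𝟙 K) (U l))).choose

theorem encScalar_smul (K : C) (l : I C) :
    encScalar K l • 𝟙 (U l : C) = encircle K (𝟙 K) (U l) :=
  (exists_smul_id l (encircle K (𝟙 K) (U l))).choose_spec

theorem qdim_smul (K : C) : qdim K • 𝟙 (𝟙_ C) = tr K (Kᘁ : C) (𝟙 K) := by
  rw [qdim, scalar_smul_id, tr]; simp; rfl

theorem encScalar_eq_sum (K : C) (l : I C) :
    encScalar K l = ∑ m : I C, mult K m * encScalar (U m) l := by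
  refine smul_id_injective (U l) ?_
  rw [encScalar_smul, encircle_eq_sum, Finset.sum_smul]
  refine Finset.sum_congr rfl fun m _ => ?_
  rw [← encScalar_smul, mul_smul, Nat.cast_smul_eq_nsmul]

theorem qdim_eq_sum (K : C) : qdim K = ∑ m : I C, mult K m * qdim (U m : C) := by
  refine smul_id_injective (𝟙_ C) ?_
  rw [qdim_smul, ← encircle_unit, encircle_eq_sum, Finset.sum_smul]
  refine Finset.sum_congr rfl fun m _ => ?_
  rw [encircle_unit, ← qdim_smul, mul_smul, Nat.cast_smul_eq_nsmul]

/-- Together with `encScalar_eq_sum` this makes `K ↦ encScalar K l` a character of the fusion ring,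
just as the dimension is one. -/
theorem encScalar_tensor (K L : C) (l : I C) :
    encScalar (K ⊗ L) l = encScalar L l * encScalar K l := by
  refine smul_id_injective (U l) ?_
  rw [encScalar_smul, encircle_tensor, ← encScalar_smul, ← encScalar_smul]
  simp [smul_smul, mul_comm]

theorem qdim_tensor (K L : C) : qdim (K ⊗ L) = qdim L * qdim K := by
  refine smul_id_injective (𝟙_ C) ?_
  rw [qdim_smul, ← encircle_unit, encircle_tensor, encircle_unit, encircle_unit, ← qdim_smul,
    ← qdim_smul]
  simp [smul_smul, mul_comm]

theorem qdim_dual (K : C) : qdim (Kᘁ : C) = qdim K := by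
  refine smul_id_injective (𝟙_ C) ?_
  rw [qdim_smul, qdim_smul, tr_id_dual K]

/-- By `mult_tensor` the left side computes the dimension of `U_n ⊗ U_kᘁ`, and dual objects have
equal dimension. -/
theorem sum_qdim_mult (k n : I C) :
    ∑ m : I C, qdim (U m : C) * mult (U m ⊗ U k : C) n = qdim (U n : C) * qdim (U k : C) := by
  simp only [mult_tensor]
  have h := qdim_eq_sum (U n ⊗ ((U k)ᘁ : C))
  rw [qdim_tensor, qdim_dual] at h
  rw [mul_comm (qdim (U n : C)), h]
  exact Finset.sum_congr rfl fun m _ => mul_comm _ _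

theorem qdim_iso {K L : C} (e : K ≅ L) : qdim K = qdim L := by
  refine smul_id_injective (𝟙_ C) ?_
  rw [qdim_smul, qdim_smul, ← e.hom_inv_id, tr_cyclic (Kᘁ : C) (Lᘁ : C), e.inv_hom_id]

theorem qdim_unit : qdim (𝟙_ C) = 1 := by
  refine smul_id_injective (𝟙_ C) ?_
  rw [qdim_smul, tr_eq_ptr, ptr_pairing _ (𝟙_ C) _ (exactPairingUnit : ExactPairing (𝟙_ C) (𝟙_ C)),
    ← tr_eq_ptr, tr_unit, one_smul]

/-- A loop coloured by `∑ d_m U_m` absorbs any further loop `U_k` up to the factor `d_k`: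
multiplicativity expands the product in the fusion ring, and `sum_qdim_mult` resums it. -/
theorem sum_qdim_encScalar_mul (k l : I C) :
    (∑ m : I C, qdim (U m : C) * encScalar (U m : C) l) * encScalar (U k : C) l =
      (∑ m : I C, qdim (U m : C) * encScalar (U m : C) l) * qdim (U k : C) := by
  have h : ∀ m : I C, encScalar (U m : C) l * encScalar (U k : C) l =
      ∑ n : I C, mult (U m ⊗ U k : C) n * encScalar (U n : C) l := fun m => by
    rw [← encScalar_eq_sum, encScalar_tensor, mul_comm]
  simp only [Finset.sum_mul, mul_assoc, h, Finset.mul_sum]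
  rw [Finset.sum_comm]
  refine Finset.sum_congr rfl fun n _ => ?_
  simp only [← mul_assoc]
  rw [← Finset.sum_mul, sum_qdim_mult]
  ring

theorem sMatrix_apply (l m : I C) :
    sMatrix C l m = encScalar (U m : C) l * qdim (U l : C) := by
  refine smul_id_injective (𝟙_ C) ?_
  rw [sMatrix, scalar_smul_id, ← encScalar_smul, mul_smul, qdim_smul, tr]
  simp
  rfl

/-- Nondegeneracy of the `s`-matrix forces the global dimension to be nonzero. -/
theorem globalDim_ne_zero (h : IsUnit (sMatrix C)) : globalDim C ≠ 0 := by
  intro h0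
  -- If the sum were nonzero it could be cancelled in `sum_qdim_encScalar_mul`, so that `encScalar
  -- (U k) l = d_k` for all `k`; but then the sum is `Dim C = 0`. Thus `s` annihilates the vector of
  -- dimensions.
  have hx : ∀ l : I C, ∑ m : I C, qdim (U m : C) * encScalar (U m : C) l = 0 := by
    intro l
    by_contra hl
    have hk : ∀ k : I C, encScalar (U k : C) l = qdim (U k : C) := fun k =>
      mul_left_cancel₀ hl (sum_qdim_encScalar_mul k l)
    apply hl
    simp only [hk, ← pow_two]
    exact h0
  have hv : (sMatrix C).mulVec (fun m => qdim (U m : C)) = 0 := by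
    funext l
    simp only [Matrix.mulVec, dotProduct, sMatrix_apply, Pi.zero_apply]
    have := congrArg (· * qdim (U l : C)) (hx l)
    simp only [Finset.sum_mul, zero_mul] at this
    rw [← this]
    exact Finset.sum_congr rfl fun m _ => by ring
  have hd : (fun m : I C => qdim (U m : C)) = 0 :=
    Matrix.mulVec_injective_of_isUnit h (by rw [hv, Matrix.mulVec_zero])
  -- The entry of the dimension vector at the unit object is `1`, so the vector is not zero.
  obtain ⟨i, ⟨e⟩⟩ := exists_iso (𝟙_ C) inferInstance
  have h1 := congrFun hd i
  simp only [Pi.zero_apply] at h1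
  rw [← qdim_iso e, qdim_unit] at h1
  exact one_ne_zero h1

end Fusion

/-! ### Linear algebra in a semisimple category -/

section Semisimple

variable {E : Type u} [Category.{v} E] [Preadditive E]

/-- `X` is a direct summand of a finite direct sum of members of the family `S`. -/
def IsGeneratedBy {J : Type} (S : J → E) (X : E) : Prop :=
  ∃ (ι : Type) (_ : Fintype ι) (f : ι → J) (x : ∀ a, X ⟶ S (f a)) (y : ∀ a, S (f a) ⟶ X),
    ∑ a, x a ≫ y a = 𝟙 X

theorem IsGeneratedBy.of_sum {J : Type} {S : J → E} {X : E} {ι : Type} [Fintype ι] {Y : ι → E}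
    (hY : ∀ a, IsGeneratedBy S (Y a)) (x : ∀ a, X ⟶ Y a) (y : ∀ a, Y a ⟶ X)
    (h : ∑ a, x a ≫ y a = 𝟙 X) : IsGeneratedBy S X := by
  choose κ hκ f x' y' h' using hY
  refine ⟨Σ a, κ a, inferInstance, fun p => f p.1 p.2, fun p => x p.1 ≫ x' p.1 p.2,
    fun p => y' p.1 p.2 ≫ y p.1, ?_⟩
  rw [Fintype.sum_sigma, ← h]
  refine Finset.sum_congr rfl fun a _ => ?_
  conv_rhs => rw [← Category.id_comp (y a), ← h' a, Preadditive.sum_comp, Preadditive.comp_sum]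
  simp

variable [Linear ℂ E]

/-- The members of the family `S` are pairwise disjoint and have only scalar endomorphisms. -/
structure IsSchurFamily {J : Type} (S : J → E) : Prop where
  eq_zero : ∀ p q, p ≠ q → ∀ f : S p ⟶ S q, f = 0
  eq_smul : ∀ p, ∀ f : S p ⟶ S p, ∃ c : ℂ, c • 𝟙 (S p) = f

variable {J : Type} {S : J → E}

theorem IsGeneratedBy.hom_ext {X Y : E} (hX : IsGeneratedBy S X) {g g' : X ⟶ Y}
    (h : ∀ p (t : S p ⟶ X), t ≫ g = t ≫ g') : g = g' := by
  obtain ⟨ι, _, f, x, y, hxy⟩ := hX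
  rw [← Category.id_comp g, ← Category.id_comp g', ← hxy, Preadditive.sum_comp,
    Preadditive.sum_comp]
  exact Finset.sum_congr rfl fun a _ => by rw [Category.assoc, h, Category.assoc]

/-- A family of linear maps `Hom(S p, Y) → Hom(S p, X)` is induced by a morphism `Y ⟶ X`. -/
theorem IsSchurFamily.exists_hom (hS : IsSchurFamily S) {X Y : E} (hY : IsGeneratedBy S Y)
    (φ : ∀ p, (S p ⟶ Y) →ₗ[ℂ] (S p ⟶ X)) : ∃ g : Y ⟶ X, ∀ p (h : S p ⟶ Y), h ≫ g = φ p h := by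
  obtain ⟨ι, _, f, x, y, hxy⟩ := hY
  -- Naturality in the simple object is automatic, since the only morphisms between members of `S`
  -- are zero and scalars.
  have key : ∀ p q (t : S p ⟶ S q) (z : S q ⟶ Y), t ≫ φ q z = φ p (t ≫ z) := by
    intro p q t z
    by_cases hpq : p = q
    · subst hpq
      obtain ⟨c, rfl⟩ := hS.eq_smul p t
      simp
    · rw [hS.eq_zero p q hpq t]; simp
  refine ⟨∑ a, x a ≫ φ (f a) (y a), fun p h => ?_⟩
  conv_rhs => rw [← Category.comp_id h, ← hxy, Preadditive.comp_sum, map_sum]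
  rw [Preadditive.comp_sum]
  exact Finset.sum_congr rfl fun a _ => by
    rw [← Category.assoc, key, Category.assoc]

/-- Every morphism of a semisimple category is von Neumann regular. -/
theorem IsSchurFamily.exists_regular (hS : IsSchurFamily S) {X Y : E} (hX : IsGeneratedBy S X)
    (hY : IsGeneratedBy S Y) (f : X ⟶ Y) : ∃ g : Y ⟶ X, f ≫ g ≫ f = f := by
  let F : ∀ p, (S p ⟶ X) →ₗ[ℂ] (S p ⟶ Y) := fun p => Linear.rightComp ℂ (S p) f
  -- A linear section over the range, extended arbitrarily to the whole space, is a generalised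
  -- inverse of `F p`.
  have hG : ∀ p, ∃ G : (S p ⟶ Y) →ₗ[ℂ] (S p ⟶ X), ∀ h, F p (G (F p h)) = F p h := by
    intro p
    obtain ⟨s, hs⟩ := (F p).rangeRestrict.exists_rightInverse_of_surjective
      (F p).range_rangeRestrict
    obtain ⟨G, hG⟩ := LinearMap.exists_extend s
    refine ⟨G, fun h => ?_⟩
    have h1 : G (F p h) = s ((F p).rangeRestrict h) := by
      rw [← hG]; rfl
    have h2 := congrArg Subtype.val (LinearMap.congr_fun hs ((F p).rangeRestrict h))
    rw [h1]
    exact h2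
  choose G hG using hG
  obtain ⟨g, hg⟩ := hS.exists_hom hY G
  refine ⟨g, hX.hom_ext fun p t => ?_⟩
  have := hG p t
  simp only [F, Linear.rightComp_apply] at this
  rw [← Category.assoc, ← Category.assoc, hg, this]

/-- Kernels in a semisimple category exist and are split. -/
theorem IsSchurFamily.exists_kernel [Fintype J] [HasFiniteBiproducts E] (hS : IsSchurFamily S)
    (hE : ∀ X : E, IsGeneratedBy S X) [∀ X Y : E, FiniteDimensional ℂ (X ⟶ Y)] {X Y : E}
    (f : X ⟶ Y) : ∃ (K : E) (k : K ⟶ X) (r : X ⟶ K), k ≫ r = 𝟙 K ∧ k ≫ f = 0 ∧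
      ∀ (Z : E) (g : Z ⟶ X), g ≫ f = 0 → g ≫ r ≫ k = g := by
  classical
  let F : ∀ p, (S p ⟶ X) →ₗ[ℂ] (S p ⟶ Y) := fun p => Linear.rightComp ℂ (S p) f
  let b : ∀ p, Module.Basis (Fin (Module.finrank ℂ (LinearMap.ker (F p)))) ℂ
    (LinearMap.ker (F p)) := fun p => Module.finBasis ℂ _
  -- The kernel object contains `S p` as often as the dimension of `ker (F p)`. A basis of `ker (F
  -- p)` gives its inclusion, and linear retractions onto these kernels assemble to its retraction.
  have hρ : ∀ p, ∃ ρ : (S p ⟶ X) →ₗ[ℂ] LinearMap.ker (F p),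
      ρ ∘ₗ (LinearMap.ker (F p)).subtype = LinearMap.id := fun p =>
    LinearMap.exists_leftInverse_of_injective _ (Submodule.ker_subtype _)
  choose ρ hρ using hρ
  have hρ' : ∀ p (h : LinearMap.ker (F p)), ρ p h.1 = h := fun p h =>
    LinearMap.congr_fun (hρ p) h
  let T : (Σ p : J, Fin (Module.finrank ℂ (LinearMap.ker (F p)))) → E := fun q => S q.1
  let φ : ∀ p, (S p ⟶ X) →ₗ[ℂ] (S p ⟶ ⨁ T) := fun p =>
    (Fintype.linearCombination ℂ (fun i => (biproduct.ι T ⟨p, i⟩ : S p ⟶ ⨁ T))) ∘ₗ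
      ((b p).equivFun : _ →ₗ[ℂ] _) ∘ₗ ρ p
  have hφ : ∀ p h, φ p h = ∑ i, (b p).equivFun (ρ p h) i • (biproduct.ι T ⟨p, i⟩ : S p ⟶ ⨁ T) :=
    fun p h => rfl
  obtain ⟨r, hr⟩ := hS.exists_hom (hE X) φ
  let k : ⨁ T ⟶ X := biproduct.desc fun q => (b q.1 q.2).1
  have hk : ∀ q, biproduct.ι T q ≫ k = (b q.1 q.2).1 := fun q => biproduct.ι_desc _ _
  have hker : ∀ p (h : LinearMap.ker (F p)), h.1 ≫ f = 0 := fun p h => h.2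
  refine ⟨⨁ T, k, r, ?_, ?_, ?_⟩
  · refine biproduct.hom_ext' _ _ fun q => ?_
    obtain ⟨p, i⟩ := q
    rw [← Category.assoc, hk]
    refine (hr p _).trans ?_
    rw [hφ, hρ', Category.comp_id, Finset.sum_eq_single i]
    · rw [Module.Basis.equivFun_self, if_pos rfl, one_smul]
    · intro j _ hj
      rw [Module.Basis.equivFun_self, if_neg (Ne.symm hj), zero_smul]
    · simp
  · refine biproduct.hom_ext' _ _ fun q => ?_
    rw [← Category.assoc, hk, hker, comp_zero]
  · intro Z g hg
    refine (hE Z).hom_ext fun p t => ?_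
    have hmem : t ≫ g ∈ LinearMap.ker (F p) := by
      change (t ≫ g) ≫ f = 0
      rw [Category.assoc, hg, comp_zero]
    rw [← Category.assoc, ← Category.assoc, hr, hφ, Preadditive.sum_comp]
    have h1 := hρ' p ⟨t ≫ g, hmem⟩
    dsimp only at h1
    rw [h1]
    have h2 := congrArg Subtype.val ((b p).sum_equivFun ⟨t ≫ g, hmem⟩)
    rw [AddSubmonoidClass.coe_finsetSum] at h2
    refine Eq.trans ?_ h2
    refine Finset.sum_congr rfl fun i _ => ?_
    rw [Linear.smul_comp]
    exact congrArg _ (hk ⟨p, i⟩)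

end Semisimple

/-! ### Invariants of a simple commutative algebra -/

section Simple

variable {E : Type u} [Category.{v} E] [MonoidalCategory E] [Preadditive E]
  [MonoidalPreadditive E] [Linear ℂ E] [MonoidalLinear ℂ E] [BraidedCategory E]

/-- Multiplication from the right by `z : 𝟙 ⟶ B`. -/
def mulRight (B : FrobeniusAlgebra E) (z : 𝟙_ E ⟶ B.X) : B.X ⟶ B.X :=
  (ρ_ B.X).inv ≫ B.X ◁ z ≫ B.mul

theorem one_mulRight (B : FrobeniusAlgebra E) (z : 𝟙_ E ⟶ B.X) :
    B.one ≫ mulRight B z = z := by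
  unfold mulRight
  calc _ = 𝟙 _ ⊗≫ (B.one ▷ 𝟙_ E ≫ B.X ◁ z) ⊗≫ B.mul := by monoidal
    _ = 𝟙 _ ⊗≫ z ⊗≫ (B.one ▷ B.X ≫ B.mul) := by rw [← whisker_exchange]; monoidal
    _ = z := by rw [B.one_mul]; monoidal

theorem mulRight_left (B : FrobeniusAlgebra E) (z : 𝟙_ E ⟶ B.X) :
    B.mul ≫ mulRight B z = B.X ◁ mulRight B z ≫ B.mul := by
  unfold mulRight
  calc _ = 𝟙 _ ⊗≫ (B.mul ▷ 𝟙_ E ≫ B.X ◁ z) ⊗≫ B.mul := by monoidal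
    _ = 𝟙 _ ⊗≫ (B.X ⊗ B.X) ◁ z ⊗≫ (B.mul ▷ B.X ≫ B.mul) := by rw [← whisker_exchange]; monoidal
    _ = _ := by rw [B.mul_assoc]; monoidal

/-- Multiplying by an invariant on the right is the same as multiplying by it on the left. With
`mulRight_left` it is therefore a bimodule endomorphism, and its kernel is an ideal. -/
theorem mulRight_right (B : FrobeniusAlgebra E) (hB : B.IsCommutative) (z : 𝟙_ E ⟶ B.X) :
    B.mul ≫ mulRight B z = mulRight B z ▷ B.X ≫ B.mul := by
  have hB' : (β_ B.X B.X).hom ≫ B.mul = B.mul := hB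
  have h : B.X ◁ z ≫ B.mul = (ρ_ B.X).hom ≫ (λ_ B.X).inv ≫ z ▷ B.X ≫ B.mul := by
    conv_lhs => rw [← hB', BraidedCategory.braiding_naturality_right_assoc,
      braiding_tensorUnit_right]
    simp
  rw [mulRight_left]
  unfold mulRight
  rw [h]
  calc _ = 𝟙 _ ⊗≫ (B.X ◁ z) ▷ B.X ⊗≫ ((α_ B.X B.X B.X).hom ≫ B.X ◁ B.mul ≫ B.mul) := by monoidal
    _ = 𝟙 _ ⊗≫ (B.X ◁ z ≫ B.mul) ▷ B.X ⊗≫ B.mul := by rw [← B.mul_assoc]; monoidal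
    _ = _ := by rw [h]; monoidal

theorem mulRight_sub_smul (B : FrobeniusAlgebra E) (z : 𝟙_ E ⟶ B.X) (c : ℂ) :
    mulRight B (z - c • B.one) = mulRight B z - c • 𝟙 B.X := by
  have h : B.X ◁ (z - c • B.one) = B.X ◁ z - c • B.X ◁ B.one := by
    rw [sub_eq_add_neg, MonoidalPreadditive.whiskerLeft_add, sub_eq_add_neg, ← neg_smul,
      ← neg_smul, MonoidalLinear.whiskerLeft_smul]
  unfold mulRight
  rw [h, Preadditive.sub_comp, Preadditive.comp_sub, Linear.smul_comp, Linear.comp_smul,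
    B.mul_one, Iso.inv_hom_id]

/-- The bimodule structure on the kernel of a bimodule endomorphism. -/
def kernelBimod (B : FrobeniusAlgebra E) {K : E} (k : K ⟶ B.X) (r : B.X ⟶ K)
    (hkr : k ≫ r = 𝟙 K) (hl : B.X ◁ k ≫ B.mul ≫ r ≫ k = B.X ◁ k ≫ B.mul)
    (hr : k ▷ B.X ≫ B.mul ≫ r ≫ k = k ▷ B.X ≫ B.mul) : Bimod B.toMon B.toMon where
  X := K
  actLeft := B.X ◁ k ≫ B.mul ≫ r
  actRight := k ▷ B.X ≫ B.mul ≫ r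
  one_actLeft := by
    change B.one ▷ K ≫ B.X ◁ k ≫ B.mul ≫ r = _
    rw [← whisker_exchange_assoc, ← Category.assoc (B.one ▷ B.X), B.one_mul]
    simp [hkr]
  left_assoc := by
    change B.mul ▷ K ≫ B.X ◁ k ≫ B.mul ≫ r = (α_ B.X B.X K).hom ≫
      B.X ◁ (B.X ◁ k ≫ B.mul ≫ r) ≫ B.X ◁ k ≫ B.mul ≫ r
    rw [← whisker_exchange_assoc, ← Category.assoc (B.mul ▷ B.X), B.mul_assoc,
      ← MonoidalCategory.whiskerLeft_comp_assoc]
    simp only [Category.assoc]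
    rw [hl]
    simp
  actRight_one := by
    change K ◁ B.one ≫ k ▷ B.X ≫ B.mul ≫ r = _
    rw [whisker_exchange_assoc, ← Category.assoc (B.X ◁ B.one), B.mul_one]
    simp [hkr]
  right_assoc := by
    change K ◁ B.mul ≫ k ▷ B.X ≫ B.mul ≫ r = (α_ K B.X B.X).inv ≫
      (k ▷ B.X ≫ B.mul ≫ r) ▷ B.X ≫ k ▷ B.X ≫ B.mul ≫ r
    rw [whisker_exchange_assoc, ← comp_whiskerRight_assoc]
    simp only [Category.assoc]
    rw [hr, comp_whiskerRight_assoc, ← Category.assoc (B.mul ▷ B.X), B.mul_assoc]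
    simp
  middle_assoc := by
    change (B.X ◁ k ≫ B.mul ≫ r) ▷ B.X ≫ k ▷ B.X ≫ B.mul ≫ r =
      (α_ B.X K B.X).hom ≫ B.X ◁ (k ▷ B.X ≫ B.mul ≫ r) ≫ B.X ◁ k ≫ B.mul ≫ r
    rw [← comp_whiskerRight_assoc, ← MonoidalCategory.whiskerLeft_comp_assoc]
    simp only [Category.assoc]
    rw [hl, hr, comp_whiskerRight_assoc, ← Category.assoc (B.mul ▷ B.X), B.mul_assoc]
    simp

/-- In a semisimple category, the only elements `𝟙 ⟶ B` of a simple commutative algebra `B` are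
the multiples of the unit. -/
theorem unit_hom_eq_smul_one {J : Type} [Fintype J] {S : J → E} [HasFiniteBiproducts E]
    (hS : IsSchurFamily S) (hE : ∀ X : E, IsGeneratedBy S X)
    [∀ X Y : E, FiniteDimensional ℂ (X ⟶ Y)] (B : FrobeniusAlgebra E) (hB : B.IsCommutative)
    (hs : B.IsSimple) (z : 𝟙_ E ⟶ B.X) : ∃ c : ℂ, z = c • B.one := by
  have hs' : Simple (Bimod.regular B.toMon) := hs
  have hid : 𝟙 B.X ≠ 0 := fun h => id_nonzero (Bimod.regular B.toMon) (Bimod.hom_ext _ _ h)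
  have : Nontrivial (End B.X) := ⟨⟨𝟙 B.X, 0, hid⟩⟩
  have : FiniteDimensional ℂ (End B.X) := inferInstanceAs (FiniteDimensional ℂ (B.X ⟶ B.X))
  -- An eigenvalue `c` makes multiplication by `w = z - c η` noninvertible; the aim is `w = 0`.
  obtain ⟨c, hc⟩ := spectrum.nonempty_of_isAlgClosed_of_finiteDimensional ℂ
    (A := End B.X) (mulRight B z)
  refine ⟨c, sub_eq_zero.1 ?_⟩
  set w := z - c • B.one with hw
  have hf : ¬ IsIso (mulRight B w) := by
    intro hiso
    apply hc
    rw [← isUnit_iff_isIso, hw, mulRight_sub_smul] at hiso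
    change IsUnit (algebraMap ℂ (End B.X) c - End.of (mulRight B z))
    rw [← neg_sub]
    refine IsUnit.neg ?_
    rw [Algebra.algebraMap_eq_smul_one]
    exact hiso
  obtain ⟨K, k, r, hkr, hkf, hK⟩ := hS.exists_kernel hE (mulRight B w)
  have hl : B.X ◁ k ≫ B.mul ≫ r ≫ k = B.X ◁ k ≫ B.mul := by
    have := hK _ (B.X ◁ k ≫ B.mul) (by
      rw [Category.assoc, mulRight_left, ← MonoidalCategory.whiskerLeft_comp_assoc, hkf]
      simp)
    simpa using this
  have hr : k ▷ B.X ≫ B.mul ≫ r ≫ k = k ▷ B.X ≫ B.mul := by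
    have := hK _ (k ▷ B.X ≫ B.mul) (by
      rw [Category.assoc, mulRight_right B hB, ← comp_whiskerRight_assoc, hkf]
      simp)
    simpa using this
  let κ : kernelBimod B k r hkr hl hr ⟶ Bimod.regular B.toMon :=
    { hom := k
      left_act_hom := by
        change (B.X ◁ k ≫ B.mul ≫ r) ≫ k = B.X ◁ k ≫ B.mul
        simpa using hl
      right_act_hom := by
        change (k ▷ B.X ≫ B.mul ≫ r) ≫ k = k ▷ B.X ≫ B.mul
        simpa using hr }
  have hmono : Mono κ := by
    refine ⟨fun g h e => Bimod.hom_ext _ _ ?_⟩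
    have e' : g.hom ≫ k = h.hom ≫ k := congrArg Bimod.Hom.hom e
    have hr' : ∀ {Z : E} (t : Z ⟶ K), (t ≫ k) ≫ r = t := fun t => by
      rw [Category.assoc, hkr, Category.comp_id]
    exact (hr' g.hom).symm.trans ((congrArg (· ≫ r) e').trans (hr' h.hom))
  -- A zero kernel makes composition with `mulRight B w` injective on the finite-dimensional space
  -- `End B.X`, hence surjective, so `mulRight B w` would be invertible. A nonzero kernel is
  -- everything by simplicity, so multiplication by `w` vanishes, and applying it to the unit gives
  -- `w = 0`.
  by_cases hκ : κ = 0
  · exfalso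
    have hk0 : k = 0 := congrArg Bimod.Hom.hom hκ
    have hinj : ∀ a : B.X ⟶ B.X, a ≫ mulRight B w = 0 → a = 0 := fun a ha => by
      rw [← hK _ a ha, hk0, comp_zero, comp_zero]
    let L : (B.X ⟶ B.X) →ₗ[ℂ] (B.X ⟶ B.X) := Linear.rightComp ℂ B.X (mulRight B w)
    have hL : Function.Injective L := (injective_iff_map_eq_zero L).2 hinj
    obtain ⟨a, ha⟩ := LinearMap.injective_iff_surjective.1 hL (𝟙 B.X)
    have ha' : a ≫ mulRight B w = 𝟙 B.X := ha
    refine hf ⟨a, ?_, ha'⟩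
    refine hL ?_
    change (mulRight B w ≫ a) ≫ mulRight B w = 𝟙 B.X ≫ mulRight B w
    rw [Category.assoc, ha', Category.comp_id, Category.id_comp]
  · have : IsIso κ := (Simple.mono_isIso_iff_nonzero κ).2 hκ
    obtain ⟨j, h1⟩ : ∃ j : B.X ⟶ K, j ≫ k = 𝟙 B.X :=
      ⟨(inv κ).hom, congrArg Bimod.Hom.hom (IsIso.inv_hom_id κ)⟩
    have h2 : mulRight B w = 0 := by
      rw [← Category.id_comp (mulRight B w), ← h1, Category.assoc, hkf, comp_zero]
    rw [← one_mulRight B w, h2, comp_zero]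

end Simple
end Ribbon

/-! ### Linear structure on matrices of morphisms -/

namespace CategoryTheory.Mat_

section Linear

variable {E : Type u} [Category.{v} E] [Preadditive E] [Linear ℂ E]

noncomputable instance (M N : Mat_ E) : Module ℂ (M ⟶ N) where
  smul c f := ofEntries fun i j => c • entry f i j
  one_smul f := ext_entry fun i j => one_smul ℂ (entry f i j)
  mul_smul a b f := ext_entry fun i j => mul_smul a b (entry f i j)
  smul_zero a := ext_entry fun _ _ => smul_zero a
  smul_add a f g := ext_entry fun i j => smul_add a (entry f i j) (entry g i j)
  add_smul a b f := ext_entry fun i j => add_smul a b (entry f i j)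
  zero_smul f := ext_entry fun i j => zero_smul ℂ (entry f i j)

theorem entry_smul {M N : Mat_ E} (c : ℂ) (f : M ⟶ N) (i : M.ι) (j : N.ι) :
    entry (c • f) i j = c • entry f i j := rfl

noncomputable instance : Linear ℂ (Mat_ E) where
  smul_comp M N K c f g := by
    refine ext_entry fun i k => ?_
    simp only [entry_smul, entry_comp, Linear.smul_comp, Finset.smul_sum]
  comp_smul M N K f c g := by
    refine ext_entry fun i k => ?_
    simp only [entry_smul, entry_comp, Linear.comp_smul, Finset.smul_sum]

/-- The entries of a matrix of morphisms, as a linear map. -/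
def entries (M N : Mat_ E) : (M ⟶ N) →ₗ[ℂ] (∀ i j, M.X i ⟶ N.X j) where
  toFun f := fun i j => entry f i j
  map_add' _ _ := rfl
  map_smul' _ _ := rfl

instance [∀ X Y : E, FiniteDimensional ℂ (X ⟶ Y)] (M N : Mat_ E) :
    FiniteDimensional ℂ (M ⟶ N) :=
  Module.Finite.of_injective (entries M N) fun _ _ h =>
    ext_entry fun i j => congrFun (congrFun h i) j

variable [MonoidalCategory E] [MonoidalPreadditive E] [MonoidalLinear ℂ E]

instance : MonoidalLinear ℂ (Mat_ E) where
  whiskerLeft_smul M N P c f := by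
    refine ext_entry fun p q => ?_
    simp only [entry_whiskerLeft, entry_smul, MonoidalCategory.tensorHom_def,
      MonoidalLinear.whiskerLeft_smul, Linear.comp_smul]
  smul_whiskerRight c N P f M := by
    refine ext_entry fun p q => ?_
    simp only [entry_whiskerRight, entry_smul, MonoidalCategory.tensorHom_def,
      MonoidalLinear.smul_whiskerRight, Linear.smul_comp]

end Linear

end CategoryTheory.Mat_

/-! ### Bilinearity of pairs of morphisms -/

namespace BoxPair

variable {C : Type u} [Category.{v} C] [Preadditive C] [Linear ℂ C]

instance [∀ X Y : C, FiniteDimensional ℂ (X ⟶ Y)] (X Y : BoxPair C) :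
    FiniteDimensional ℂ (X ⟶ Y) :=
  inferInstanceAs (FiniteDimensional ℂ (TensorProduct ℂ (X.left ⟶ Y.left) (X.right ⟶ Y.right)))

/-- `hom` as a bilinear map. -/
noncomputable def homLin (X Y : BoxPair C) :
    (X.left ⟶ Y.left) →ₗ[ℂ] (X.right ⟶ Y.right) →ₗ[ℂ] (X ⟶ Y) :=
  TensorProduct.mk ℂ (X.left ⟶ Y.left) (X.right ⟶ Y.right)

theorem homLin_apply {X Y : BoxPair C} (f : X.left ⟶ Y.left) (g : X.right ⟶ Y.right) :
    homLin X Y f g = hom f g := rfl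

theorem zero_hom {X Y : BoxPair C} (g : X.right ⟶ Y.right) :
    (hom (0 : X.left ⟶ Y.left) g : X ⟶ Y) = 0 := by
  rw [← homLin_apply, map_zero, LinearMap.zero_apply]

theorem hom_zero {X Y : BoxPair C} (f : X.left ⟶ Y.left) :
    (hom f (0 : X.right ⟶ Y.right) : X ⟶ Y) = 0 := by
  rw [← homLin_apply, map_zero]

theorem sum_hom {X Y : BoxPair C} {ι : Type*} (s : Finset ι) (f : ι → (X.left ⟶ Y.left))
    (g : X.right ⟶ Y.right) :
    (hom (∑ i ∈ s, f i) g : X ⟶ Y) = ∑ i ∈ s, hom (f i) g := by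
  simp only [← homLin_apply, map_sum, LinearMap.sum_apply]

theorem hom_sum {X Y : BoxPair C} {ι : Type*} (s : Finset ι) (f : X.left ⟶ Y.left)
    (g : ι → (X.right ⟶ Y.right)) :
    (hom f (∑ i ∈ s, g i) : X ⟶ Y) = ∑ i ∈ s, hom f (g i) := by
  simp only [← homLin_apply, map_sum]

theorem smul_hom {X Y : BoxPair C} (c : ℂ) (f : X.left ⟶ Y.left) (g : X.right ⟶ Y.right) :
    (hom (c • f) g : X ⟶ Y) = c • hom f g := by
  simp only [← homLin_apply, map_smul, LinearMap.smul_apply]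

theorem hom_smul {X Y : BoxPair C} (c : ℂ) (f : X.left ⟶ Y.left) (g : X.right ⟶ Y.right) :
    (hom f (c • g) : X ⟶ Y) = c • hom f g := by
  simp only [← homLin_apply, map_smul]

end BoxPair

namespace Ribbon

/-! ### Semisimplicity of `C₊ ⊠ C₋` -/

section BoxSquare

open RibbonFusionCategory

variable {C : Type u} [Category.{v} C] [Abelian C] [Linear ℂ C]
    [MonoidalCategory C] [MonoidalPreadditive C] [MonoidalLinear ℂ C] [BraidedCategory C]
    [RightRigidCategory C] [RibbonCategory C] [RibbonFusionCategory C]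

theorem isSchurFamily_U : IsSchurFamily (U : I C → C) where
  eq_zero _ _ h f := hom_simple_eq_zero h f
  eq_smul i f := exists_smul_id i f

theorem isGeneratedBy_U (X : C) : IsGeneratedBy (U : I C → C) X :=
  ⟨Σ i : I C, BasisIndex X i, inferInstance, fun p => p.1, fun p => toSimple X p.1 p.2,
    fun p => fromSimple X p.1 p.2, by rw [Fintype.sum_sigma]; exact sum_toSimple_fromSimple X⟩

variable (C) in
/-- The simple objects `U i × U j` of `C₊ ⊠ C₋`. -/
noncomputable def boxSimple (p : I C × I C) : BoxSquare C :=
  (Mat_.embedding (BoxPair C)).obj ⟨U p.1, U p.2⟩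

/-- Every morphism between such objects is a sum of pure tensors `f ⊗ g`, and Schur's lemma applies
to each factor. -/
theorem isSchurFamily_boxSimple : IsSchurFamily (boxSimple C) where
  eq_zero p q h f := by
    obtain ⟨f, rfl⟩ := (Mat_.embedding (BoxPair C)).map_surjective f
    suffices f = 0 by rw [this]; exact (Mat_.embedding (BoxPair C)).map_zero _ _
    induction f using BoxPair.hom_ind with
    | add a b ha hb => rw [ha, hb, add_zero]
    | hom f g =>
      by_cases h1 : p.1 = q.1
      · have h2 : p.2 ≠ q.2 := fun h2 => h (Prod.ext h1 h2)
        rw [show g = 0 from hom_simple_eq_zero h2 g, BoxPair.hom_zero]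
      · rw [show f = 0 from hom_simple_eq_zero h1 f, BoxPair.zero_hom]
  eq_smul p f := by
    obtain ⟨f, rfl⟩ := (Mat_.embedding (BoxPair C)).map_surjective f
    suffices ∃ c : ℂ, c • 𝟙 _ = f by
      obtain ⟨c, rfl⟩ := this
      refine ⟨c, ?_⟩
      refine Mat_.ext_entry fun i j => ?_
      rw [Mat_.entry_smul]
      exact congrArg (c • ·) (Mat_.entry_id_self (boxSimple C p) _)
    induction f using BoxPair.hom_ind with
    | add a b ha hb =>
      obtain ⟨c, rfl⟩ := ha
      obtain ⟨d, rfl⟩ := hb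
      exact ⟨c + d, add_smul _ _ _⟩
    | hom f g =>
      obtain ⟨c, hc⟩ := exists_smul_id p.1 f
      obtain ⟨d, hd⟩ := exists_smul_id p.2 g
      refine ⟨c * d, ?_⟩
      rw [← hc, ← hd, BoxPair.smul_hom, BoxPair.hom_smul, smul_smul]
      rfl

theorem isGeneratedBy_boxSimple (M : BoxSquare C) : IsGeneratedBy (boxSimple C) M := by
  have hpair : ∀ X : BoxPair C,
      IsGeneratedBy (boxSimple C) ((Mat_.embedding (BoxPair C)).obj X) := by
    intro X
    let s : (Σ i : I C, BasisIndex X.left i) × (Σ i : I C, BasisIndex X.right i) → I C × I C :=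
      fun q => (q.1.1, q.2.1)
    let x : ∀ q, X ⟶ (⟨U (s q).1, U (s q).2⟩ : BoxPair C) := fun q =>
      BoxPair.hom (toSimple X.left q.1.1 q.1.2) (toSimple X.right q.2.1 q.2.2)
    let y : ∀ q, (⟨U (s q).1, U (s q).2⟩ : BoxPair C) ⟶ X := fun q =>
      BoxPair.hom (fromSimple X.left q.1.1 q.1.2) (fromSimple X.right q.2.1 q.2.2)
    have hxy : ∑ q, x q ≫ y q = 𝟙 X := by
      rw [BoxPair.id_eq, ← sum_toSimple_fromSimple X.left, ← sum_toSimple_fromSimple X.right,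
        ← Fintype.sum_sigma', ← Fintype.sum_sigma', BoxPair.sum_hom, Fintype.sum_prod_type]
      refine Finset.sum_congr rfl fun a _ => ?_
      rw [BoxPair.hom_sum]
      rfl
    have hE : ∑ q, (Mat_.embedding (BoxPair C)).map (x q) ≫ (Mat_.embedding (BoxPair C)).map (y q) =
        𝟙 _ := by
      rw [Finset.sum_congr rfl fun q _ => ((Mat_.embedding _).map_comp (x q) (y q)).symm,
        ← Functor.map_sum, hxy, CategoryTheory.Functor.map_id]
    exact ⟨_, inferInstance, s, fun q => (Mat_.embedding (BoxPair C)).map (x q),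
      fun q => (Mat_.embedding (BoxPair C)).map (y q), hE⟩
  refine IsGeneratedBy.of_sum (ι := M.ι) (fun i => hpair (M.X i))
    (fun i => Mat_.ofEntries fun j _ => Mat_.entry (𝟙 M) j i)
    (fun i => Mat_.ofEntries fun _ j => Mat_.entry (𝟙 M) i j) ?_
  refine Mat_.ext_entry fun i j => ?_
  -- Squaring the identity matrix produces the sum over the summands of `M`; the factorisation
  -- through one summand has a single intermediate index.
  have h : Mat_.entry (𝟙 M) i j = Mat_.entry (𝟙 M ≫ 𝟙 M) i j := by rw [Category.comp_id]
  rw [h, Mat_.entry_comp]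
  have hsum : ∀ (F : M.ι → (M ⟶ M)), Mat_.entry (∑ a, F a) i j = ∑ a, Mat_.entry (F a) i j :=
    fun F => map_sum (AddMonoidHom.mk' (fun f : M ⟶ M => Mat_.entry f i j) fun _ _ => rfl) F _
  rw [hsum]
  refine Finset.sum_congr rfl fun a _ => ?_
  rw [Mat_.entry_comp]
  exact Fintype.sum_unique (ι := PUnit) _

theorem boxSquare_unit_hom (B : FrobeniusAlgebra (BoxSquare C)) (hB : B.IsCommutative)
    (hs : B.IsSimple) (z : 𝟙_ (BoxSquare C) ⟶ B.X) : ∃ c : ℂ, z = c • B.one :=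
  unit_hom_eq_smul_one isSchurFamily_boxSimple isGeneratedBy_boxSimple B hB hs z

end BoxSquare
end Ribbon

/-! ### The tensor product functor on pairs, and rotation -/

namespace BoxPair

variable {C : Type u} [Category.{v} C] [Preadditive C] [Linear ℂ C]
  [MonoidalCategory C] [MonoidalPreadditive C] [MonoidalLinear ℂ C]

/-- The action on morphisms of the functor `V × W ↦ V ⊗ W`. -/
noncomputable def toTensor (X Y : BoxPair C) :
    (X ⟶ Y) →ₗ[ℂ] (X.left ⊗ X.right ⟶ Y.left ⊗ Y.right) :=
  TensorProduct.lift (tensorHomLin X.left Y.left X.right Y.right)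

theorem toTensor_hom {X Y : BoxPair C} (f : X.left ⟶ Y.left) (g : X.right ⟶ Y.right) :
    toTensor X Y (hom f g) = f ⊗ₘ g := rfl

theorem toTensor_comp {X Y Z : BoxPair C} (f : X ⟶ Y) (g : Y ⟶ Z) :
    toTensor X Z (f ≫ g) = toTensor X Y f ≫ toTensor Y Z g := by
  induction f using hom_ind with
  | add a b ha hb => simp only [Preadditive.add_comp, map_add, ha, hb]
  | hom f f' =>
  induction g using hom_ind with
  | add a b ha hb => simp only [Preadditive.comp_add, map_add, ha, hb]
  | hom g g' => simp only [hom_comp, toTensor_hom, tensorHom_comp_tensorHom]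

variable [BraidedCategory C] [RightRigidCategory C] [RibbonCategory C]

open Ribbon

/-- The second component comes out with the inverse braiding and the inverse twist, which by
`rotate_eq_inv` is again the rotation in `C`. -/
theorem rotate_hom {X Y : BoxPair C} (f : 𝟙_ C ⟶ X.left ⊗ Y.left)
    (g : 𝟙_ C ⟶ X.right ⊗ Y.right) :
    rotate (hom f g : 𝟙_ (BoxPair C) ⟶ X ⊗ Y) = hom (rotate f) (rotate g) := by
  have h : rotate (hom f g : 𝟙_ (BoxPair C) ⟶ X ⊗ Y) =
      hom (f ≫ (β_ X.left Y.left).hom ≫ (twist Y.left ⊗ₘ 𝟙 X.left))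
        (g ≫ (β_ Y.right X.right).inv ≫ (twistInv Y.right ⊗ₘ 𝟙 X.right)) := rfl
  rw [h, rotate_eq_inv g, tensorHom_id, tensorHom_id]
  rfl

/-- The functor `T`, with its tensor structure given by the interchange of the middle factors,
commutes with rotation. By linearity it suffices to treat pure tensors, for which this is
`rotate_tensorμ`. -/
theorem toTensor_rotate_tensorμ {X Y : BoxPair C} (h : 𝟙_ (BoxPair C) ⟶ X ⊗ Y) :
    toTensor _ _ (rotate h) ≫ tensorμ Y.left X.left Y.right X.right =
      (λ_ (𝟙_ C)).hom ≫ rotate ((λ_ (𝟙_ C)).inv ≫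
        toTensor _ _ h ≫ tensorμ X.left Y.left X.right Y.right) := by
  induction h using hom_ind with
  | add a b ha hb =>
    have : rotate (a + b) = rotate a + rotate b := by simp only [rotate, Preadditive.add_comp]
    rw [this, map_add, map_add, Preadditive.add_comp, ha, hb]
    simp only [rotate, Preadditive.add_comp, Preadditive.comp_add]
  | hom f g =>
    rw [rotate_hom]
    refine Eq.trans ?_ (congrArg _ (rotate_tensorμ f g)).symm
    rw [Iso.hom_inv_id_assoc]
    rfl

end BoxPair

namespace Ribbon

/-! ### Passing back along the adjunction between `T` and `R` -/

section Untranspose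

open RibbonFusionCategory Mat_ BoxPair

variable {C : Type u} [Category.{v} C] [Abelian C] [Linear ℂ C]
    [MonoidalCategory C] [MonoidalPreadditive C] [MonoidalLinear ℂ C] [BraidedCategory C]
    [RightRigidCategory C] [RibbonCategory C] [RibbonFusionCategory C]

theorem contract_naturality {Z Z' : C} (f : Z ⟶ Z') (k : I C) :
    (f ▷ ((U k)ᘁ : C) ⊗ₘ 𝟙 (U k)) ≫ contract Z' k = contract Z k ≫ f := by
  unfold contract
  calc _ = 𝟙 _ ⊗≫ (f ▷ (((U k)ᘁ : C) ⊗ U k) ≫ Z' ◁ ε_ (U k) ((U k)ᘁ : C)) ⊗≫ 𝟙 _ := by monoidal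
    _ = _ := by rw [← whisker_exchange]; monoidal

/-- A zigzag straightens the strand `U_k`. Summed over `k` and `a` this is a triangle identity of
the adjunction. -/
theorem unitLeg_contract (X Y : C) (k : I C) (a : BasisIndex Y k) :
    (unitLeg X Y k a ⊗ₘ toSimple Y k a) ≫ contract (X ⊗ Y) k =
      X ◁ (toSimple Y k a ≫ fromSimple Y k a) := by
  unfold unitLeg contract
  generalize toSimple Y k a = t
  generalize fromSimple Y k a = f
  calc _ = X ◁ t ⊗≫ X ◁ (η_ (U k) ((U k)ᘁ : C) ▷ U k) ⊗≫
        (X ◁ (f ▷ (((U k)ᘁ : C) ⊗ U k) ≫ Y ◁ ε_ (U k) ((U k)ᘁ : C))) ⊗≫ 𝟙 _ := by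
        rw [tensorHom_def']; monoidal
    _ = X ◁ t ⊗≫ X ◁ (η_ (U k) ((U k)ᘁ : C) ▷ U k ⊗≫ U k ◁ ε_ (U k) ((U k)ᘁ : C)) ⊗≫ X ◁ f := by
        rw [← whisker_exchange]; monoidal
    _ = _ := by rw [ExactPairing.evaluation_coevaluation'']; monoidal

theorem sum_unitLeg_contract (X Y : C) :
    ∑ k : I C, ∑ a : BasisIndex Y k,
      (unitLeg X Y k a ⊗ₘ toSimple Y k a) ≫ contract (X ⊗ Y) k = 𝟙 (X ⊗ Y) := by
  simp only [unitLeg_contract]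
  rw [← MonoidalCategory.whiskerLeft_id, ← sum_toSimple_fromSimple Y]
  simp only [whiskerLeft_sum]

/-- The summand `(Z ⊗ U_kᘁ) × U_k` of `R(Z)`. -/
noncomputable abbrev rComponent (Z : C) (k : I C) : BoxPair C := ⟨Z ⊗ ((U k)ᘁ : C), U k⟩

/-- The component of a morphism to `R(Z)` at the summand `k`. -/
noncomputable def rEntry {M : BoxSquare C} {Z : C} (F : M ⟶ RObj Z) (i : M.ι) (k : I C) :
    M.X i ⟶ rComponent Z k := entry F i k

/-- The morphism `V ⊗ W ⟶ Z` obtained from `V × W ⟶ (Z ⊗ U_kᘁ) × U_k` by contraction. -/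
noncomputable def contractHom (P : BoxPair C) (Z : C) (k : I C) :
    (P ⟶ rComponent Z k) →ₗ[ℂ] (P.left ⊗ P.right ⟶ Z) :=
  (Linear.rightComp ℂ (P.left ⊗ P.right) (contract Z k)).comp (toTensor P (rComponent Z k))

theorem contractHom_apply {P : BoxPair C} {Z : C} {k : I C} (h : P ⟶ rComponent Z k) :
    contractHom P Z k h = toTensor P (rComponent Z k) h ≫ contract Z k := rfl

/-- The morphism `V ⊗ W ⟶ Z` adjoint to the component at the summand `V × W` of a morphism
to `R(Z)`. -/
noncomputable def untranspose {M : BoxSquare C} {Z : C} (F : M ⟶ RObj Z) (i : M.ι) :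
    (M.X i).left ⊗ (M.X i).right ⟶ Z :=
  ∑ k : I C, contractHom (M.X i) Z k (rEntry F i k)

theorem untranspose_smul {M : BoxSquare C} {Z : C} (c : ℂ) (F : M ⟶ RObj Z) (i : M.ι) :
    untranspose (c • F) i = c • untranspose F i := by
  rw [untranspose, untranspose, Finset.smul_sum]
  exact Finset.sum_congr rfl fun k _ => map_smul (contractHom (M.X i) Z k) c (rEntry F i k)

theorem rEntry_comp {M N : BoxSquare C} {Z : C} (G : M ⟶ N) (F : N ⟶ RObj Z) (i : M.ι)
    (k : I C) : rEntry (G ≫ F) i k = ∑ j : N.ι, entry G i j ≫ rEntry F j k := rfl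

/-- Naturality of the adjunction in the source. It lets the components of `G` be evaluated in `C`
one at a time. -/
theorem untranspose_comp {M N : BoxSquare C} {Z : C} (G : M ⟶ N) (F : N ⟶ RObj Z) (i : M.ι) :
    untranspose (G ≫ F) i = ∑ j : N.ι, toTensor _ _ (entry G i j) ≫ untranspose F j := by
  simp only [untranspose, rEntry_comp, map_sum, Preadditive.comp_sum]
  rw [Finset.sum_comm (s := Finset.univ (α := I C))]
  refine Finset.sum_congr rfl fun j _ => Finset.sum_congr rfl fun k _ => ?_
  rw [contractHom_apply, contractHom_apply, toTensor_comp, Category.assoc]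

theorem rEntry_comp_RMap {M : BoxSquare C} {Z Z' : C} (F : M ⟶ RObj Z) (f : Z ⟶ Z') (i : M.ι)
    (k : I C) : rEntry (F ≫ RMap f) i k = rEntry F i k ≫
      (BoxPair.hom (f ▷ ((U k)ᘁ : C)) (𝟙 (U k)) : rComponent Z k ⟶ rComponent Z' k) :=
  entry_comp_diag (N := RObj Z) (K := RObj Z') F (fun i => i) (fun _ _ h => h) _ i k

theorem untranspose_RMap {M : BoxSquare C} {Z Z' : C} (F : M ⟶ RObj Z) (f : Z ⟶ Z') (i : M.ι) :
    untranspose (F ≫ RMap f) i = untranspose F i ≫ f := by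
  simp only [untranspose, Preadditive.sum_comp]
  refine Finset.sum_congr rfl fun k _ => ?_
  rw [rEntry_comp_RMap, contractHom_apply, contractHom_apply, toTensor_comp, Category.assoc,
    Category.assoc, ← contract_naturality, toTensor_hom]

theorem sum_unitLeg_contract_comp (X Y Z : C) (f : X ⊗ Y ⟶ Z) :
    ∑ k : I C, ∑ a : BasisIndex Y k,
      (unitLeg X Y k a ≫ f ▷ ((U k)ᘁ : C) ⊗ₘ toSimple Y k a) ≫ contract Z k = f := by
  conv_rhs => rw [← Category.id_comp f, ← sum_unitLeg_contract]
  simp only [Preadditive.sum_comp, Category.assoc, ← contract_naturality,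
    tensorHom_comp_tensorHom_assoc, Category.comp_id]

theorem rEntry_RPhi2 (A B : C) (p : I C × I C) (k : I C) :
    rEntry (RPhi2 A B) p k = ∑ a : BasisIndex (U p.1 ⊗ U p.2 : C) k,
      (BoxPair.hom (unitLeg ((A ⊗ ((U p.1)ᘁ : C)) ⊗ (B ⊗ ((U p.2)ᘁ : C))) (U p.1 ⊗ U p.2) k a ≫
          (tensorμ (A ⊗ ((U p.1)ᘁ : C)) (B ⊗ ((U p.2)ᘁ : C)) (U p.1) (U p.2) ≫
            (contract A p.1 ⊗ₘ contract B p.2)) ▷ ((U k)ᘁ : C))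
        (toSimple (U p.1 ⊗ U p.2) k a) :
          rComponent A p.1 ⊗ rComponent B p.2 ⟶ rComponent (A ⊗ B) k) := rfl

/-- The lax constraint is by construction the transpose of the interchange followed by the two
contractions. -/
theorem untranspose_RPhi2 (A B : C) (p : I C × I C) :
    untranspose (RPhi2 A B) p =
      tensorμ (A ⊗ ((U p.1)ᘁ : C)) (B ⊗ ((U p.2)ᘁ : C)) (U p.1) (U p.2) ≫
        (contract A p.1 ⊗ₘ contract B p.2) := by
  refine Eq.trans ?_ (sum_unitLeg_contract_comp _ _ _ _)
  refine Finset.sum_congr rfl fun k _ => ?_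
  rw [rEntry_RPhi2]
  refine (map_sum (contractHom (rComponent A p.1 ⊗ rComponent B p.2) (A ⊗ B) k) _ _).trans ?_
  rfl

theorem rEntry_RPhi0 (k : I C) :
    rEntry (RPhi0 : 𝟙_ (BoxSquare C) ⟶ _) () k = ∑ a : BasisIndex (𝟙_ C) k,
      (BoxPair.hom (unitLeg (𝟙_ C) (𝟙_ C) k a ≫ (λ_ (𝟙_ C)).hom ▷ ((U k)ᘁ : C))
        (toSimple (𝟙_ C) k a) : 𝟙_ (BoxPair C) ⟶ rComponent (𝟙_ C) k) := rfl

theorem untranspose_RPhi0 :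
    untranspose (RPhi0 : 𝟙_ (BoxSquare C) ⟶ _) () = (λ_ (𝟙_ C)).hom := by
  refine Eq.trans ?_ (sum_unitLeg_contract_comp _ _ _ _)
  refine Finset.sum_congr rfl fun k _ => ?_
  rw [rEntry_RPhi0]
  refine (map_sum (contractHom (𝟙_ (BoxPair C)) (𝟙_ C) k) _ _).trans ?_
  rfl

theorem entry_rotate {M N : BoxSquare C} (H : 𝟙_ (BoxSquare C) ⟶ M ⊗ N) (q : N.ι × M.ι) :
    entry (rotate H) () q = rotate (X := M.X q.2) (Y := N.X q.1) (entry H () (q.2, q.1)) := by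
  have h : rotate H = H ≫ (braid M N).hom ≫ (twistIso N).hom ▷ M := rfl
  rw [h, whiskerRight_eq, id_eq_diag, twistIso_eq, braid_eq, diag_tensor, diag_comp_diag]
  refine (entry_comp_swap H _ () q).trans ?_
  rw [tensorHom_id]
  rfl

/-- Bending the strand `U_k` of an invariant and contracting it again. -/
theorem unitLeg_counitLeg {Z Y : C} (k : I C) (y : 𝟙_ C ⟶ Z ⊗ Y) (b : BasisIndex (𝟙_ C) k)
    (a : BasisIndex Y k) :
    unitLeg (𝟙_ C) (𝟙_ C) k b ≫ ((λ_ (𝟙_ C)).hom ≫ y) ▷ ((U k)ᘁ : C) ≫ counitLeg Z Y k a =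
      y ≫ Z ◁ (toSimple Y k a ≫ fromSimple (𝟙_ C) k b) ≫ (ρ_ Z).hom := by
  unfold unitLeg counitLeg
  generalize toSimple Y k a = t
  generalize fromSimple (𝟙_ C) k b = f
  -- The bent strand is a loop coloured `U_k`. Moving `f` around it turns it into a loop coloured
  -- `𝟙`, which is no loop at all.
  have h := ptr_cyclic ((U k)ᘁ : C) (𝟙_ C) f ((λ_ (𝟙_ C)).hom ≫ y ≫ Z ◁ t)
  have h' : ((λ_ (𝟙_ C)).hom ≫ y ≫ Z ◁ t) ≫ Z ◁ f = (y ≫ Z ◁ (t ≫ f) ≫ (ρ_ Z).hom) ▷ 𝟙_ C := by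
    monoidal
  rw [h', ptr_unit] at h
  rw [← h]
  change _ = (ρ_ _).inv ≫ _ ◁ η_ (U k) ((U k)ᘁ : C) ≫ (α_ _ _ _).inv ≫ _ ≫ (α_ _ _ _).hom ≫
    Z ◁ evTilde (U k) ≫ _
  monoidal

theorem comp_tensorHom_factor {L Y : C} (y : 𝟙_ C ⟶ L ⊗ Y) (s : Y ⟶ 𝟙_ C) (t : 𝟙_ C ⟶ Y) :
    (y ≫ L ◁ s ≫ (ρ_ L).hom ⊗ₘ t) = (λ_ (𝟙_ C)).hom ≫ y ≫ L ◁ (s ≫ t) := by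
  rw [MonoidalCategory.tensorHom_def]
  monoidal

/-- The left leg of `A ⊗ B ⟶ R(A) ⊗ R(B)` at the summand `p`. -/
noncomputable def coproductLeg (A B : C) (p : I C × I C) :
    A ⊗ B ⟶ ((A ⊗ ((U p.1)ᘁ : C)) ⊗ (B ⊗ ((U p.2)ᘁ : C))) ⊗ (U p.1 ⊗ U p.2) :=
  (expand A p.1 ⊗ₘ expand B p.2) ≫
    tensorδ (A ⊗ ((U p.1)ᘁ : C)) (B ⊗ ((U p.2)ᘁ : C)) (U p.1) (U p.2)

/-- The right leg of `R(A) ⊗ R(B) ⟶ A ⊗ B` at the summand `p`. -/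
noncomputable def productLeg (A B : C) (p : I C × I C) :
    ((A ⊗ ((U p.1)ᘁ : C)) ⊗ (B ⊗ ((U p.2)ᘁ : C))) ⊗ (U p.1 ⊗ U p.2) ⟶ A ⊗ B :=
  tensorμ (A ⊗ ((U p.1)ᘁ : C)) (B ⊗ ((U p.2)ᘁ : C)) (U p.1) (U p.2) ≫
    (contract A p.1 ⊗ₘ contract B p.2)

theorem coproductLeg_productLeg (A B : C) (p : I C × I C) (g : U p.1 ⊗ U p.2 ⟶ (U p.1 ⊗ U p.2 : C)) :
    coproductLeg A B p ≫ _ ◁ g ≫ productLeg A B p =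
      (ρ_ (A ⊗ B)).inv ≫
        (A ⊗ B) ◁ tr (U p.1 ⊗ U p.2) (((U p.2)ᘁ : C) ⊗ ((U p.1)ᘁ : C)) g ≫ (ρ_ (A ⊗ B)).hom := by
  rw [← expd_tensorδ_tensorμ_contr]
  simp only [coproductLeg, productLeg, Category.assoc]
  rfl

theorem entry_RPsi2 (A B : C) (k : I C) (p : I C × I C) :
    entry (RPsi2 A B) k p =
      (qdim (U p.1 : C) * qdim (U p.2 : C) / (qdim (U k : C) * globalDim C)) •
      ∑ a : BasisIndex (U p.1 ⊗ U p.2 : C) k,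
        (BoxPair.hom (coproductLeg A B p ▷ ((U k)ᘁ : C) ≫ counitLeg _ (U p.1 ⊗ U p.2) k a)
          (fromSimple (U p.1 ⊗ U p.2) k a) :
            rComponent (A ⊗ B) k ⟶ rComponent A p.1 ⊗ rComponent B p.2) := rfl

theorem rEntry_RPhi0_RMap {Z : C} (u : 𝟙_ C ⟶ Z) (k : I C) :
    rEntry (RPhi0 ≫ RMap u) () k = ∑ b : BasisIndex (𝟙_ C) k,
      (BoxPair.hom (unitLeg (𝟙_ C) (𝟙_ C) k b ≫ ((λ_ (𝟙_ C)).hom ≫ u) ▷ ((U k)ᘁ : C))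
        (toSimple (𝟙_ C) k b) : 𝟙_ (BoxPair C) ⟶ rComponent Z k) := by
  rw [rEntry_comp_RMap, rEntry_RPhi0]
  refine (Preadditive.sum_comp _ _ _).trans ?_
  refine Finset.sum_congr rfl fun b _ => ?_
  refine (BoxPair.hom_comp _ _ _ _).trans ?_
  rw [Category.comp_id, Category.assoc, comp_whiskerRight]

/-- An index exists only for the `k` with `U k` isomorphic to `𝟙`, because a nonzero morphism
between simple objects is invertible. -/
theorem qdim_of_basisIndex_unit (k : I C) (b : BasisIndex (𝟙_ C) k) : qdim (U k : C) = 1 := by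
  have h : fromSimple (𝟙_ C) k b ≠ 0 := by
    intro h
    have h2 := fromSimple_toSimple_self (𝟙_ C) k b
    rw [h, zero_comp] at h2
    exact id_nonzero _ h2.symm
  have := isIso_of_hom_simple h
  rw [qdim_iso (asIso (fromSimple (𝟙_ C) k b)), qdim_unit]

end Untranspose

/-! ### Rotation of the coproduct of `R(A)` on invariants -/

section Coproduct

open RibbonFusionCategory Mat_ BoxPair

variable {C : Type u} [Category.{v} C] [Abelian C] [Linear ℂ C]
    [MonoidalCategory C] [MonoidalPreadditive C] [MonoidalLinear ℂ C] [BraidedCategory C]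
    [RightRigidCategory C] [RibbonCategory C] [RibbonFusionCategory C]

theorem RMap_comp {X Y Z : C} (f : X ⟶ Y) (g : Y ⟶ Z) : RMap (f ≫ g) = RMap f ≫ RMap g := by
  refine Eq.trans ?_ (diag_comp_diag _ _ _ _).symm
  refine diag_congr (M := RObj X) (N := RObj Z) _ fun i => ?_
  refine Eq.trans ?_ (BoxPair.hom_comp _ _ _ _).symm
  exact congrArg₂ BoxPair.hom (comp_whiskerRight _ _ _) (Category.comp_id _).symm

theorem unit_comp_scalar {Z : C} (u : 𝟙_ C ⟶ Z) (s : 𝟙_ C ⟶ 𝟙_ C) :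
    u ≫ (ρ_ Z).inv ≫ Z ◁ s ≫ (ρ_ Z).hom = s ≫ u := by
  rw [rightUnitor_inv_naturality_assoc, ← whisker_exchange_assoc]
  monoidal

/-- The component of an invariant of `R(A) ⊗ R(B)` at the summand `p`. -/
noncomputable def pEntry {A B : C} (H : 𝟙_ (BoxSquare C) ⟶ RObj A ⊗ RObj B) (p : I C × I C) :
    𝟙_ (BoxPair C) ⟶ rComponent A p.1 ⊗ rComponent B p.2 := entry H () p

theorem pEntry_rotate {A B : C} (H : 𝟙_ (BoxSquare C) ⟶ RObj A ⊗ RObj B) (q : I C × I C) :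
    pEntry (rotate H) q = rotate (pEntry H (q.2, q.1)) := entry_rotate H q

theorem pEntry_RPhi0_RMap_RPsi2 {A B : C} (u : 𝟙_ C ⟶ A ⊗ B) (p : I C × I C) :
    pEntry ((RPhi0 ≫ RMap u) ≫ RPsi2 A B) p = ∑ k : I C, ∑ b : BasisIndex (𝟙_ C) k,
      (qdim (U p.1 : C) * qdim (U p.2 : C) / (qdim (U k : C) * globalDim C)) •
      ∑ a : BasisIndex (U p.1 ⊗ U p.2 : C) k,
        (BoxPair.hom ((u ≫ coproductLeg A B p) ≫
            _ ◁ (toSimple (U p.1 ⊗ U p.2) k a ≫ fromSimple (𝟙_ C) k b) ≫ (ρ_ _).hom)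
          (toSimple (𝟙_ C) k b ≫ fromSimple (U p.1 ⊗ U p.2) k a) :
            𝟙_ (BoxPair C) ⟶ rComponent A p.1 ⊗ rComponent B p.2) := by
  have h : pEntry ((RPhi0 ≫ RMap u) ≫ RPsi2 A B) p =
    ∑ k : I C, rEntry (RPhi0 ≫ RMap u) () k ≫
      (entry (RPsi2 A B) k p : rComponent (A ⊗ B) k ⟶ rComponent A p.1 ⊗ rComponent B p.2) := rfl
  rw [h]
  refine Finset.sum_congr rfl fun k _ => ?_
  rw [rEntry_RPhi0_RMap, entry_RPsi2]
  refine (Preadditive.sum_comp _ _ _).trans ?_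
  refine Finset.sum_congr rfl fun b _ => ?_
  refine (Linear.comp_smul _ _ _ _ _ _).trans ?_
  refine congrArg _ ((Preadditive.comp_sum _ _ _).trans ?_)
  refine Finset.sum_congr rfl fun a _ => ?_
  refine (BoxPair.hom_comp _ _ _ _).trans (congrArg (fun z => BoxPair.hom z _) ?_)
  refine Eq.trans ?_ (unitLeg_counitLeg k (u ≫ coproductLeg A B p) b a)
  simp only [comp_whiskerRight, Category.assoc]
  exact (Category.assoc _ _ _).trans (congrArg _ (Category.assoc _ _ _))

/-- Without rotation the coproduct leg meets the product leg with a morphism between them that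
factors through `𝟙`. Its trace is the reversed composite, where the dual basis vectors for `a`
cancel; so each `a` contributes the same, which gives the multiplicity. -/
theorem toTensor_pEntry_productLeg {A B : C} (u : 𝟙_ C ⟶ A ⊗ B) (p : I C × I C) :
    toTensor (𝟙_ (BoxPair C)) (rComponent A p.1 ⊗ rComponent B p.2)
        (pEntry ((RPhi0 ≫ RMap u) ≫ RPsi2 A B) p) ≫ productLeg A B p =
      ∑ k : I C, ∑ b : BasisIndex (𝟙_ C) k,
        (qdim (U p.1 : C) * qdim (U p.2 : C) / (qdim (U k : C) * globalDim C) *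
          mult (U p.1 ⊗ U p.2 : C) k) •
        ((λ_ (𝟙_ C)).hom ≫ (toSimple (𝟙_ C) k b ≫ fromSimple (𝟙_ C) k b) ≫ u) := by
  rw [pEntry_RPhi0_RMap_RPsi2]
  simp only [map_sum, map_smul, Preadditive.sum_comp, Linear.smul_comp]
  refine Finset.sum_congr rfl fun k _ => Finset.sum_congr rfl fun b _ => ?_
  rw [mul_smul]
  congr 1
  rw [mult, ← Finset.card_univ, Nat.cast_smul_eq_nsmul, ← Finset.sum_const]
  refine Finset.sum_congr rfl fun a _ => ?_
  rw [toTensor_hom]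
  refine (congrArg (· ≫ productLeg A B p) (comp_tensorHom_factor _ _ _)).trans ?_
  rw [Category.assoc, Category.assoc, Category.assoc, coproductLeg_productLeg, tr_factor,
    unit_comp_scalar]
  simp only [Category.assoc]
  rw [reassoc_of% fromSimple_toSimple_self (U p.1 ⊗ U p.2 : C) k a]

/-- Summing over the first index by `sum_qdim_mult` leaves `d_j² / Dim C`, and these add up to `1`.
This is what the normalisation of the second adjunction is for. -/
theorem sum_coefficient (h : globalDim C ≠ 0) (k : I C) (hk : qdim (U k : C) ≠ 0) :
    ∑ p : I C × I C, qdim (U p.1 : C) * qdim (U p.2 : C) / (qdim (U k : C) * globalDim C) *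
          mult (U p.1 ⊗ U p.2 : C) k = 1 := by
  rw [Fintype.sum_prod_type_right]
  have h1 : ∀ j : I C, ∑ i : I C, qdim (U i : C) * qdim (U j : C) /
      (qdim (U k : C) * globalDim C) * mult (U i ⊗ U j : C) k = qdim (U j : C) ^ 2 / globalDim C := by
    intro j
    have h2 : ∀ i : I C, qdim (U i : C) * qdim (U j : C) / (qdim (U k : C) * globalDim C) *
        mult (U i ⊗ U j : C) k = qdim (U j : C) / (qdim (U k : C) * globalDim C) *
          (qdim (U i : C) * mult (U i ⊗ U j : C) k) := fun i => by ring
    simp only [h2]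
    rw [← Finset.mul_sum, sum_qdim_mult]
    field_simp
  simp only [h1]
  rw [← Finset.sum_div]
  exact div_self h

theorem sum_toTensor_pEntry_productLeg (h : globalDim C ≠ 0) {A B : C} (u : 𝟙_ C ⟶ A ⊗ B) :
    ∑ p : I C × I C, toTensor (𝟙_ (BoxPair C)) (rComponent A p.1 ⊗ rComponent B p.2)
        (pEntry ((RPhi0 ≫ RMap u) ≫ RPsi2 A B) p) ≫ productLeg A B p =
      (λ_ (𝟙_ C)).hom ≫ u := by
  simp only [toTensor_pEntry_productLeg]
  rw [Finset.sum_comm]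
  have h1 : ∀ k : I C, ∑ p : I C × I C, ∑ b : BasisIndex (𝟙_ C) k,
        (qdim (U p.1 : C) * qdim (U p.2 : C) / (qdim (U k : C) * globalDim C) *
          mult (U p.1 ⊗ U p.2 : C) k) •
        ((λ_ (𝟙_ C)).hom ≫ (toSimple (𝟙_ C) k b ≫ fromSimple (𝟙_ C) k b) ≫ u) =
      ∑ b : BasisIndex (𝟙_ C) k,
        (λ_ (𝟙_ C)).hom ≫ (toSimple (𝟙_ C) k b ≫ fromSimple (𝟙_ C) k b) ≫ u := by
    intro k
    rw [Finset.sum_comm]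
    refine Finset.sum_congr rfl fun b _ => ?_
    rw [← Finset.sum_smul, sum_coefficient h k (by rw [qdim_of_basisIndex_unit k b]; exact one_ne_zero),
      one_smul]
  simp only [h1]
  conv_rhs => rw [← Category.id_comp u, ← sum_toSimple_fromSimple (𝟙_ C)]
  simp only [Preadditive.sum_comp, Preadditive.comp_sum]

/-- Since `T` commutes with rotation and rotation is natural, it can be moved outside the sum over
summands; the sum inside collapses to `u`. -/
theorem untranspose_rotate (h : globalDim C ≠ 0) {A B : C} (u : 𝟙_ C ⟶ A ⊗ B) :
    untranspose (rotate ((RPhi0 ≫ RMap u) ≫ RPsi2 A B) ≫ RPhi2 B A) () =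
      (λ_ (𝟙_ C)).hom ≫ rotate u := by
  rw [untranspose_comp]
  have h1 : ∀ q : I C × I C,
      toTensor (𝟙_ (BoxPair C)) (rComponent B q.1 ⊗ rComponent A q.2)
        (pEntry (rotate ((RPhi0 ≫ RMap u) ≫ RPsi2 A B)) q) ≫ untranspose (RPhi2 B A) q =
      (λ_ (𝟙_ C)).hom ≫ rotate ((λ_ (𝟙_ C)).inv ≫
        toTensor (𝟙_ (BoxPair C)) (rComponent A q.2 ⊗ rComponent B q.1)
        (pEntry ((RPhi0 ≫ RMap u) ≫ RPsi2 A B) (q.2, q.1)) ≫ productLeg A B (q.2, q.1)) := by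
    intro q
    rw [untranspose_RPhi2, pEntry_rotate]
    refine (Category.assoc _ _ _).symm.trans ?_
    refine (congrArg (· ≫ (contract B q.1 ⊗ₘ contract A q.2)) (toTensor_rotate_tensorμ
      (X := rComponent A q.2) (Y := rComponent B q.1) _)).trans ?_
    rw [productLeg, Category.assoc, ← rotate_naturality]
    simp only [Category.assoc]
  refine (Finset.sum_congr rfl fun q _ => h1 q).trans ?_
  -- Rotation exchanges the two summands, so the sum is reindexed by the swap.
  refine ((Equiv.prodComm (I C) (I C)).sum_comp fun p => (λ_ (𝟙_ C)).hom ≫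
    rotate ((λ_ (𝟙_ C)).inv ≫ toTensor (𝟙_ (BoxPair C)) (rComponent A p.1 ⊗ rComponent B p.2)
      (pEntry ((RPhi0 ≫ RMap u) ≫ RPsi2 A B) p) ≫ productLeg A B p)).trans ?_
  rw [← Preadditive.comp_sum]
  congr 1
  conv_rhs => rw [← Iso.inv_hom_id_assoc (λ_ (𝟙_ C)) u, ← sum_toTensor_pEntry_productLeg h u]
  simp only [rotate, Preadditive.comp_sum, Preadditive.sum_comp]

end Coproduct

/-! ### The Cardy condition on invariants -/

section Cardy

variable {C : Type u} [Category.{v} C] [Abelian C] [Linear ℂ C]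
    [MonoidalCategory C] [MonoidalPreadditive C] [MonoidalLinear ℂ C] [BraidedCategory C]
    [RightRigidCategory C] [RibbonCategory C] [ModularTensorCategory C]

/-- In a Cardy algebra with simple closed part, the image of every invariant of the open part
under `Δ`, rotation and `m` is a multiple of the unit. -/
theorem CardyAlgebra.exists_rotate_eq (A : CardyAlgebra C) (hcl : A.cl.IsSimple)
    (w : 𝟙_ C ⟶ A.op.X) : ∃ c : ℂ, rotate (w ≫ A.op.comul) ≫ A.op.mul = c • A.op.one := by
  have hD : globalDim C ≠ 0 := globalDim_ne_zero ModularTensorCategory.nondegenerate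
  -- The constant is the factor by which `ι*` sends the transpose of `w` to the unit of the closed
  -- algebra.
  obtain ⟨c, hc⟩ := boxSquare_unit_hom A.cl A.cl_commutative hcl
    ((RPhi0 ≫ RMap w) ≫ FrobeniusData.star A.cl.toFrobeniusData (RFrob A.op.toFrobeniusData) A.ι)
  refine ⟨c, ?_⟩
  have h : (RPhi0 ≫ RMap w) ≫ (RFrob A.op.toFrobeniusData).leftCentreMap =
      c • (RPhi0 ≫ RMap A.op.one) := by
    rw [← A.cardy]
    refine (Category.assoc _ _ _).symm.trans ((congrArg (· ≫ A.ι) hc).trans ?_)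
    exact (Linear.smul_comp _ _ _ _ _ _).trans (congrArg (c • ·) A.ι_isAlgebraHom.map_one)
  have hw : (RPhi0 ≫ RMap w) ≫ RMap A.op.comul = RPhi0 ≫ RMap (w ≫ A.op.comul) := by
    rw [RMap_comp, Category.assoc]
  have h2 : (RPhi0 ≫ RMap w) ≫ (RFrob A.op.toFrobeniusData).leftCentreMap =
      (rotate ((RPhi0 ≫ RMap (w ≫ A.op.comul)) ≫ RPsi2 A.op.X A.op.X) ≫
        RPhi2 A.op.X A.op.X) ≫ RMap A.op.mul := by
    rw [leftCentreMap_eq, ← hw, rotate]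
    change (RPhi0 ≫ RMap w) ≫ (RMap A.op.comul ≫ RPsi2 A.op.X A.op.X) ≫
      (β_ (RObj A.op.X) (RObj A.op.X)).hom ≫ twist (RObj A.op.X) ▷ RObj A.op.X ≫
        RPhi2 A.op.X A.op.X ≫ RMap A.op.mul = _
    simp only [Category.assoc]
  -- Two expressions for `P^l` on the transpose of `w` are brought back to `C`: one becomes the
  -- rotated coproduct multiplied out, the other `c` times the unit.
  have h3 := congrArg (fun F => untranspose F ()) (h2.symm.trans h)
  simp only [untranspose_RMap, untranspose_rotate hD, untranspose_smul, untranspose_RPhi0] at h3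
  rw [← cancel_epi (λ_ (𝟙_ C)).hom]
  simpa using h3

end Cardy

/-! ### Copairings of symmetric Frobenius algebras -/

section Frobenius

variable {V : Type u} [Category.{v} V] [MonoidalCategory V]

/-- The copairing `Δ ∘ η` of a Frobenius algebra. -/
def copairing (A : FrobeniusAlgebra V) : 𝟙_ V ⟶ A.X ⊗ A.X := A.one ≫ A.comul

theorem copairing_snake_right (A : FrobeniusAlgebra V) :
    A.X ◁ copairing A ≫ (α_ A.X A.X A.X).inv ≫ (A.mul ≫ A.counit) ▷ A.X =
      (ρ_ A.X).hom ≫ (λ_ A.X).inv := by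
  calc _ = A.X ◁ A.one ≫ (A.X ◁ A.comul ≫ (α_ A.X A.X A.X).inv ≫ A.mul ▷ A.X) ≫
        A.counit ▷ A.X := by simp [copairing]
    _ = (A.X ◁ A.one ≫ A.mul) ≫ A.comul ≫ A.counit ▷ A.X := by
        rw [A.frobenius_right]; simp only [Category.assoc]
    _ = _ := by rw [A.mul_one, A.counit_comul]

theorem copairing_snake_left (A : FrobeniusAlgebra V) :
    copairing A ▷ A.X ≫ (α_ A.X A.X A.X).hom ≫ A.X ◁ (A.mul ≫ A.counit) =
      (λ_ A.X).hom ≫ (ρ_ A.X).inv := by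
  calc _ = A.one ▷ A.X ≫ (A.comul ▷ A.X ≫ (α_ A.X A.X A.X).hom ≫ A.X ◁ A.mul) ≫
        A.X ◁ A.counit := by simp [copairing]
    _ = (A.one ▷ A.X ≫ A.mul) ≫ A.comul ≫ A.X ◁ A.counit := by
        rw [A.frobenius_left]; simp only [Category.assoc]
    _ = _ := by rw [A.one_mul, A.comul_counit]

theorem comul_eq_copairing_left (A : FrobeniusAlgebra V) :
    A.comul = (λ_ A.X).inv ≫ copairing A ▷ A.X ≫ (α_ A.X A.X A.X).hom ≫ A.X ◁ A.mul := by
  rw [copairing, comp_whiskerRight_assoc, A.frobenius_left, ← Category.assoc (A.one ▷ A.X),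
    A.one_mul, Iso.inv_hom_id_assoc]

theorem comul_eq_copairing_right (A : FrobeniusAlgebra V) :
    A.comul = (ρ_ A.X).inv ≫ A.X ◁ copairing A ≫ (α_ A.X A.X A.X).inv ≫ A.mul ▷ A.X := by
  rw [copairing, MonoidalCategory.whiskerLeft_comp_assoc, A.frobenius_right,
    ← Category.assoc (A.X ◁ A.one), A.mul_one, Iso.inv_hom_id_assoc]

/-- Since `Δ` is a module map it is determined by `Δ ∘ η`, so `m ∘ Δ` is left multiplication by the
invariant `m ∘ Δ ∘ η`. -/
theorem comul_mul_eq (A : FrobeniusAlgebra V) :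
    A.comul ≫ A.mul = (λ_ A.X).inv ≫ (copairing A ≫ A.mul) ▷ A.X ≫ A.mul := by
  conv_lhs => rw [comul_eq_copairing_left]
  rw [comp_whiskerRight_assoc, A.mul_assoc]
  simp only [Category.assoc]

theorem eq_one_comp_of_right_linear (A : FrobeniusAlgebra V) (f : A.X ⟶ A.X)
    (hf : f ▷ A.X ≫ A.mul = A.mul ≫ f) : f = (λ_ A.X).inv ≫ (A.one ≫ f) ▷ A.X ≫ A.mul := by
  rw [comp_whiskerRight_assoc, hf, ← Category.assoc (A.one ▷ A.X), A.one_mul,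
    Iso.inv_hom_id_assoc]

/-- A right-linear `f` is left multiplication by `f ∘ η`, and `Δ` is left-linear. -/
theorem one_comp_comul (A : FrobeniusAlgebra V) (f : A.X ⟶ A.X)
    (hf : f ▷ A.X ≫ A.mul = A.mul ≫ f) : (A.one ≫ f) ≫ A.comul = copairing A ≫ f ▷ A.X := by
  rw [comul_eq_copairing_right]
  calc _ = 𝟙 _ ⊗≫ ((A.one ≫ f) ▷ 𝟙_ V ≫ A.X ◁ copairing A) ⊗≫ A.mul ▷ A.X := by monoidal
    _ = copairing A ≫ ((λ_ A.X).inv ≫ (A.one ≫ f) ▷ A.X ≫ A.mul) ▷ A.X := by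
        rw [← whisker_exchange]; monoidal
    _ = _ := by rw [← eq_one_comp_of_right_linear A f hf]

variable [BraidedCategory V] [RightRigidCategory V] [RibbonCategory V]

theorem copairing_Phi (A : FrobeniusAlgebra V) :
    copairing A ≫ A.X ◁ A.Phi = η_ A.X (A.Xᘁ : V) := by
  unfold FrobeniusData.Phi
  calc _ = 𝟙 _ ⊗≫ (copairing A ▷ 𝟙_ V ≫ (A.X ⊗ A.X) ◁ η_ A.X (A.Xᘁ : V)) ⊗≫
        (A.X ◁ (A.mul ≫ A.counit)) ▷ (A.Xᘁ : V) ⊗≫ 𝟙 _ := by monoidal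
    _ = 𝟙 _ ⊗≫ η_ A.X (A.Xᘁ : V) ⊗≫ (copairing A ▷ A.X ≫ (α_ A.X A.X A.X).hom ≫
          A.X ◁ (A.mul ≫ A.counit)) ▷ (A.Xᘁ : V) ⊗≫ 𝟙 _ := by
        rw [← whisker_exchange]; monoidal
    _ = _ := by rw [copairing_snake_left]; monoidal

theorem copairing_Phi' (A : FrobeniusAlgebra V) :
    copairing A ≫ A.Phi' ▷ A.X = coevTilde A.X := by
  unfold FrobeniusData.Phi'
  calc _ = 𝟙 _ ⊗≫ (𝟙_ V ◁ copairing A ≫ coevTilde A.X ▷ (A.X ⊗ A.X)) ⊗≫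
        (A.Xᘁ : V) ◁ ((A.mul ≫ A.counit) ▷ A.X) ⊗≫ 𝟙 _ := by monoidal
    _ = 𝟙 _ ⊗≫ coevTilde A.X ⊗≫ (A.Xᘁ : V) ◁ (A.X ◁ copairing A ≫ (α_ A.X A.X A.X).inv ≫
          (A.mul ≫ A.counit) ▷ A.X) ⊗≫ 𝟙 _ := by
        rw [whisker_exchange]; monoidal
    _ = _ := by rw [copairing_snake_right]; monoidal

theorem Phi_ev (A : FrobeniusAlgebra V) :
    A.Phi ▷ A.X ≫ ε_ A.X (A.Xᘁ : V) = A.mul ≫ A.counit := by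
  unfold FrobeniusData.Phi
  calc _ = 𝟙 _ ⊗≫ A.X ◁ (η_ A.X (A.Xᘁ : V) ▷ A.X) ⊗≫ ((A.mul ≫ A.counit) ▷ ((A.Xᘁ : V) ⊗ A.X) ≫
        𝟙_ V ◁ ε_ A.X (A.Xᘁ : V)) ⊗≫ 𝟙 _ := by monoidal
    _ = 𝟙 _ ⊗≫ A.X ◁ (η_ A.X (A.Xᘁ : V) ▷ A.X ⊗≫ A.X ◁ ε_ A.X (A.Xᘁ : V)) ⊗≫
          (A.mul ≫ A.counit) := by
        rw [← whisker_exchange]; monoidal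
    _ = _ := by rw [ExactPairing.evaluation_coevaluation'']; monoidal

/-- The inverse of `Phi`, built from the copairing. -/
def PhiInv (A : FrobeniusAlgebra V) : (A.Xᘁ : V) ⟶ A.X :=
  (ρ_ _).inv ≫ (A.Xᘁ : V) ◁ copairing A ≫ (α_ _ _ _).inv ≫ ε_ A.X (A.Xᘁ : V) ▷ A.X ≫ (λ_ _).hom

theorem Phi_PhiInv (A : FrobeniusAlgebra V) : A.Phi ≫ PhiInv A = 𝟙 A.X := by
  unfold PhiInv
  calc _ = 𝟙 _ ⊗≫ (A.Phi ▷ 𝟙_ V ≫ (A.Xᘁ : V) ◁ copairing A) ⊗≫ ε_ A.X (A.Xᘁ : V) ▷ A.X ⊗≫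
        𝟙 _ := by monoidal
    _ = 𝟙 _ ⊗≫ A.X ◁ copairing A ⊗≫ (A.Phi ▷ A.X ≫ ε_ A.X (A.Xᘁ : V)) ▷ A.X ⊗≫ 𝟙 _ := by
        rw [← whisker_exchange]; monoidal
    _ = 𝟙 _ ⊗≫ (A.X ◁ copairing A ≫ (α_ A.X A.X A.X).inv ≫ (A.mul ≫ A.counit) ▷ A.X) ⊗≫ 𝟙 _ := by
        rw [Phi_ev]; monoidal
    _ = _ := by rw [copairing_snake_right]; monoidal

/-- The copairing of a symmetric Frobenius algebra is invariant under rotation. -/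
theorem rotate_copairing (A : FrobeniusAlgebra V) (hA : A.IsSymmetric) :
    rotate (copairing A) = copairing A := by
  have hA' : A.Phi = A.Phi' := hA
  have h : copairing A ≫ A.Phi ▷ A.X =
      (copairing A ≫ (β_ A.X A.X).hom ≫ A.X ◁ twist A.X) ≫ A.Phi ▷ A.X := by
    conv_lhs => rw [hA', copairing_Phi', coevTilde, ← copairing_Phi]
    simp only [Category.assoc, BraidedCategory.braiding_naturality_right_assoc, whisker_exchange]
  have h2 : copairing A = copairing A ≫ (β_ A.X A.X).hom ≫ A.X ◁ twist A.X := by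
    have := congrArg (· ≫ PhiInv A ▷ A.X) h
    simpa only [Category.assoc, ← comp_whiskerRight, Phi_PhiInv, id_whiskerRight,
      Category.comp_id] using this
  conv_rhs => rw [h2]
  rw [rotate, ← Category.assoc, unit_comp_twist_whiskerRight, Category.assoc]

/-- `Phi` carries the copairing to the coevaluation and the evaluation to `ε ∘ m`. What remains is
the rotation of the copairing, which symmetry removes; so the dimension is `ε ∘ m ∘ Δ ∘ η`. -/
theorem coev_evTilde_eq (A : FrobeniusAlgebra V) (hA : A.IsSymmetric) :
    η_ A.X (A.Xᘁ : V) ≫ evTilde A.X = copairing A ≫ A.mul ≫ A.counit := by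
  conv_rhs => rw [← rotate_copairing A hA, ← Phi_ev, rotate]
  rw [evTilde, ← copairing_Phi]
  simp only [Category.assoc]
  rw [whisker_exchange_assoc, BraidedCategory.braiding_naturality_right_assoc,
    reassoc_of% unit_comp_twist_whiskerRight (copairing A),
    BraidedCategory.braiding_naturality_right_assoc]

end Frobenius

/-! ### Averaging morphisms over the coproduct -/

section Averaging

variable {V : Type u} [Category.{v} V] [MonoidalCategory V]

/-- The averaged map `x ↦ x₁ · s(x₂)` is left-linear because `Δ` is, just as averaging over a group
produces equivariant maps. -/
theorem leftAverage_left (A : FrobeniusAlgebra V) {N : V} (a : A.X ⊗ N ⟶ N)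
    (ha : A.mul ▷ N ≫ a = (α_ A.X A.X N).hom ≫ A.X ◁ a ≫ a) (s : A.X ⟶ N) :
    A.X ◁ (A.comul ≫ A.X ◁ s ≫ a) ≫ a = A.mul ≫ A.comul ≫ A.X ◁ s ≫ a := by
  calc _ = A.X ◁ A.comul ≫ A.X ◁ A.X ◁ s ≫ (α_ A.X A.X N).inv ≫
        ((α_ A.X A.X N).hom ≫ A.X ◁ a ≫ a) := by simp
    _ = (A.X ◁ A.comul ≫ (α_ A.X A.X A.X).inv) ≫ ((A.X ⊗ A.X) ◁ s ≫ A.mul ▷ N) ≫ a := by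
        rw [← ha]; simp
    _ = (A.X ◁ A.comul ≫ (α_ A.X A.X A.X).inv ≫ A.mul ▷ A.X) ≫ A.X ◁ s ≫ a := by
        rw [whisker_exchange]; simp
    _ = _ := by rw [A.frobenius_right, Category.assoc]

theorem leftAverage_right (A : FrobeniusAlgebra V) {N : V} (a : A.X ⊗ N ⟶ N) (b : N ⊗ A.X ⟶ N)
    (hab : a ▷ A.X ≫ b = (α_ A.X N A.X).hom ≫ A.X ◁ b ≫ a) (s : A.X ⟶ N)
    (hs : s ▷ A.X ≫ b = A.mul ≫ s) :
    (A.comul ≫ A.X ◁ s ≫ a) ▷ A.X ≫ b = A.mul ≫ A.comul ≫ A.X ◁ s ≫ a := by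
  calc _ = A.comul ▷ A.X ≫ (A.X ◁ s) ▷ A.X ≫ (a ▷ A.X ≫ b) := by simp
    _ = A.comul ▷ A.X ≫ (α_ A.X A.X A.X).hom ≫ A.X ◁ (s ▷ A.X ≫ b) ≫ a := by rw [hab]; simp
    _ = (A.comul ▷ A.X ≫ (α_ A.X A.X A.X).hom ≫ A.X ◁ A.mul) ≫ A.X ◁ s ≫ a := by rw [hs]; simp
    _ = _ := by rw [A.frobenius_left, Category.assoc]

theorem rightAverage_right (A : FrobeniusAlgebra V) {N : V} (b : N ⊗ A.X ⟶ N)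
    (hb : N ◁ A.mul ≫ b = (α_ N A.X A.X).inv ≫ b ▷ A.X ≫ b) (s : A.X ⟶ N) :
    (A.comul ≫ s ▷ A.X ≫ b) ▷ A.X ≫ b = A.mul ≫ A.comul ≫ s ▷ A.X ≫ b := by
  calc _ = A.comul ▷ A.X ≫ (s ▷ A.X) ▷ A.X ≫ (α_ N A.X A.X).hom ≫
        ((α_ N A.X A.X).inv ≫ b ▷ A.X ≫ b) := by simp
    _ = (A.comul ▷ A.X ≫ (α_ A.X A.X A.X).hom) ≫ (s ▷ (A.X ⊗ A.X) ≫ N ◁ A.mul) ≫ b := by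
        rw [← hb]; simp
    _ = (A.comul ▷ A.X ≫ (α_ A.X A.X A.X).hom ≫ A.X ◁ A.mul) ≫ s ▷ A.X ≫ b := by
        rw [← whisker_exchange]; simp
    _ = _ := by rw [A.frobenius_left, Category.assoc]

/-- For `x` in the image of `i`, the second leg of `Δ(x)` lies there too, since that image is a left
ideal. There `i ∘ s` acts as the identity, and the average reduces to `m ∘ Δ`. -/
theorem comp_leftAverage_comp (A : FrobeniusAlgebra V) {N : V} (a : A.X ⊗ N ⟶ N) (i : N ⟶ A.X)
    (hi : a ≫ i = A.X ◁ i ≫ A.mul) (s : A.X ⟶ N) (hs : i ≫ s ≫ i = i) :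
    i ≫ (A.comul ≫ A.X ◁ s ≫ a) ≫ i = i ≫ A.comul ≫ A.mul := by
  have h : i ≫ A.comul = (λ_ N).inv ≫ copairing A ▷ N ≫ (α_ A.X A.X N).hom ≫ A.X ◁ (a ≫ i) := by
    rw [hi]
    conv_lhs => rw [comul_eq_copairing_left]
    calc _ = 𝟙 _ ⊗≫ (𝟙_ V ◁ i ≫ copairing A ▷ A.X) ⊗≫ A.X ◁ A.mul := by monoidal
      _ = _ := by rw [whisker_exchange]; monoidal
  simp only [Category.assoc]
  rw [hi, reassoc_of% h, reassoc_of% h]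
  simp only [← MonoidalCategory.whiskerLeft_comp_assoc, Category.assoc, hs]

theorem comp_rightAverage_comp (A : FrobeniusAlgebra V) {N : V} (b : N ⊗ A.X ⟶ N) (i : N ⟶ A.X)
    (hi : b ≫ i = i ▷ A.X ≫ A.mul) (s : A.X ⟶ N) (hs : i ≫ s ≫ i = i) :
    i ≫ (A.comul ≫ s ▷ A.X ≫ b) ≫ i = i ≫ A.comul ≫ A.mul := by
  have h : i ≫ A.comul = (ρ_ N).inv ≫ N ◁ copairing A ≫ (α_ N A.X A.X).inv ≫ (b ≫ i) ▷ A.X := by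
    rw [hi]
    conv_lhs => rw [comul_eq_copairing_right]
    calc _ = 𝟙 _ ⊗≫ (i ▷ 𝟙_ V ≫ A.X ◁ copairing A) ⊗≫ A.mul ▷ A.X := by monoidal
      _ = _ := by rw [← whisker_exchange]; monoidal
  simp only [Category.assoc]
  rw [hi, reassoc_of% h, reassoc_of% h]
  simp only [← comp_whiskerRight_assoc, Category.assoc, hs]

end Averaging

/-! ### Separability and simplicity -/

section Simple

variable {E : Type u} [Category.{v} E] [MonoidalCategory E] [Preadditive E]
  [MonoidalPreadditive E] [Linear ℂ E] [MonoidalLinear ℂ E]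

/-- If `m ∘ Δ` is invertible, then a regular bimodule morphism to `A` is regular as a bimodule
morphism. -/
theorem exists_bimodule_retraction (A : FrobeniusAlgebra E) {l : ℂ} (hl : l ≠ 0)
    (hA : A.comul ≫ A.mul = l • 𝟙 A.X) {N : E} (a : A.X ⊗ N ⟶ N) (b : N ⊗ A.X ⟶ N)
    (ha : A.mul ▷ N ≫ a = (α_ A.X A.X N).hom ≫ A.X ◁ a ≫ a)
    (hb : N ◁ A.mul ≫ b = (α_ N A.X A.X).inv ≫ b ▷ A.X ≫ b)
    (hab : a ▷ A.X ≫ b = (α_ A.X N A.X).hom ≫ A.X ◁ b ≫ a)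
    (i : N ⟶ A.X) (hil : a ≫ i = A.X ◁ i ≫ A.mul) (hir : b ≫ i = i ▷ A.X ≫ A.mul)
    (hreg : ∃ s : A.X ⟶ N, i ≫ s ≫ i = i) :
    ∃ r : A.X ⟶ N, A.X ◁ r ≫ a = A.mul ≫ r ∧ r ▷ A.X ≫ b = A.mul ≫ r ∧ i ≫ r ≫ i = i := by
  obtain ⟨s, hs⟩ := hreg
  -- Average first over the right action and then over the left one; the second average preserves
  -- right linearity. The factor `l⁻¹` compensates `m ∘ Δ = l id` each time.
  obtain ⟨t, ht, hti⟩ : ∃ t : A.X ⟶ N, t ▷ A.X ≫ b = A.mul ≫ t ∧ i ≫ t ≫ i = i := by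
    refine ⟨l⁻¹ • (A.comul ≫ s ▷ A.X ≫ b), ?_, ?_⟩
    · rw [MonoidalLinear.smul_whiskerRight, Linear.smul_comp, Linear.comp_smul,
        rightAverage_right A b hb]
    · rw [Linear.smul_comp, Linear.comp_smul, comp_rightAverage_comp A b i hir s hs, hA,
        Linear.comp_smul, Category.comp_id, smul_smul, inv_mul_cancel₀ hl, one_smul]
  refine ⟨l⁻¹ • (A.comul ≫ A.X ◁ t ≫ a), ?_, ?_, ?_⟩
  · rw [MonoidalLinear.whiskerLeft_smul, Linear.smul_comp, Linear.comp_smul,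
      leftAverage_left A a ha]
  · rw [MonoidalLinear.smul_whiskerRight, Linear.smul_comp, Linear.comp_smul,
      leftAverage_right A a b hab t ht]
  · rw [Linear.smul_comp, Linear.comp_smul, comp_leftAverage_comp A a i hil t hti, hA,
      Linear.comp_smul, Category.comp_id, smul_smul, inv_mul_cancel₀ hl, one_smul]

/-- A Frobenius algebra with `m ∘ Δ` invertible, whose only bimodule endomorphisms are the
scalars, is simple, if morphisms are von Neumann regular. -/
theorem isSimple_of_scalar_endomorphisms (A : FrobeniusAlgebra E) {l : ℂ} (hl : l ≠ 0)
    (hA : A.comul ≫ A.mul = l • 𝟙 A.X) (hid : 𝟙 A.X ≠ 0)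
    (hend : ∀ f : A.X ⟶ A.X, A.X ◁ f ≫ A.mul = A.mul ≫ f → f ▷ A.X ≫ A.mul = A.mul ≫ f →
      ∃ c : ℂ, f = c • 𝟙 A.X)
    (hreg : ∀ {X Y : E} (f : X ⟶ Y), ∃ g : Y ⟶ X, f ≫ g ≫ f = f) : A.IsSimple := by
  refine ⟨fun {M} i hi => ⟨fun hiso h0 => ?_, fun h0 => ?_⟩⟩
  · refine hid ?_
    have h1 : 𝟙 (Bimod.regular A.toMon) = 0 := by
      rw [← IsIso.inv_hom_id i]
      exact (congrArg (inv i ≫ ·) h0).trans comp_zero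
    exact congrArg Bimod.Hom.hom h1
  · obtain ⟨j, hj⟩ : ∃ j : M.X ⟶ A.X, j = i.hom := ⟨i.hom, rfl⟩
    have hj0 : j ≠ 0 := fun h => h0 (Bimod.hom_ext _ _ (hj.symm.trans h))
    have hjl : M.actLeft ≫ j = A.X ◁ j ≫ A.mul := by
      rw [hj]; exact i.left_act_hom
    have hjr : M.actRight ≫ j = j ▷ A.X ≫ A.mul := by
      rw [hj]; exact i.right_act_hom
    obtain ⟨r, hrl, hrr, hr⟩ := exists_bimodule_retraction A hl hA M.actLeft M.actRight
      M.left_assoc M.right_assoc M.middle_assoc j hjl hjr (hreg j)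
    -- The projection of `A` onto the subbimodule is a bimodule endomorphism, hence a scalar, and `j
    -- ≫ r ≫ j = j` with `j ≠ 0` forces this scalar to be `1`; so the inclusion is onto.
    obtain ⟨c, hc⟩ := hend (r ≫ j)
      (by
        rw [MonoidalCategory.whiskerLeft_comp_assoc, ← reassoc_of% hrl, ← hjl]
        exact (Category.assoc _ _ _).symm)
      (by
        rw [comp_whiskerRight_assoc, ← reassoc_of% hrr, ← hjr]
        exact (Category.assoc _ _ _).symm)
    have hc1 : c = 1 := by
      rw [hc, Linear.comp_smul, Category.comp_id] at hr
      have h1 : (c - 1) • j = 0 := by rw [sub_smul, hr, one_smul, sub_self]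
      exact sub_eq_zero.1 ((smul_eq_zero.1 h1).resolve_right hj0)
    rw [hc1, one_smul] at hc
    let ρ : Bimod.regular A.toMon ⟶ M :=
      { hom := r
        left_act_hom := hrl.symm
        right_act_hom := hrr.symm }
    have hρ : ρ ≫ i = 𝟙 _ := Bimod.hom_ext _ _ ((congrArg (r ≫ ·) hj.symm).trans hc)
    refine ⟨ρ, ?_, hρ⟩
    rw [← cancel_mono i, Category.assoc, hρ, Category.comp_id, Category.id_comp]

end Simple

/-! ### Conclusion for the open algebra -/

section Cardy

variable {C : Type u} [Category.{v} C] [Abelian C] [Linear ℂ C]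
    [MonoidalCategory C] [MonoidalPreadditive C] [MonoidalLinear ℂ C] [BraidedCategory C]
    [RightRigidCategory C] [RibbonCategory C] [RibbonFusionCategory C]

/-- The hypothesis `h` is all that is needed from the closed sector. It is used for `w = η`, which
gives specialness, and for `w = f ∘ η` with `f` a bimodule endomorphism, which gives simplicity. -/
theorem isSimple_and_isSpecial (A : FrobeniusAlgebra C) (hA : A.IsSymmetric)
    (hdim : qdim A.X ≠ 0)
    (h : ∀ w : 𝟙_ C ⟶ A.X, ∃ c : ℂ, rotate (w ≫ A.comul) ≫ A.mul = c • A.one) :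
    A.IsSimple ∧ A.IsSpecial := by
  obtain ⟨l, hl⟩ := h A.one
  change rotate (copairing A) ≫ A.mul = l • A.one at hl
  rw [rotate_copairing A hA] at hl
  have hξ := scalar_smul_id (A.one ≫ A.counit)
  set ξ := scalar (A.one ≫ A.counit)
  -- The dimension is `ε ∘ (m ∘ Δ ∘ η) = l (ε ∘ η)`, so neither factor can vanish.
  have hprod : l * ξ = qdim A.X := by
    refine smul_id_injective (𝟙_ C) ?_
    have h1 : qdim A.X • 𝟙 (𝟙_ C) = _ := scalar_smul_id _
    rw [h1, coev_evTilde_eq A hA, reassoc_of% hl, Linear.smul_comp, ← hξ, smul_smul]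
  have hl0 : l ≠ 0 := fun h0 => hdim (by rw [← hprod, h0, zero_mul])
  have hξ0 : ξ ≠ 0 := fun h0 => hdim (by rw [← hprod, h0, mul_zero])
  have hsep : A.comul ≫ A.mul = l • 𝟙 A.X := by
    rw [comul_mul_eq, hl, MonoidalLinear.smul_whiskerRight, Linear.smul_comp, Linear.comp_smul,
      A.one_mul, Iso.inv_hom_id]
  refine ⟨isSimple_of_scalar_endomorphisms A hl0 hsep ?_ ?_ ?_, l, ξ, hl0, hξ0, hsep, hξ.symm⟩
  · intro h0
    apply hξ0
    refine smul_id_injective (𝟙_ C) ?_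
    rw [hξ, ← Category.id_comp A.counit, h0, zero_comp, comp_zero, zero_smul]
  · intro f hfl hfr
    obtain ⟨c, hc⟩ := h (A.one ≫ f)
    -- Rotation moves `f` to the other leg of the invariant copairing. Left linearity then pulls it
    -- out of `m`, and the hypothesis reads `l f ∘ η = c η`.
    have h1 : rotate (copairing A ≫ (f ⊗ₘ 𝟙 A.X)) = copairing A ≫ (𝟙 A.X ⊗ₘ f) := by
      rw [rotate_naturality, rotate_copairing A hA]
    rw [tensorHom_id, id_tensorHom, ← one_comp_comul A f hfr] at h1
    rw [h1, Category.assoc, hfl, reassoc_of% hl, Linear.smul_comp] at hc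
    refine ⟨l⁻¹ * c, ?_⟩
    have h2 : A.one ≫ f = (l⁻¹ * c) • A.one := by
      rw [mul_smul, ← hc, smul_smul, inv_mul_cancel₀ hl0, one_smul]
    rw [eq_one_comp_of_right_linear A f hfr, h2, MonoidalLinear.smul_whiskerRight,
      Linear.smul_comp, Linear.comp_smul, A.one_mul, Iso.inv_hom_id]
  · exact fun f => isSchurFamily_U.exists_regular (isGeneratedBy_U _) (isGeneratedBy_U _) f

end Cardy
end Ribbon

theorem proposition3 {C : Type u} [Category.{v} C] [Abelian C] [Linear ℂ C]
    [MonoidalCategory C] [MonoidalPreadditive C] [MonoidalLinear ℂ C] [BraidedCategory C]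
    [RightRigidCategory C] [RibbonCategory C] [ModularTensorCategory C]
    (A : CardyAlgebra C) (hcl : A.cl.IsSimple) (hdim : qdim A.op.X ≠ 0) :
    A.op.IsSimple ∧ A.op.IsSpecial :=
  Ribbon.isSimple_and_isSpecial A.op A.op_symmetric hdim
    (Ribbon.CardyAlgebra.exists_rotate_eq A hcl)
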